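/- A \emph{Cantor group} is a totally disconnected compact Abelian topological group with no isolated points. A \emph{translation} of a Cantor group $\Omega$ is a map $T:\Omega\to\Omega$ of the form $T\omega=\omega+\alpha$ for some $\alpha\in\Omega$; it is \emph{minimal} if the orbit $\{T^n\omega : n\in\mathbb{Z}\}$ of every $\omega\in\Omega$ is dense in $\Omega$. A \emph{Cantor set} is a closed subset of $\mathbb{R}$ with empty interior and no isolated points. For $f\in C(\Omega,\mathbb{R})$ and $\omega\in\Omega$, let $H_\omega$ be the bounded self-adjoint operator on $\ell^2(\mathbb{Z})$ given by $$[H_\omega\psi](n)=\psi(n+1)+\psi(n-1)+f(T^n\omega)\,\psi(n),\qquad n\in\mathbb{Z}.$$ The operator $H_\omega$ has \emph{purely absolutely continuous} (respectively, \emph{purely singular continuous}) spectrum if for every $\psi\in\ell^2(\mathbb{Z})$ the spectral measure of $H_\omega$ and $\psi$ is absolutely continuous with respect to Lebesgue measure (respectively, is singular with respect to Lebesgue measure and has no atoms). \textbf{Theorem.} Suppose $\Omega$ is a Cantor group and $T:\Omega\to\Omega$ is a minimal translation. Equip $C(\Omega,\mathbb{R})$ with the topology of uniform convergence. (a) There is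 a dense set of $f\in C(\Omega,\mathbb{R})$ such that, for every $f$ in this set and every $\omega\in\Omega$, the spectrum of $H_\omega$ is a Cantor set of positive Lebesgue measure and $H_\omega$ has purely absolutely continuous spectrum. (b) There is a dense $G_\delta$ set of $f\in C(\Omega,\mathbb{R})$ such that, for every $f$ in this set and every $\omega\in\Omega$, the spectrum of $H_\omega$ is a Cantor set of zero Lebesgue measure and $H_\omega$ has purely singular continuous spectrum. -/

import Mathlib

open scoped lp ENNReal CompactlySupported InnerProductSpace
open MeasureTheory

/-- A Cantor group: a totally disconnected compact Abelian topological group without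
isolated points. (The Hausdorff property is a consequence.) -/
class IsCantorGroup (Ω : Type*) [AddCommGroup Ω] [TopologicalSpace Ω] : Prop extends
    IsTopologicalAddGroup Ω, CompactSpace Ω, TotallyDisconnectedSpace Ω, PerfectSpace Ω

/-- A translation is a map of the form `T ω = ω + α`. -/
def IsTranslation {Ω : Type*} [AddCommGroup Ω] [TopologicalSpace Ω] (T : Ω ≃ₜ Ω) : Prop :=
  ∃ α : Ω, ∀ ω : Ω, T ω = ω + α

/-- Minimality: all two-sided orbits are dense. Here `T ^ n` is the iterate of the
homeomorphism `T`, with `n` possibly negative. -/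
def IsMinimalHomeo {Ω : Type*} [TopologicalSpace Ω] (T : Ω ≃ₜ Ω) : Prop :=
  ∀ ω : Ω, Dense (Set.range fun n : ℤ => (T ^ n) ω)

/-- A Cantor set of real numbers: closed, with empty interior and no isolated points
(`Perfect` means closed and without isolated points). -/
def IsCantorSet (K : Set ℝ) : Prop :=
  Perfect K ∧ interior K = ∅

section Schrodinger

/-- Translation by `m` on square-summable sequences preserves square-summability. -/
lemma memℓp_comp_add_right (ψ : ℓ^2(ℤ, ℂ)) (m : ℤ) :
    Memℓp (fun n : ℤ => ψ (n + m)) 2 := by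
  have h := (memℓp_gen_iff (p := 2) (by norm_num)).1 (lp.memℓp ψ)
  exact memℓp_gen ((Equiv.addRight m).summable_iff.2 h)

/-- The shift `(shift m ψ)(n) = ψ (n + m)` on `ℓ²(ℤ)`. -/
noncomputable def lpShift (m : ℤ) : ℓ^2(ℤ, ℂ) →L[ℂ] ℓ^2(ℤ, ℂ) :=
  LinearMap.mkContinuous
    { toFun := fun ψ => ⟨fun n => ψ (n + m), memℓp_comp_add_right ψ m⟩
      map_add' := fun _ _ => rfl
      map_smul' := fun _ _ => rfl } 1 (by
    intro ψ
    rw [one_mul, lp.norm_eq_tsum_rpow (by norm_num), lp.norm_eq_tsum_rpow (by norm_num)]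
    exact le_of_eq (congrArg (· ^ _)
      ((Equiv.addRight m).tsum_eq fun n => ‖ψ n‖ ^ (2 : ℝ≥0∞).toReal)))

lemma norm_potential_mul_le (V : ℓ^∞(ℤ, ℝ)) (ψ : ℓ^2(ℤ, ℂ)) (n : ℤ) :
    ‖(V n : ℂ) * ψ n‖ ≤ ‖((‖V‖ : ℂ) • ψ) n‖ := by
  rw [lp.coeFn_smul, Pi.smul_apply, norm_mul, smul_eq_mul, norm_mul, Complex.norm_real,
    Complex.norm_real, norm_norm]
  exact mul_le_mul_of_nonneg_right (lp.norm_apply_le_norm (by simp) V n) (norm_nonneg _)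

/-- Multiplication by a bounded real sequence on `ℓ²(ℤ)`. -/
noncomputable def lpMultiplication (V : ℓ^∞(ℤ, ℝ)) : ℓ^2(ℤ, ℂ) →L[ℂ] ℓ^2(ℤ, ℂ) :=
  LinearMap.mkContinuous
    { toFun := fun ψ => ⟨fun n => (V n : ℂ) * ψ n,
        Memℓp.mono' (lp.memℓp ((‖V‖ : ℂ) • ψ)) (norm_potential_mul_le V ψ)⟩
      map_add' := fun _ _ => by ext n; exact mul_add _ _ _
      map_smul' := fun _ _ => by ext n; exact mul_left_comm _ _ _ } ‖V‖ (by
    intro ψ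
    refine (lp.norm_mono (by norm_num) (norm_potential_mul_le V ψ)).trans ?_
    rw [norm_smul, Complex.norm_real, norm_norm])

/-- The discrete Schrödinger operator with bounded real potential `V` on `ℓ²(ℤ)`,
`(H ψ)(n) = ψ (n + 1) + ψ (n - 1) + V n * ψ n`. -/
noncomputable def schrodinger (V : ℓ^∞(ℤ, ℝ)) : ℓ^2(ℤ, ℂ) →L[ℂ] ℓ^2(ℤ, ℂ) :=
  lpShift 1 + lpShift (-1) + lpMultiplication V

lemma schrodinger_apply (V : ℓ^∞(ℤ, ℝ)) (ψ : ℓ^2(ℤ, ℂ)) (n : ℤ) :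
    schrodinger V ψ n = ψ (n + 1) + ψ (n - 1) + (V n : ℂ) * ψ n := rfl

lemma inner_lpShift_left (m : ℤ) (φ ψ : ℓ^2(ℤ, ℂ)) :
    ⟪lpShift m φ, ψ⟫_ℂ = ⟪φ, lpShift (-m) ψ⟫_ℂ := by
  rw [lp.inner_eq_tsum, lp.inner_eq_tsum, ← (Equiv.addRight m).tsum_eq
    fun n => ⟪φ n, lpShift (-m) ψ n⟫_ℂ]
  refine tsum_congr fun n => ?_
  change ⟪φ (n + m), ψ n⟫_ℂ = ⟪φ (n + m), ψ (n + m + -m)⟫_ℂ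
  rw [add_neg_cancel_right]

lemma inner_lpMultiplication_left (V : ℓ^∞(ℤ, ℝ)) (φ ψ : ℓ^2(ℤ, ℂ)) :
    ⟪lpMultiplication V φ, ψ⟫_ℂ = ⟪φ, lpMultiplication V ψ⟫_ℂ := by
  rw [lp.inner_eq_tsum, lp.inner_eq_tsum]
  refine tsum_congr fun n => ?_
  change ⟪(V n : ℂ) * φ n, ψ n⟫_ℂ = ⟪φ n, (V n : ℂ) * ψ n⟫_ℂ
  simp only [RCLike.inner_apply, map_mul, Complex.conj_ofReal]
  ring

lemma isSelfAdjoint_schrodinger (V : ℓ^∞(ℤ, ℝ)) : IsSelfAdjoint (schrodinger V) := by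
  rw [ContinuousLinearMap.isSelfAdjoint_iff_isSymmetric]
  intro φ ψ
  have h1 := inner_lpShift_left 1 φ ψ
  have h2 := inner_lpShift_left (-1) φ ψ
  have h3 := inner_lpMultiplication_left V φ ψ
  rw [neg_neg] at h2
  change ⟪lpShift 1 φ + lpShift (-1) φ + lpMultiplication V φ, ψ⟫_ℂ =
    ⟪φ, lpShift 1 ψ + lpShift (-1) ψ + lpMultiplication V ψ⟫_ℂ
  simp only [inner_add_left, inner_add_right, h1, h2, h3]
  ring

end Schrodinger

section SpectralMeasure

variable {H : Type*} [NormedAddCommGroup H] [InnerProductSpace ℂ H] [CompleteSpace H]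

/-- The positive functional `g ↦ ⟪ψ, g(A) ψ⟫` on compactly supported continuous functions, for a
bounded self-adjoint operator `A`, where `g(A)` is the continuous functional calculus. -/
noncomputable def spectralFunctional (A : H →L[ℂ] H) (_hA : IsSelfAdjoint A) (ψ : H) :
    C_c(ℝ, ℝ) →ₚ[ℝ] ℝ :=
  PositiveLinearMap.mk₀
    { toFun := fun g => (⟪ψ, cfc (g : ℝ → ℝ) A ψ⟫_ℂ).re
      map_add' := fun g h => by
        have := cfc_add (a := A) (g : ℝ → ℝ) (h : ℝ → ℝ)
          g.continuous.continuousOn h.continuous.continuousOn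
        change (⟪ψ, cfc (fun x => g x + h x) A ψ⟫_ℂ).re = _
        rw [this, add_apply, inner_add_right, Complex.add_re]
      map_smul' := fun c g => by
        have := cfc_smul c (g : ℝ → ℝ) A g.continuous.continuousOn
        change (⟪ψ, cfc (fun x => c • g x) A ψ⟫_ℂ).re = _
        rw [this, smul_apply, inner_smul_right_eq_smul, Complex.smul_re]
        rfl }
    (fun g hg => by
      have h : (0 : H →L[ℂ] H) ≤ cfc (g : ℝ → ℝ) A := cfc_nonneg fun x _ => hg x
      rw [ContinuousLinearMap.nonneg_iff_isPositive] at h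
      exact h.re_inner_nonneg_right ψ)

/-- The spectral measure of a bounded self-adjoint operator `A` at the vector `ψ`: the Borel measure
`μ` on the real line with `∫ g dμ = ⟪ψ, g(A) ψ⟫` for every `g` continuous with compact support. -/
noncomputable def spectralMeasure (A : H →L[ℂ] H) (hA : IsSelfAdjoint A) (ψ : H) : Measure ℝ :=
  RealRMK.rieszMeasure (spectralFunctional A hA ψ)

lemma integral_spectralMeasure (A : H →L[ℂ] H) (hA : IsSelfAdjoint A) (ψ : H) (g : C_c(ℝ, ℝ)) :
    ∫ x, g x ∂(spectralMeasure A hA ψ) = (⟪ψ, cfc (g : ℝ → ℝ) A ψ⟫_ℂ).re :=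
  RealRMK.integral_rieszMeasure _ g

/-- All spectral measures are absolutely continuous with respect to Lebesgue measure. -/
def HasPurelyACSpectrum (A : H →L[ℂ] H) (hA : IsSelfAdjoint A) : Prop :=
  ∀ ψ : H, spectralMeasure A hA ψ ≪ volume

/-- All spectral measures are singular continuous: singular with respect to Lebesgue measure, and
without atoms. -/
def HasPurelySCSpectrum (A : H →L[ℂ] H) (hA : IsSelfAdjoint A) : Prop :=
  ∀ ψ : H, spectralMeasure A hA ψ ⟂ₘ volume ∧ ∀ E : ℝ, spectralMeasure A hA ψ {E} = 0

end SpectralMeasure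

section Family

variable {Ω : Type*} [TopologicalSpace Ω] [CompactSpace Ω]

/-- The bounded potential `V_ω(n) = f (T ^ n ω)`. -/
noncomputable def dynPotential (T : Ω ≃ₜ Ω) (f : C(Ω, ℝ)) (ω : Ω) : ℓ^∞(ℤ, ℝ) :=
  ⟨fun n => f ((T ^ n) ω), memℓp_infty ⟨‖f‖, by
    rintro _ ⟨n, rfl⟩
    exact f.norm_coe_le_norm _⟩⟩

/-- The Schrödinger operator `H_ω` with potential `V_ω(n) = f (T ^ n ω)`. -/
noncomputable def dynSchrodinger (T : Ω ≃ₜ Ω) (f : C(Ω, ℝ)) (ω : Ω) :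
    ℓ^2(ℤ, ℂ) →L[ℂ] ℓ^2(ℤ, ℂ) :=
  schrodinger (dynPotential T f ω)

lemma isSelfAdjoint_dynSchrodinger (T : Ω ≃ₜ Ω) (f : C(Ω, ℝ)) (ω : Ω) :
    IsSelfAdjoint (dynSchrodinger T f ω) :=
  isSelfAdjoint_schrodinger _

lemma dynSchrodinger_apply (T : Ω ≃ₜ Ω) (f : C(Ω, ℝ)) (ω : Ω) (ψ : ℓ^2(ℤ, ℂ)) (n : ℤ) :
    dynSchrodinger T f ω ψ n = ψ (n + 1) + ψ (n - 1) + (f ((T ^ n) ω) : ℂ) * ψ n := rfl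

end Family

/-!
A compact totally disconnected group has arbitrarily small open subgroups, all of finite index, so
the sampling functions that give rise to periodic potentials are dense in `C(Ω, ℝ)`. Both parts
perturb such functions.

For a potential of period `N` the spectrum is `{E | |Δ E| ≤ 2}`, where the discriminant `Δ` is the
trace of the transfer matrix over one period. Any given energy can be moved into a gap by a small
perturbation of larger period, and by compactness finitely many of these perturbations serve all
energies. Letting them act one after the other along one very long period yields, at every energy,
a block on which the transfer matrices are huge; then `Δ` varies fast on the bands and the new
spectrum has small measure. Hence the functions with small spectrum form a dense open set, and
generically the spectrum has measure zero. Generically the potential is moreover approximated so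
well by periodic ones that Gordon's argument excludes eigenvalues, which leaves purely singular
continuous spectrum.

For the absolutely continuous part, gaps are opened one by one in a sequence of prescribed
intervals. The spectral measure of the origin in a periodic potential has density `|Im G| / π`, and
this density depends continuously, in `L¹`, on the potential of a fixed period. So the
perturbations can be chosen with summable changes in total variation, and the limiting spectral
measure is still absolutely continuous although no interval is left in the spectrum.

In both cases there are no eigenvalues, hence no isolated points in the spectrum.
-/

section TestFunctions

open Filter Topology

variable {X : Type*} [TopologicalSpace X] [MeasurableSpace X] [OpensMeasurableSpace X]

lemma lintegral_ofReal_compactlySupported (m : Measure X) [IsFiniteMeasureOnCompacts m]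
    {g : C_c(X, ℝ)} (hg : ∀ x, 0 ≤ g x) :
    ∫⁻ x, ENNReal.ofReal (g x) ∂m = ENNReal.ofReal (∫ x, g x ∂m) :=
  (ofReal_integral_eq_lintegral_ofReal
    (g.continuous.integrable_of_hasCompactSupport g.hasCompactSupport)
    (Eventually.of_forall hg)).symm

lemma lintegral_ofReal_le_measure_of_tsupport_subset (m : Measure X) {O : Set X} (hO : IsOpen O)
    {g : X → ℝ} (hg1 : ∀ x, g x ≤ 1) (hgO : tsupport g ⊆ O) :
    ∫⁻ x, ENNReal.ofReal (g x) ∂m ≤ m O := by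
  rw [← lintegral_indicator_one hO.measurableSet]
  refine lintegral_mono fun x => ?_
  by_cases hx : x ∈ O
  · simpa [hx] using hg1 x
  · simp [hx, image_eq_zero_of_notMem_tsupport fun h => hx (hgO h)]

lemma measure_le_of_forall_lintegral_ofReal_le {X : Type*} [TopologicalSpace X]
    [LocallyCompactSpace X] [SigmaCompactSpace X] [TopologicalSpace.PseudoMetrizableSpace X]
    [MeasurableSpace X] [BorelSpace X] (m : Measure X) {O : Set X} (hO : IsOpen O) {c : ℝ≥0∞}
    (h : ∀ g : C_c(X, ℝ), (∀ x, 0 ≤ g x) → (∀ x, g x ≤ 1) → tsupport g ⊆ O →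
      ∫⁻ x, ENNReal.ofReal (g x) ∂m ≤ c) : m O ≤ c := by
  have hreg := (Measure.InnerRegularWRT.isCompact_isClosed m).trans
    (Measure.InnerRegularWRT.of_pseudoMetrizableSpace m)
  rw [hreg.measure_eq_iSup hO]
  refine iSup₂_le fun K hKO => iSup_le fun hK => ?_
  obtain ⟨f, hf1, hfc, hfO, hf⟩ := exists_continuousMap_one_of_isCompact_subset_isOpen hK hO hKO
  refine le_trans ?_ (h ⟨f, hfc⟩ (fun x => (hf x).1) (fun x => (hf x).2) hfO)
  refine meas_le_lintegral₀ (by fun_prop) fun x hx => ?_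
  change 1 ≤ ENNReal.ofReal (f x)
  simp [hf1 hx]

end TestFunctions

section SpectralTheory

open Filter Topology

lemma exists_mem_spectrum_abs_sub_le {𝓐 : Type*} [CStarAlgebra 𝓐] {a b : 𝓐} (hb : IsSelfAdjoint b)
    {E : ℝ} (hE : E ∈ spectrum ℝ a) : ∃ E' ∈ spectrum ℝ b, |E - E'| ≤ ‖a - b‖ := by
  by_contra! hfar
  have hne : ∀ x ∈ spectrum ℝ b, E - x ≠ 0 := fun x hx h => by
    have := hfar x hx
    rw [h, abs_zero] at this
    exact this.not_ge (norm_nonneg _)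
  have hEb : cfc (fun x : ℝ => E - x) b = algebraMap ℝ 𝓐 E - b := by
    rw [cfc_sub (fun _ : ℝ => E) (fun x : ℝ => x) b, cfc_id' ℝ b, cfc_const E b]
  let u : 𝓐ˣ := cfcUnits (fun x : ℝ => E - x) b hne
  rcases subsingleton_or_nontrivial 𝓐 with _ | _
  · simp [spectrum.of_subsingleton] at hE
  have hinv : ‖a - b‖ < ‖(↑u⁻¹ : 𝓐)‖⁻¹ := by
    rcases (norm_nonneg (a - b)).eq_or_lt' with h0 | hpos
    · exact h0 ▸ inv_pos.2 (Units.norm_pos _)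
    · refine (lt_inv_comm₀ (Units.norm_pos _) hpos).1 (norm_cfc_lt (inv_pos.2 hpos) fun x hx => ?_)
      rw [norm_inv, Real.norm_eq_abs]
      exact inv_strictAnti₀ hpos (hfar x hx)
  refine hE ((u.ofNearby (algebraMap ℝ 𝓐 E - a) ?_).isUnit)
  change ‖algebraMap ℝ 𝓐 E - a - cfc (fun x : ℝ => E - x) b‖ < _
  rwa [hEb, sub_sub_sub_cancel_left, norm_sub_rev]

variable {H : Type*} [NormedAddCommGroup H] [InnerProductSpace ℂ H] [CompleteSpace H]

instance regular_spectralMeasure (A : H →L[ℂ] H) (hA : IsSelfAdjoint A) (ψ : H) :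
    (spectralMeasure A hA ψ).Regular :=
  inferInstanceAs (RealRMK.rieszMeasure _).Regular

lemma spectralMeasure_compl_spectrum (A : H →L[ℂ] H) (hA : IsSelfAdjoint A) (ψ : H) :
    spectralMeasure A hA ψ (spectrum ℝ A)ᶜ = 0 := by
  refine le_antisymm (measure_le_of_forall_lintegral_ofReal_le _
    (spectrum.isClosed A).isOpen_compl fun g hg0 _ hgs => ?_) zero_le
  have hcfc : cfc (g : ℝ → ℝ) A = 0 := by
    rw [← cfc_zero ℝ A]
    exact cfc_congr fun x hx => image_eq_zero_of_notMem_tsupport fun h => hgs h hx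
  simp [lintegral_ofReal_compactlySupported _ hg0, integral_spectralMeasure, hcfc]

lemma ae_mem_spectrum_spectralMeasure (A : H →L[ℂ] H) (hA : IsSelfAdjoint A) (ψ : H) :
    ∀ᵐ x ∂(spectralMeasure A hA ψ), x ∈ spectrum ℝ A :=
  mem_ae_iff.2 (spectralMeasure_compl_spectrum A hA ψ)

lemma spectralMeasure_mutuallySingular (A : H →L[ℂ] H) (hA : IsSelfAdjoint A) (ψ : H)
    {m : Measure ℝ} (h : m (spectrum ℝ A) = 0) : spectralMeasure A hA ψ ⟂ₘ m :=
  ⟨(spectrum ℝ A)ᶜ, (spectrum.isClosed A).measurableSet.compl,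
    spectralMeasure_compl_spectrum A hA ψ, by rwa [compl_compl]⟩

instance isFiniteMeasure_spectralMeasure (A : H →L[ℂ] H) (hA : IsSelfAdjoint A) (ψ : H) :
    IsFiniteMeasure (spectralMeasure A hA ψ) := by
  refine ⟨?_⟩
  rw [← measure_add_measure_compl (spectrum.isClosed A).measurableSet,
    spectralMeasure_compl_spectrum, add_zero]
  exact (spectrum.isCompact A).measure_lt_top

lemma integral_spectralMeasure_of_continuous (A : H →L[ℂ] H) (hA : IsSelfAdjoint A) (ψ : H)
    {g : ℝ → ℝ} (hg : Continuous g) :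
    ∫ x, g x ∂(spectralMeasure A hA ψ) = (⟪ψ, cfc g A ψ⟫_ℂ).re := by
  obtain ⟨f, hf1, hfc, -⟩ := exists_continuousMap_one_of_isCompact_subset_isOpen
    (spectrum.isCompact (𝕜 := ℝ) A) isOpen_univ (Set.subset_univ _)
  let G : C_c(ℝ, ℝ) := ⟨⟨fun x => f x * g x, f.continuous.mul hg⟩, HasCompactSupport.mul_right hfc⟩
  have hgG : Set.EqOn g G (spectrum ℝ A) := fun x hx => by
    change g x = f x * g x
    simp [hf1 hx]
  rw [cfc_congr hgG, ← integral_spectralMeasure A hA ψ G]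
  exact integral_congr_ae ((ae_mem_spectrum_spectralMeasure A hA ψ).mono hgG)

lemma spectralMeasure_real_univ (A : H →L[ℂ] H) (hA : IsSelfAdjoint A) (ψ : H) :
    (spectralMeasure A hA ψ).real Set.univ = ‖ψ‖ ^ 2 := by
  have h := integral_spectralMeasure_of_continuous A hA ψ (g := fun _ => 1) continuous_const
  rw [cfc_const_one ℝ A] at h
  simpa [inner_self_eq_norm_sq_to_K, ← Complex.ofReal_pow] using h

lemma spectralMeasure_zero (A : H →L[ℂ] H) (hA : IsSelfAdjoint A) :
    spectralMeasure A hA (0 : H) = 0 := by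
  rw [← Measure.measure_univ_eq_zero, ← ofReal_measureReal, spectralMeasure_real_univ]
  simp

lemma spectralMeasure_add_sub (A : H →L[ℂ] H) (hA : IsSelfAdjoint A) (φ ψ : H) :
    spectralMeasure A hA (φ + ψ) + spectralMeasure A hA (φ - ψ) =
      (2 : ℝ≥0∞) • (spectralMeasure A hA φ + spectralMeasure A hA ψ) := by
  have : IsFiniteMeasure ((2 : ℝ≥0∞) • (spectralMeasure A hA φ + spectralMeasure A hA ψ)) :=
    Measure.smul_finite _ (by simp)
  refine Measure.ext_of_integral_eq_on_compactlySupported fun g => ?_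
  have hg (χ : H) : Integrable g (spectralMeasure A hA χ) :=
    g.continuous.integrable_of_hasCompactSupport g.hasCompactSupport
  rw [integral_smul_measure, integral_add_measure (hg _) (hg _),
    integral_add_measure (hg _) (hg _)]
  simp only [integral_spectralMeasure, map_add, map_sub, inner_add_left, inner_add_right,
    inner_sub_left, inner_sub_right, Complex.add_re, Complex.sub_re, ENNReal.toReal_ofNat,
    smul_eq_mul]
  ring

lemma spectralMeasure_smul (A : H →L[ℂ] H) (hA : IsSelfAdjoint A) (c : ℂ) (ψ : H) :
    spectralMeasure A hA (c • ψ) = ENNReal.ofReal (‖c‖ ^ 2) • spectralMeasure A hA ψ := by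
  have : IsFiniteMeasure (ENNReal.ofReal (‖c‖ ^ 2) • spectralMeasure A hA ψ) :=
    Measure.smul_finite _ (by simp)
  refine Measure.ext_of_integral_eq_on_compactlySupported fun g => ?_
  rw [integral_smul_measure, integral_spectralMeasure, integral_spectralMeasure, map_smul,
    inner_smul_left, inner_smul_right, ← mul_assoc, Complex.conj_mul', ← Complex.ofReal_pow,
    Complex.re_ofReal_mul, ENNReal.toReal_ofReal (sq_nonneg _), smul_eq_mul]

lemma spectralMeasure_cfc_apply (A : H →L[ℂ] H) (hA : IsSelfAdjoint A) (ψ : H) {h : ℝ → ℝ}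
    (hh : Continuous h) : spectralMeasure A hA (cfc h A ψ) =
      (spectralMeasure A hA ψ).withDensity fun x => ENNReal.ofReal (h x ^ 2) := by
  have := IsLocallyFiniteMeasure.withDensity_ofReal (μ := spectralMeasure A hA ψ) (hh.pow 2)
  refine Measure.ext_of_integral_eq_on_compactlySupported fun g => ?_
  have hsymm := ContinuousLinearMap.isSelfAdjoint_iff_isSymmetric.1
    (cfc_predicate h A : IsSelfAdjoint (cfc h A))
  have hmul : cfc (fun x => h x * (g x * h x)) A = cfc h A * (cfc (g : ℝ → ℝ) A * cfc h A) := by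
    rw [cfc_mul h (fun x => g x * h x) A hh.continuousOn (g.continuous.mul hh).continuousOn,
      cfc_mul g h A g.continuous.continuousOn hh.continuousOn]
  rw [integral_withDensity_eq_integral_toReal_smul (by fun_prop) (by simp),
    integral_spectralMeasure]
  simp only [ENNReal.toReal_ofReal (sq_nonneg _), smul_eq_mul]
  calc (⟪cfc h A ψ, cfc (g : ℝ → ℝ) A (cfc h A ψ)⟫_ℂ).re
      = (⟪ψ, cfc h A (cfc (g : ℝ → ℝ) A (cfc h A ψ))⟫_ℂ).re := congrArg _ (hsymm _ _)
    _ = (⟪ψ, cfc (fun x => h x * (g x * h x)) A ψ⟫_ℂ).re := by rw [hmul]; rfl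
    _ = ∫ x, h x * (g x * h x) ∂(spectralMeasure A hA ψ) :=
      (integral_spectralMeasure_of_continuous A hA ψ (hh.mul (g.continuous.mul hh))).symm
    _ = ∫ x, h x ^ 2 * g x ∂(spectralMeasure A hA ψ) := integral_congr_ae (ae_of_all _ fun x => by
      ring)

lemma isClosed_setOf_spectralMeasure_apply_eq_zero (A : H →L[ℂ] H) (hA : IsSelfAdjoint A)
    (S : Set ℝ) : IsClosed {ψ : H | spectralMeasure A hA ψ S = 0} := by
  refine IsSeqClosed.isClosed fun φ ψ hφ hlim => ?_
  have hbound (n : ℕ) :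
      spectralMeasure A hA ψ S ≤ 2 * ENNReal.ofReal (‖ψ - φ n‖ ^ 2) := by
    have h := congrArg (· S) (spectralMeasure_add_sub A hA (φ n) (ψ - φ n))
    have hφn : spectralMeasure A hA (φ n) S = 0 := hφ n
    simp only [add_sub_cancel, Measure.coe_add, Measure.coe_smul, Pi.add_apply, Pi.smul_apply,
      hφn, zero_add, smul_eq_mul] at h
    rw [← spectralMeasure_real_univ A hA, ofReal_measureReal]
    exact (le_self_add.trans h.le).trans (by gcongr; exact Set.subset_univ _)
  have hzero : Tendsto (fun n => 2 * ENNReal.ofReal (‖ψ - φ n‖ ^ 2)) atTop (𝓝 0) := by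
    have h := ENNReal.tendsto_ofReal (((tendsto_const_nhds (x := ψ)).sub hlim).norm.pow 2)
    simpa using ENNReal.Tendsto.const_mul (a := 2) h (Or.inr (by simp))
  exact le_antisymm (ge_of_tendsto' hzero hbound) zero_le

/-- The absolutely continuous subspace of `A`: the vectors whose spectral measure is absolutely
continuous with respect to Lebesgue measure. -/
noncomputable def acSubmodule (A : H →L[ℂ] H) (hA : IsSelfAdjoint A) : Submodule ℂ H where
  carrier := {ψ | spectralMeasure A hA ψ ≪ volume}
  add_mem' := fun {φ ψ} hφ hψ S hS => by
    have h := congrArg (· S) (spectralMeasure_add_sub A hA φ ψ)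
    simp only [Measure.coe_add, Measure.coe_smul, Pi.add_apply, Pi.smul_apply, hφ hS, hψ hS,
      add_zero, smul_zero, add_eq_zero] at h
    exact h.1
  zero_mem' := by
    rw [Set.mem_ofPred_eq, spectralMeasure_zero]
    exact Measure.AbsolutelyContinuous.zero _
  smul_mem' := fun c ψ hψ => by
    rw [Set.mem_ofPred_eq, spectralMeasure_smul]
    exact hψ.smul_left _

lemma isClosed_acSubmodule (A : H →L[ℂ] H) (hA : IsSelfAdjoint A) :
    IsClosed (acSubmodule A hA : Set H) := by
  have h : (acSubmodule A hA : Set H) =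
      ⋂ (S : Set ℝ) (_ : volume S = 0), {ψ | spectralMeasure A hA ψ S = 0} := by
    ext ψ
    simp only [Set.mem_iInter]
    exact Iff.rfl
  rw [h]
  exact isClosed_biInter fun S _ => isClosed_setOf_spectralMeasure_apply_eq_zero A hA S

lemma cfc_sub_const_apply (A : H →L[ℂ] H) (hA : IsSelfAdjoint A) (E : ℝ) (φ : H) :
    cfc (fun x : ℝ => x - E) A φ = A φ - (E : ℂ) • φ := by
  rw [cfc_sub (fun x : ℝ => x) (fun _ => E) A, cfc_id' ℝ A, cfc_const E A]
  rfl

lemma exists_eigenvector_of_spectralMeasure_singleton_ne_zero {A : H →L[ℂ] H}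
    (hA : IsSelfAdjoint A) {ψ : H} {E : ℝ} (hE : spectralMeasure A hA ψ {E} ≠ 0) :
    ∃ φ : H, φ ≠ 0 ∧ A φ = (E : ℂ) • φ := by
  by_contra! hno
  set B : H →L[ℂ] H := cfc (fun x : ℝ => x - E) A
  have hker : B.ker = ⊥ := LinearMap.ker_eq_bot'.2 fun φ hφ => by
    by_contra hφ0
    exact hno φ hφ0 (sub_eq_zero.1 ((cfc_sub_const_apply A hA E φ).symm.trans hφ))
  have hdense : Dense (B.range : Set H) := by
    have hBs : IsSelfAdjoint B := cfc_predicate _ A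
    rw [Submodule.dense_iff_topologicalClosure_eq_top, Submodule.topologicalClosure_eq_top_iff,
      ContinuousLinearMap.orthogonal_range, hBs.adjoint_eq, hker]
  refine hE ((isClosed_setOf_spectralMeasure_apply_eq_zero A hA {E}).closure_subset_iff.2 ?_
    (hdense ψ))
  rintro _ ⟨χ, rfl⟩
  change spectralMeasure A hA (cfc (fun x : ℝ => x - E) A χ) {E} = 0
  rw [spectralMeasure_cfc_apply A hA χ (by fun_prop),
    withDensity_apply_eq_zero (by fun_prop)]
  convert measure_empty (μ := spectralMeasure A hA χ)
  ext x
  simp +contextual [sub_eq_zero]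

lemma spectralMeasure_compl_singleton_of_eigenvector {A : H →L[ℂ] H} (hA : IsSelfAdjoint A)
    {φ : H} {E : ℝ} (hφ : A φ = (E : ℂ) • φ) : spectralMeasure A hA φ {E}ᶜ = 0 := by
  have h0 : cfc (fun x : ℝ => x - E) A φ = 0 := by
    rw [cfc_sub_const_apply A hA, hφ, sub_self]
  have h := spectralMeasure_cfc_apply A hA φ (h := fun x => x - E) (by fun_prop)
  rw [h0, spectralMeasure_zero] at h
  have hae := withDensity_eq_zero (by fun_prop) h.symm
  rw [← mem_ae_iff]
  filter_upwards [hae] with x hx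
  simpa [sub_eq_zero, sq_nonpos_iff] using hx

lemma HasPurelyACSpectrum.eq_zero_of_eigenvector {A : H →L[ℂ] H} {hA : IsSelfAdjoint A}
    (h : HasPurelyACSpectrum A hA) {E : ℝ} {φ : H} (hφ : A φ = (E : ℂ) • φ) : φ = 0 := by
  have huniv : spectralMeasure A hA φ Set.univ = 0 := by
    rw [← measure_add_measure_compl (measurableSet_singleton E), h φ (by simp),
      spectralMeasure_compl_singleton_of_eigenvector hA hφ, add_zero]
  have hnorm := spectralMeasure_real_univ A hA φ
  rw [measureReal_def, huniv] at hnorm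
  simpa using hnorm.symm

lemma exists_eigenvector_of_not_accPt {A : H →L[ℂ] H} (hA : IsSelfAdjoint A) {E : ℝ}
    (hE : E ∈ spectrum ℝ A) (hacc : ¬ AccPt E (𝓟 (spectrum ℝ A))) :
    ∃ φ : H, φ ≠ 0 ∧ A φ = (E : ℂ) • φ := by
  rw [accPt_principal_iff_clusterPt, ← mem_closure_iff_clusterPt] at hacc
  obtain ⟨g, hg0, hg1, -⟩ := exists_continuous_zero_one_of_isClosed isClosed_closure
    isClosed_singleton (Set.disjoint_singleton_right.2 hacc)
  have hgA : cfc (g : ℝ → ℝ) A ≠ 0 := fun h => by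
    rw [← cfc_zero ℝ A, cfc_eq_cfc_iff_eqOn] at h
    exact one_ne_zero ((hg1 rfl).symm.trans (h hE))
  obtain ⟨ψ, hψ⟩ := DFunLike.ne_iff.1 hgA
  refine ⟨cfc (g : ℝ → ℝ) A ψ, hψ, sub_eq_zero.1 ?_⟩
  have hmul : cfc (fun x : ℝ => (x - E) * g x) A = 0 := by
    rw [← cfc_zero ℝ A]
    refine cfc_congr fun x hx => ?_
    rcases eq_or_ne x E with rfl | hne
    · simp
    · simp [hg0 (subset_closure ⟨hx, hne⟩)]
  rw [cfc_mul (fun x : ℝ => x - E) g A] at hmul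
  rw [← cfc_sub_const_apply A hA]
  exact congrArg (· ψ) hmul

lemma isCantorSet_spectrum {A : H →L[ℂ] H} (hA : IsSelfAdjoint A)
    (hne : ∀ (E : ℝ) (φ : H), A φ = (E : ℂ) • φ → φ = 0) (hint : interior (spectrum ℝ A) = ∅) :
    IsCantorSet (spectrum ℝ A) := by
  refine ⟨⟨spectrum.isClosed A, fun E hE => ?_⟩, hint⟩
  by_contra h
  obtain ⟨φ, hφ, hφE⟩ := exists_eigenvector_of_not_accPt hA hE h
  exact hφ (hne E φ hφE)

lemma tendsto_cfc_of_tendsto {𝓐 : Type*} [CStarAlgebra 𝓐] {a : ℕ → 𝓐} {b : 𝓐}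
    (ha : ∀ j, IsSelfAdjoint (a j)) (hb : IsSelfAdjoint b) (hlim : Tendsto a atTop (𝓝 b))
    {g : ℝ → ℝ} (hg : Continuous g) : Tendsto (fun j => cfc g (a j)) atTop (𝓝 (cfc g b)) := by
  have hspec (c : 𝓐) : spectrum ℝ c ⊆ Metric.closedBall 0 (‖c‖ * ‖(1 : 𝓐)‖) :=
    spectrum.subset_closedBall_norm_mul c
  refine Filter.Tendsto.cfc
    (s := Metric.closedBall 0 ((‖b‖ + 1) * ‖(1 : 𝓐)‖)) (isCompact_closedBall _ _)
    g hlim ?_ (Eventually.of_forall ha) ?_ hb hg.continuousOn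
  · filter_upwards [hlim.norm.eventually_lt_const (lt_add_one ‖b‖)] with j hj
    exact (hspec _).trans (Metric.closedBall_subset_closedBall (by gcongr))
  · exact (hspec b).trans (Metric.closedBall_subset_closedBall (by gcongr; simp))

lemma abs_le_norm_of_mem_spectrum (A : H →L[ℂ] H) {E : ℝ} (hE : E ∈ spectrum ℝ A) :
    |E| ≤ ‖A‖ :=
  (spectrum.norm_le_norm_mul_of_mem hE).trans
    (mul_le_of_le_one_right (norm_nonneg _) ContinuousLinearMap.norm_id_le)

lemma spectralMeasure_open_le_of_tendsto {A : ℕ → H →L[ℂ] H} {B : H →L[ℂ] H}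
    (hA : ∀ j, IsSelfAdjoint (A j)) (hB : IsSelfAdjoint B) (hlim : Tendsto A atTop (𝓝 B)) (ψ : H)
    {O : Set ℝ} (hO : IsOpen O) {c : ℝ≥0∞}
    (hc : ∀ᶠ j in atTop, spectralMeasure (A j) (hA j) ψ O ≤ c) : spectralMeasure B hB ψ O ≤ c := by
  refine measure_le_of_forall_lintegral_ofReal_le _ hO fun g hg0 hg1 hgO => ?_
  have hint : Tendsto (fun j => ∫⁻ x, ENNReal.ofReal (g x) ∂(spectralMeasure (A j) (hA j) ψ)) atTop
      (𝓝 (∫⁻ x, ENNReal.ofReal (g x) ∂(spectralMeasure B hB ψ))) := by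
    simp only [lintegral_ofReal_compactlySupported _ hg0, integral_spectralMeasure]
    have hform : Continuous fun D : H →L[ℂ] H => ENNReal.ofReal (⟪ψ, D ψ⟫_ℂ).re :=
      ENNReal.continuous_ofReal.comp (by fun_prop)
    exact (hform.tendsto _).comp (tendsto_cfc_of_tendsto hA hB hlim g.continuous)
  refine le_of_tendsto hint (hc.mono fun j hj => ?_)
  exact (lintegral_ofReal_le_measure_of_tsupport_subset _ hO hg1 hgO).trans hj

end SpectralTheory

section TransferMatrix

open Polynomial Matrix

/-- The one-step transfer matrix of the difference equation `u (k + 1) + u (k - 1) = x • u k`,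
acting on the column `(u k, u (k - 1))`. -/
def stepMatrix {R : Type*} [CommRing R] (x : R) : Matrix (Fin 2) (Fin 2) R := !![x, -1; 1, 0]

/-- The transfer matrix of `u (k + 1) + u (k - 1) = w k • u k` across the `n` sites
`m, …, m + n - 1`. -/
def transfer {R : Type*} [CommRing R] (w : ℤ → R) (m : ℤ) : ℕ → Matrix (Fin 2) (Fin 2) R
  | 0 => 1
  | n + 1 => stepMatrix (w (m + n)) * transfer w m n

section Algebra

variable {R : Type*} [CommRing R] (w : ℤ → R) (m : ℤ)

@[simp] lemma transfer_zero : transfer w m 0 = 1 := rfl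

lemma transfer_succ (n : ℕ) :
    transfer w m (n + 1) = stepMatrix (w (m + n)) * transfer w m n := rfl

lemma det_stepMatrix (x : R) : (stepMatrix x).det = 1 := by
  simp [stepMatrix, Matrix.det_fin_two]

lemma det_transfer (n : ℕ) : (transfer w m n).det = 1 := by
  induction n with
  | zero => simp
  | succ n ih => rw [transfer_succ, Matrix.det_mul, det_stepMatrix, ih, one_mul]

lemma transfer_add (a b : ℕ) :
    transfer w m (a + b) = transfer w (m + a) b * transfer w m a := by
  induction b with
  | zero => simp
  | succ b ih =>
    rw [← add_assoc, transfer_succ, ih, transfer_succ, ← mul_assoc, Nat.cast_add, add_assoc]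

variable {w m} in
lemma transfer_congr {w' : ℤ → R} {m' : ℤ} {n : ℕ} (h : ∀ k : ℕ, k < n → w (m + k) = w' (m' + k)) :
    transfer w m n = transfer w' m' n := by
  induction n with
  | zero => simp
  | succ n ih =>
    rw [transfer_succ, transfer_succ, h n n.lt_succ_self, ih fun k hk => h k (by omega)]

lemma stepMatrix_map {R' : Type*} [CommRing R'] (f : R →+* R') (x : R) :
    (stepMatrix x).map f = stepMatrix (f x) := by
  ext i j
  fin_cases i <;> fin_cases j <;> simp [stepMatrix]

lemma transfer_map {R' : Type*} [CommRing R'] (f : R →+* R') (n : ℕ) :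
    (transfer w m n).map f = transfer (fun k => f (w k)) m n := by
  induction n with
  | zero => simp
  | succ n ih => rw [transfer_succ, transfer_succ, Matrix.map_mul, ih, stepMatrix_map]

lemma trace_map_transfer {R' : Type*} [CommRing R'] (f : R →+* R') (n : ℕ) :
    f (transfer w m n).trace = (transfer (fun k => f (w k)) m n).trace := by
  rw [← transfer_map, AddMonoidHom.map_trace]

lemma mul_self_eq_trace_smul_sub_one {M : Matrix (Fin 2) (Fin 2) R} (hM : M.det = 1) :
    M * M = M.trace • M - 1 := by
  have hadjugate : M.adjugate = M.trace • 1 - M := by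
    rw [Matrix.adjugate_fin_two, Matrix.trace_fin_two]
    ext i j
    fin_cases i <;> fin_cases j <;> simp
  have h := M.mul_adjugate
  rw [hadjugate, hM, mul_sub, mul_smul_comm, mul_one, one_smul] at h
  rw [← h, sub_sub_cancel]

section Periodic

variable {w} {N : ℕ} (hw : ∀ k, w (k + N) = w k)
include hw

lemma transfer_add_period (n : ℕ) : transfer w (m + N) n = transfer w m n :=
  transfer_congr fun k _ => by rw [add_right_comm, hw]

lemma transfer_mul_transfer (k : ℕ) :
    transfer w (m + k) N * transfer w m k = transfer w m k * transfer w m N := by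
  rw [← transfer_add, add_comm, transfer_add, transfer_add_period m hw]

lemma transfer_eq_conj (k : ℕ) :
    transfer w (m + k) N = transfer w m k * transfer w m N * (transfer w m k).adjugate := by
  rw [← transfer_mul_transfer m hw, mul_assoc, Matrix.mul_adjugate, det_transfer, one_smul, mul_one]

lemma trace_transfer_add (k : ℕ) : (transfer w (m + k) N).trace = (transfer w m N).trace := by
  rw [transfer_eq_conj m hw, Matrix.trace_mul_comm, ← mul_assoc, Matrix.adjugate_mul,
    det_transfer, one_smul, one_mul]

lemma trace_transfer : (transfer w m N).trace = (transfer w 0 N).trace := by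
  obtain ⟨k, rfl | rfl⟩ := m.eq_nat_or_neg
  · simpa using trace_transfer_add 0 hw k
  · simpa using (trace_transfer_add (-k) hw k).symm

lemma transfer_mul_period (t : ℕ) : transfer w m (N * t) = transfer w m N ^ t := by
  induction t with
  | zero => simp
  | succ t ih =>
    rw [mul_add, mul_one, add_comm, transfer_add, transfer_add_period m hw, ih, pow_succ]

end Periodic

section Recurrence

variable {M : Type*} [AddCommGroup M] [Module R M] {w} {u : ℤ → M}
  (hu : ∀ k, u (k + 1) + u (k - 1) = w k • u k)
include hu

lemma eq_transfer_smul (n : ℕ) :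
    u (m + n) = transfer w m n 0 0 • u m + transfer w m n 0 1 • u (m - 1) ∧
    u (m + n - 1) = transfer w m n 1 0 • u m + transfer w m n 1 1 • u (m - 1) := by
  induction n with
  | zero => simp
  | succ n ih =>
    have hstep : u (m + (n + 1 : ℕ)) = w (m + n) • u (m + n) - u (m + n - 1) := by
      rw [← hu, add_sub_cancel_right, Nat.cast_succ, add_assoc]
    have hindex : m + ((n + 1 : ℕ) : ℤ) - 1 = m + n := by push_cast; ring
    rw [hstep, hindex, transfer_succ]
    simp only [stepMatrix, Matrix.mul_apply, Fin.sum_univ_two, Matrix.of_apply, Matrix.cons_val',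
      Matrix.cons_val_zero, Matrix.cons_val_one, Matrix.cons_val_fin_one]
    rw [ih.1, ih.2]
    constructor <;> module

lemma add_period_add_sub_period {N : ℕ} (hw : ∀ k, w (k + N) = w k) :
    u (m + N) + u (m - N) = (transfer w 0 N).trace • u m := by
  have hsq : transfer w (m - N) (N + N) = (transfer w 0 N).trace • transfer w (m - N) N - 1 := by
    rw [transfer_add, transfer_add_period _ hw,
      mul_self_eq_trace_smul_sub_one (det_transfer _ _ _), trace_transfer _ hw]
  have h1 := (eq_transfer_smul (m - N) hu N).1
  have h2 := (eq_transfer_smul (m - N) hu (N + N)).1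
  rw [hsq, show m - N + ((N + N : ℕ) : ℤ) = m + N by push_cast; ring] at h2
  rw [sub_add_cancel] at h1
  rw [h2, h1]
  simp only [Matrix.sub_apply, Matrix.smul_apply, Matrix.one_apply_eq, smul_eq_mul,
    Matrix.one_apply_ne zero_ne_one]
  module

end Recurrence

end Algebra

/-- The discriminant of an `N`-periodic potential, as a polynomial in the energy: the trace of the
transfer matrix across one period. -/
noncomputable def discriminant (v : ℤ → ℝ) (N : ℕ) : ℝ[X] :=
  (transfer (fun k => (X : ℝ[X]) - C (v k)) 0 N).trace

lemma eval_discriminant (v : ℤ → ℝ) (N : ℕ) (E : ℝ) :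
    (discriminant v N).eval E = (transfer (fun k => E - v k) 0 N).trace := by
  rw [discriminant, ← Polynomial.coe_evalRingHom, trace_map_transfer]
  simp

lemma lpShift_single (m k : ℤ) :
    lpShift m (lp.single 2 k 1) = lp.single 2 (k - m) 1 := by
  ext n
  change lp.single (E := fun _ : ℤ => ℂ) 2 k 1 (n + m) = _
  simp only [lp.single_apply, Pi.single_apply, eq_sub_iff_add_eq]

lemma lpMultiplication_single (V : ℓ^∞(ℤ, ℝ)) (k : ℤ) :
    lpMultiplication V (lp.single 2 k 1) = V k • lp.single 2 k (1 : ℂ) := by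
  ext n
  change (V n : ℂ) * lp.single (E := fun _ : ℤ => ℂ) 2 k 1 n =
    V k • lp.single (E := fun _ : ℤ => ℂ) 2 k 1 n
  obtain rfl | hn := eq_or_ne n k
  · rfl
  · simp [lp.single_apply, hn]

lemma aeval_discriminant (V : ℓ^∞(ℤ, ℝ)) {N : ℕ} (hV : ∀ k, V (k + N) = V k) :
    aeval (schrodinger V) (discriminant V N) = lpShift N + lpShift (-N) := by
  let _ : Module ℝ[X] ℓ^2(ℤ, ℂ) := Module.compHom _ (aeval (schrodinger V)).toRingHom
  let δ : ℤ → ℓ^2(ℤ, ℂ) := fun k => lp.single 2 k 1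
  have hδ (k : ℤ) : δ (k + 1) + δ (k - 1) = ((X : ℝ[X]) - C (V k)) • δ k := by
    change _ = aeval (schrodinger V) (X - C (V k)) (δ k)
    rw [map_sub, aeval_X, aeval_C, _root_.sub_apply, eq_sub_iff_add_eq]
    change δ (k + 1) + δ (k - 1) + V k • δ k =
      lpShift 1 (δ k) + lpShift (-1) (δ k) + lpMultiplication V (δ k)
    rw [lpShift_single, lpShift_single, lpMultiplication_single, sub_neg_eq_add,
      add_comm (δ (k - 1))]
  refine lp.ext_continuousLinearMap (by norm_num) fun m => ?_
  ext1
  change discriminant V N • δ m = lpShift N (δ m) + lpShift (-N) (δ m)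
  rw [lpShift_single, lpShift_single, sub_neg_eq_add, add_comm (lp.single 2 _ _)]
  exact (add_period_add_sub_period m hδ fun k => by rw [hV]).symm

lemma norm_lpShift_le (m : ℤ) : ‖lpShift m‖ ≤ 1 :=
  LinearMap.mkContinuous_norm_le _ zero_le_one _

lemma abs_eval_discriminant_le (V : ℓ^∞(ℤ, ℝ)) {N : ℕ} (hV : ∀ k, V (k + N) = V k) {E : ℝ}
    (hE : E ∈ spectrum ℝ (schrodinger V)) : |(discriminant V N).eval E| ≤ 2 := by
  have hmem := spectrum.subset_polynomial_aeval (schrodinger V) (discriminant V N) ⟨E, hE, rfl⟩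
  rw [aeval_discriminant V hV] at hmem
  calc |(discriminant V N).eval E|
      ≤ ‖lpShift N + lpShift (-N)‖ := abs_le_norm_of_mem_spectrum _ hmem
    _ ≤ ‖lpShift N‖ + ‖lpShift (-N)‖ := norm_add_le _ _
    _ ≤ 2 := by linarith [norm_lpShift_le N, norm_lpShift_le (-N)]

lemma abs_le_of_mem_spectrum_schrodinger (V : ℓ^∞(ℤ, ℝ)) {E : ℝ}
    (hE : E ∈ spectrum ℝ (schrodinger V)) : |E| ≤ 2 + ‖V‖ := by
  calc |E| ≤ ‖schrodinger V‖ := abs_le_norm_of_mem_spectrum _ hE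
    _ ≤ ‖lpShift 1‖ + ‖lpShift (-1)‖ + ‖lpMultiplication V‖ := norm_add₃_le
    _ ≤ 2 + ‖V‖ := by
      have hmul : ‖lpMultiplication V‖ ≤ ‖V‖ :=
        LinearMap.mkContinuous_norm_le _ (norm_nonneg _) _
      linarith [norm_lpShift_le 1, norm_lpShift_le (-1)]

end TransferMatrix

section Gordon

open Matrix Filter Topology
open scoped Matrix.Norms.Operator

section ThreeBlock

variable {𝕜 : Type*} [NormedField 𝕜] {M M' : Matrix (Fin 2) (Fin 2) 𝕜} {x y : Fin 2 → 𝕜} {η : ℝ}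

lemma mulVec_mulVec_of_det_eq_one (hM : M.det = 1) (x : Fin 2 → 𝕜) :
    M *ᵥ (M *ᵥ x) = M.trace • (M *ᵥ x) - x := by
  rw [Matrix.mulVec_mulVec, mul_self_eq_trace_smul_sub_one hM, Matrix.sub_mulVec,
    Matrix.one_mulVec, Matrix.smul_mulVec]

lemma norm_le_of_norm_trace_le_one (hM : M.det = 1) (htr : ‖M.trace‖ ≤ 1) (hd : ‖M' - M‖ ≤ 1)
    (h1 : ‖M *ᵥ x‖ ≤ η) (h2 : ‖M' *ᵥ (M *ᵥ x)‖ ≤ η) : ‖x‖ ≤ 3 * η := by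
  have hx : x = M.trace • (M *ᵥ x) + (M' - M) *ᵥ (M *ᵥ x) - M' *ᵥ (M *ᵥ x) := by
    rw [Matrix.sub_mulVec, mulVec_mulVec_of_det_eq_one hM]
    abel
  have htrace : ‖M.trace • (M *ᵥ x)‖ ≤ η := by
    rw [norm_smul]
    exact (mul_le_of_le_one_left (norm_nonneg _) htr).trans h1
  have hdiff : ‖(M' - M) *ᵥ (M *ᵥ x)‖ ≤ η :=
    (Matrix.linfty_opNorm_mulVec _ _).trans ((mul_le_of_le_one_left (norm_nonneg _) hd).trans h1)
  rw [hx]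
  linarith [norm_sub_le (M.trace • (M *ᵥ x) + (M' - M) *ᵥ (M *ᵥ x)) (M' *ᵥ (M *ᵥ x)),
    norm_add_le (M.trace • (M *ᵥ x)) ((M' - M) *ᵥ (M *ᵥ x))]

lemma norm_le_of_one_le_norm_trace (hM : M.det = 1) (htr : 1 ≤ ‖M.trace‖) (hd : ‖M - M'‖ ≤ 1)
    (hMd : ‖M‖ * ‖M - M'‖ ≤ 1) (h1 : ‖y‖ ≤ η) (h2 : ‖M *ᵥ (M' *ᵥ y)‖ ≤ η) :
    ‖M' *ᵥ y‖ ≤ 4 * η := by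
  obtain ⟨e, he⟩ : ∃ e, e = (M - M') *ᵥ y := ⟨_, rfl⟩
  have hy : M *ᵥ y = M' *ᵥ y + e := by rw [he, Matrix.sub_mulVec, add_sub_cancel]
  have hsmul : M.trace • (M' *ᵥ y) = M *ᵥ (M' *ᵥ y) + M *ᵥ e - M.trace • e + y := by
    have h := mulVec_mulVec_of_det_eq_one hM y
    rw [hy, Matrix.mulVec_add, smul_add] at h
    rw [h]
    abel
  have hed : ‖e‖ ≤ ‖M - M'‖ * ‖y‖ := he ▸ Matrix.linfty_opNorm_mulVec _ _
  have hen : ‖e‖ ≤ η := hed.trans ((mul_le_of_le_one_left (norm_nonneg _) hd).trans h1)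
  have hMe : ‖M *ᵥ e‖ ≤ η := by
    calc ‖M *ᵥ e‖ ≤ ‖M‖ * ‖e‖ := Matrix.linfty_opNorm_mulVec _ _
      _ ≤ ‖M‖ * (‖M - M'‖ * ‖y‖) := by gcongr
      _ = ‖M‖ * ‖M - M'‖ * ‖y‖ := (mul_assoc _ _ _).symm
      _ ≤ ‖y‖ := mul_le_of_le_one_left (norm_nonneg _) hMd
      _ ≤ η := h1
  have hbound : ‖M.trace‖ * ‖M' *ᵥ y‖ ≤ η + η + ‖M.trace‖ * η + η := by
    calc ‖M.trace‖ * ‖M' *ᵥ y‖ = ‖M *ᵥ (M' *ᵥ y) + M *ᵥ e - M.trace • e + y‖ := by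
          rw [← norm_smul, hsmul]
      _ ≤ ‖M *ᵥ (M' *ᵥ y)‖ + ‖M *ᵥ e‖ + ‖M.trace • e‖ + ‖y‖ :=
        norm_add_le_of_le (norm_sub_le_of_le (norm_add_le _ _) le_rfl) le_rfl
      _ ≤ η + η + ‖M.trace‖ * η + η := by
        rw [norm_smul]
        gcongr
  nlinarith [(norm_nonneg y).trans h1]

end ThreeBlock

section Norm

variable {𝕜 : Type*} [NormedField 𝕜]

lemma linfty_opNorm_fin_two_le {M : Matrix (Fin 2) (Fin 2) 𝕜} {c : ℝ}
    (h0 : ‖M 0 0‖ + ‖M 0 1‖ ≤ c) (h1 : ‖M 1 0‖ + ‖M 1 1‖ ≤ c) : ‖M‖ ≤ c := by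
  lift c to NNReal using le_trans (by positivity) h0
  rw [Matrix.linfty_opNorm_def, NNReal.coe_le_coe]
  refine Finset.sup_le fun i _ => ?_
  rw [Fin.sum_univ_two, ← NNReal.coe_le_coe]
  fin_cases i
  · exact h0
  · exact h1

lemma norm_stepMatrix_le (x : 𝕜) : ‖stepMatrix x‖ ≤ ‖x‖ + 1 :=
  linfty_opNorm_fin_two_le (by simp [stepMatrix]) (by simp [stepMatrix])

lemma norm_stepMatrix_sub_le (x y : 𝕜) : ‖stepMatrix x - stepMatrix y‖ ≤ ‖x - y‖ :=
  linfty_opNorm_fin_two_le (by simp [stepMatrix]) (by simp [stepMatrix])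

variable {w : ℤ → 𝕜} {c : ℝ} (hc : ∀ k, ‖w k‖ + 1 ≤ c) (m m' : ℤ) (n : ℕ)
include hc

lemma norm_transfer_le : ‖transfer w m n‖ ≤ c ^ n := by
  induction n with
  | zero => exact linfty_opNorm_fin_two_le (by simp) (by simp)
  | succ n ih =>
    rw [transfer_succ, pow_succ']
    exact (norm_mul_le _ _).trans (mul_le_mul ((norm_stepMatrix_le _).trans (hc _)) ih
      (norm_nonneg _) (le_trans (by positivity) (hc 0)))

lemma norm_transfer_sub_le {δ : ℝ} (hδ : ∀ k : ℕ, ‖w (m + k) - w (m' + k)‖ ≤ δ) :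
    ‖transfer w m n - transfer w m' n‖ ≤ n * c ^ n * δ := by
  have hc1 : 1 ≤ c := le_trans (by simp) (hc 0)
  have hδ0 : 0 ≤ δ := (norm_nonneg _).trans (hδ 0)
  induction n with
  | zero => simp
  | succ n ih =>
    have htelescope : transfer w m (n + 1) - transfer w m' (n + 1) =
        (stepMatrix (w (m + n)) - stepMatrix (w (m' + n))) * transfer w m n +
        stepMatrix (w (m' + n)) * (transfer w m n - transfer w m' n) := by
      rw [transfer_succ, transfer_succ]
      noncomm_ring
    have h1 : ‖(stepMatrix (w (m + n)) - stepMatrix (w (m' + n))) * transfer w m n‖ ≤ δ * c ^ n :=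
      (norm_mul_le _ _).trans (mul_le_mul ((norm_stepMatrix_sub_le _ _).trans (hδ n))
        (norm_transfer_le hc m n) (norm_nonneg _) hδ0)
    have h2 : ‖stepMatrix (w (m' + n)) * (transfer w m n - transfer w m' n)‖ ≤
        c * (n * c ^ n * δ) :=
      (norm_mul_le _ _).trans (mul_le_mul ((norm_stepMatrix_le _).trans (hc _)) ih
        (norm_nonneg _) (by linarith))
    calc ‖transfer w m (n + 1) - transfer w m' (n + 1)‖
        ≤ δ * c ^ n + c * (n * c ^ n * δ) := htelescope ▸ norm_add_le_of_le h1 h2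
      _ ≤ δ * c ^ (n + 1) + c * (n * c ^ n * δ) := by gcongr; exact n.le_succ
      _ = (n + 1 : ℕ) * c ^ (n + 1) * δ := by push_cast; ring

end Norm

lemma vec_eq_transfer_mulVec {R : Type*} [CommRing R] {w φ : ℤ → R}
    (h : ∀ n, φ (n + 1) + φ (n - 1) = w n • φ n) (m : ℤ) (n : ℕ) :
    ![φ (m + n), φ (m + n - 1)] = transfer w m n *ᵥ ![φ m, φ (m - 1)] := by
  obtain ⟨h0, h1⟩ := eq_transfer_smul m h n
  ext i
  fin_cases i
  · simpa [Matrix.mulVec, dotProduct, Fin.sum_univ_two] using h0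
  · simpa [Matrix.mulVec, dotProduct, Fin.sum_univ_two] using h1

lemma tendsto_lp_cofinite (ψ : ℓ^2(ℤ, ℂ)) : Tendsto (fun n => ‖ψ n‖) cofinite (𝓝 0) := by
  have hsq := ((memℓp_gen_iff (p := 2) (by norm_num)).1 (lp.memℓp ψ)).tendsto_cofinite_zero
  simp only [ENNReal.toReal_ofNat, Real.rpow_ofNat] at hsq
  simpa [Real.sqrt_sq] using hsq.sqrt

lemma exists_forall_norm_vec_le (ψ : ℓ^2(ℤ, ℂ)) {η : ℝ} (hη : 0 < η) :
    ∃ K : ℕ, ∀ n : ℤ, K ≤ n.natAbs → ‖![ψ n, ψ (n - 1)]‖ ≤ η := by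
  have h := (tendsto_lp_cofinite ψ).eventually (ge_mem_nhds hη)
  rw [Filter.eventually_cofinite] at h
  obtain ⟨K, hK⟩ := (h.image Int.natAbs).bddAbove
  have hle (n : ℤ) (hn : K < n.natAbs) : ‖ψ n‖ ≤ η := by
    by_contra hcon
    exact hn.not_ge (hK ⟨n, hcon, rfl⟩)
  refine ⟨K + 2, fun n hn => (pi_norm_le_iff_of_nonneg hη.le).2 fun i => ?_⟩
  fin_cases i
  · exact hle n (by omega)
  · exact hle (n - 1) (by omega)

/-- Gordon's condition: there are arbitrarily long almost-periods `q`, of precision better than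
every exponential rate in `q`. It excludes eigenvalues of the Schrödinger operator. -/
def IsGordon (v : ℤ → ℝ) : Prop :=
  ∀ k : ℕ, ∃ q : ℕ, k ≤ q ∧ ∀ n : ℤ, |v (n + q) - v n| ≤ ((k : ℝ) + 1)⁻¹ ^ q

lemma nat_mul_pow_mul_inv_pow_mul_pow_le_one {c a : ℝ} (hc : 0 ≤ c) (ha : 0 < a)
    (h : 2 * c ^ 2 ≤ a) (q : ℕ) : (q * c ^ q * a⁻¹ ^ q) * c ^ q ≤ 1 := by
  have hq : (q : ℝ) ≤ 2 ^ q := by exact_mod_cast Nat.lt_two_pow_self.le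
  calc (q * c ^ q * a⁻¹ ^ q) * c ^ q ≤ (2 ^ q * c ^ q * a⁻¹ ^ q) * c ^ q := by gcongr
    _ = (2 * c ^ 2 * a⁻¹) ^ q := by
      rw [mul_pow, mul_pow, ← pow_mul, mul_comm 2 q, pow_mul, sq (c ^ q)]
      ring
    _ ≤ 1 := by
      refine pow_le_one₀ (by positivity) ?_
      rw [← div_eq_mul_inv]
      exact div_le_one_of_le₀ h ha.le

lemma IsGordon.exists_norm_transfer_sub_mul_pow_le_one {v : ℤ → ℝ} (hv : IsGordon v) {E : ℂ}
    {c : ℝ} (hc : ∀ k, ‖E - v k‖ + 1 ≤ c) (K : ℕ) :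
    ∃ q, K ≤ q ∧ ∀ m : ℤ, ‖transfer (fun k => E - v k) (m + q) q -
      transfer (fun k => E - v k) m q‖ * c ^ q ≤ 1 := by
  have hc0 : 0 ≤ c := le_trans (by positivity) (hc 0)
  obtain ⟨k₁, hk₁⟩ := exists_nat_ge (2 * c ^ 2)
  obtain ⟨q, hkq, hq⟩ := hv (max k₁ K)
  have hk : 2 * c ^ 2 ≤ ((max k₁ K : ℕ) : ℝ) + 1 :=
    hk₁.trans ((Nat.cast_le.2 (le_max_left k₁ K)).trans (le_add_of_nonneg_right zero_le_one))
  refine ⟨q, (le_max_right _ _).trans hkq, fun m => ?_⟩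
  refine le_trans (mul_le_mul_of_nonneg_right ?_ (pow_nonneg hc0 q))
    (nat_mul_pow_mul_inv_pow_mul_pow_le_one hc0 (by positivity) hk q)
  refine norm_transfer_sub_le hc _ _ _ fun j => ?_
  have h := hq (m + j)
  rwa [← Real.norm_eq_abs, ← Complex.norm_real, Complex.ofReal_sub, norm_sub_rev,
    ← sub_sub_sub_cancel_left _ _ E, add_right_comm] at h

lemma IsGordon.eq_zero_of_eigenvector {V : ℓ^∞(ℤ, ℝ)} (hV : IsGordon V) {E : ℝ} {ψ : ℓ^2(ℤ, ℂ)}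
    (hψ : schrodinger V ψ = (E : ℂ) • ψ) : ψ = 0 := by
  have hsol (n : ℤ) : ψ (n + 1) + ψ (n - 1) = (E - V n : ℂ) * ψ n := by
    have h : (E : ℂ) * ψ n = ψ (n + 1) + ψ (n - 1) + V n * ψ n := by
      rw [← schrodinger_apply, hψ]
      rfl
    rw [sub_mul, h, add_sub_cancel_right]
  have hblock := vec_eq_transfer_mulVec hsol
  have hc (k : ℤ) : ‖(E - V k : ℂ)‖ + 1 ≤ |E| + ‖V‖ + 1 := by
    have h := norm_sub_le (E : ℂ) (V k)
    rw [Complex.norm_real, Complex.norm_real, Real.norm_eq_abs] at h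
    linarith [lp.norm_apply_le_norm (by simp) V k]
  have hsmall (m : ℤ) {η : ℝ} (hη : 0 < η) : ‖![ψ m, ψ (m - 1)]‖ ≤ 4 * η := by
    obtain ⟨K, hK⟩ := exists_forall_norm_vec_le ψ hη
    obtain ⟨q, hKq, hq⟩ := hV.exists_norm_transfer_sub_mul_pow_le_one hc (K + m.natAbs)
    have hone : 1 ≤ (|E| + ‖V‖ + 1) ^ q := one_le_pow₀ (le_trans (by simp) (hc 0))
    have hd (m : ℤ) := (le_mul_of_one_le_right (norm_nonneg _) hone).trans (hq m)
    have hnext := hK (m + q) (by omega)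
    rw [hblock] at hnext
    obtain htr | htr := le_total ‖(transfer (fun k => (E - V k : ℂ)) m q).trace‖ 1
    · have hnext' := hK (m + q + q) (by omega)
      rw [hblock, hblock] at hnext'
      linarith [norm_le_of_norm_trace_le_one (det_transfer _ _ _) htr (hd m) hnext hnext']
    · have hprev := hblock (m - q) q
      have hq' := hq (m - q)
      have hd' := hd (m - q)
      rw [sub_add_cancel] at hprev hq' hd'
      rw [hprev] at hnext ⊢
      refine norm_le_of_one_le_norm_trace (det_transfer _ _ _) htr hd' ?_ (hK _ (by omega)) hnext
      rw [mul_comm]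
      exact (mul_le_mul_of_nonneg_left (norm_transfer_le hc m q) (norm_nonneg _)).trans hq'
  ext m
  have hzero : ‖![ψ m, ψ (m - 1)]‖ ≤ 0 := le_of_forall_pos_le_add fun η hη => by
    linarith [hsmall m (show 0 < η / 4 by positivity)]
  simpa using congrFun (norm_le_zero_iff.1 hzero) 0

lemma IsGordon.spectralMeasure_singleton {V : ℓ^∞(ℤ, ℝ)} (hV : IsGordon V) (ψ : ℓ^2(ℤ, ℂ))
    (E : ℝ) : spectralMeasure (schrodinger V) (isSelfAdjoint_schrodinger V) ψ {E} = 0 := by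
  by_contra hE
  obtain ⟨φ, hφ0, hφ⟩ := exists_eigenvector_of_spectralMeasure_singleton_ne_zero _ hE
  exact hφ0 (hV.eq_zero_of_eigenvector hφ)

lemma IsGordon.of_periodic {v : ℤ → ℝ} {N : ℕ} (hN : 0 < N) (hv : ∀ k, v (k + N) = v k) :
    IsGordon v := fun k => by
  refine ⟨k * N, Nat.le_mul_of_pos_right k hN, fun n => ?_⟩
  have hper : v (n + (k * N : ℕ)) = v n := by
    simpa using Function.Periodic.nat_mul (f := v) hv k n
  rw [hper, sub_self, abs_zero]
  positivity

end Gordon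

section BandEstimate

open Polynomial Matrix

lemma map_derivative_mul {R l m n : Type*} [CommSemiring R] [Fintype m] (A : Matrix l m R[X])
    (B : Matrix m n R[X]) :
    (A * B).map derivative = A.map derivative * B + A * B.map derivative := by
  ext1 i j
  simp only [Matrix.map_apply, Matrix.add_apply, Matrix.mul_apply, derivative_sum, derivative_mul,
    Finset.sum_add_distrib]

lemma map_derivative_transfer_succ {R : Type*} [CommRing R] {w : ℤ → R[X]}
    (hw : ∀ k, derivative (w k) = 1) (n : ℕ) :
    (transfer w 0 (n + 1)).map derivative =
      ∑ p ∈ Finset.HasAntidiagonal.antidiagonal n,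
        transfer w (p.1 + 1) p.2 * !![1, 0; 0, 0] * transfer w 0 p.1 := by
  have hstep (k : ℤ) : (stepMatrix (w k)).map derivative = !![1, 0; 0, 0] := by
    ext1 i j
    fin_cases i <;> fin_cases j <;> simp [stepMatrix, hw]
  have hone : (1 : Matrix (Fin 2) (Fin 2) R[X]).map derivative = 0 := by
    ext1 i j
    fin_cases i <;> fin_cases j <;> simp
  rw [transfer_succ, map_derivative_mul, hstep]
  induction n with
  | zero => simp [hone]
  | succ n ih =>
    rw [transfer_succ w 0 n, map_derivative_mul, hstep, ih, Finset.Nat.sum_antidiagonal_succ',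
      Finset.mul_sum]
    refine congrArg₂ _ (by simp [transfer_succ]) (Finset.sum_congr rfl fun p hp => ?_)
    rw [transfer_succ, ← Finset.HasAntidiagonal.mem_antidiagonal.1 hp, mul_assoc, mul_assoc,
      mul_assoc]
    congr 3
    push_cast
    ring

lemma transfer_succ_upper_right {R : Type*} [CommRing R] (w : ℤ → R) (m : ℤ) (n : ℕ) :
    transfer w m (n + 1) 0 1 = -transfer w (m + 1) n 0 0 := by
  rw [add_comm n, transfer_add]
  simp [transfer_succ, stepMatrix, Matrix.mul_apply]

lemma derivative_discriminant {v : ℤ → ℝ} {N : ℕ} (hv : ∀ k, v (k + N) = v k) :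
    derivative (discriminant v N) =
      -∑ k ∈ Finset.range N, transfer (fun j => (X : ℝ[X]) - C (v j)) k N 0 1 := by
  obtain _ | n := N
  · simp [discriminant]
  have htrace (M : Matrix (Fin 2) (Fin 2) ℝ[X]) :
      derivative M.trace = (M.map derivative).trace := by
    simp [Matrix.trace_fin_two]
  rw [discriminant, htrace, map_derivative_transfer_succ fun k => by simp, Matrix.trace_sum,
    ← Finset.sum_neg_distrib, Finset.Nat.sum_antidiagonal_eq_sum_range_succ_mk]
  refine Finset.sum_congr rfl fun k hk => ?_
  have hkn : n - k + k = n := by grind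
  have hperiod : transfer _ (0 + ((n + 1 : ℕ) : ℤ)) k = _ :=
    transfer_add_period 0 (w := fun j => (X : ℝ[X]) - C (v j)) (fun j => by rw [hv]) k
  rw [Matrix.trace_mul_comm, ← mul_assoc, Matrix.trace_mul_comm, transfer_succ_upper_right,
    neg_neg, ← hperiod,
    show (0 : ℤ) + ((n + 1 : ℕ) : ℤ) = k + 1 + (n - k : ℕ) by grind]
  rw [← transfer_add, hkn]
  simp [Matrix.trace_fin_two, Fin.sum_univ_two, Matrix.vecMul, dotProduct]

lemma eval_derivative_discriminant {v : ℤ → ℝ} {N : ℕ} (hv : ∀ k, v (k + N) = v k) (E : ℝ) :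
    (derivative (discriminant v N)).eval E =
      -∑ k ∈ Finset.range N, transfer (fun j => E - v j) k N 0 1 := by
  rw [derivative_discriminant hv, eval_neg, eval_finsetSum]
  refine congrArg Neg.neg (Finset.sum_congr rfl fun k _ => ?_)
  have h := congrFun₂ (transfer_map (fun j => (X : ℝ[X]) - C (v j)) k (evalRingHom E) N) 0 1
  simpa using h

section RealMatrix

lemma sum_abs_eq_abs_sum_of_mul_pos {f : ℕ → ℝ} (h : ∀ k, 0 < f (k + 1) * f k) (n : ℕ) :
    ∑ k ∈ Finset.range n, |f k| = |∑ k ∈ Finset.range n, f k| := by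
  have hsame : (∀ k, 0 < f k) ∨ ∀ k, f k < 0 := by
    refine (pos_and_pos_or_neg_and_neg_of_mul_pos (h 0)).imp (fun h0 k => ?_) fun h0 k => ?_
    · exact k.rec h0.2 fun k hk => (pos_iff_pos_of_mul_pos (h k)).2 hk
    · exact k.rec h0.2 fun k hk => (neg_iff_neg_of_mul_pos (h k)).2 hk
  obtain hpos | hneg := hsame
  · rw [abs_of_nonneg (Finset.sum_nonneg fun k _ => (hpos k).le)]
    exact Finset.sum_congr rfl fun k _ => abs_of_pos (hpos k)
  · rw [abs_of_nonpos (Finset.sum_nonpos fun k _ => (hneg k).le), ← Finset.sum_neg_distrib]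
    exact Finset.sum_congr rfl fun k _ => abs_of_neg (hneg k)

section ConjugateMatrices

variable {M : Matrix (Fin 2) (Fin 2) ℝ}

lemma offDiag_mul_neg (hM : M.det = 1) (htr : M.trace ^ 2 < 4) : M 0 1 * M 1 0 < 0 := by
  rw [Matrix.det_fin_two] at hM
  rw [Matrix.trace_fin_two] at htr
  nlinarith [sq_nonneg (M 0 0 - M 1 1)]

lemma sq_mul_add_sq_le (hM : M.det = 1) {s : ℝ} (hs : 4 * s ^ 2 = 4 - M.trace ^ 2) (x y : ℝ) :
    s ^ 2 * (x ^ 2 + y ^ 2) ≤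
      (M 1 0 - M 0 1) * (M 1 0 * x ^ 2 + (M 1 1 - M 0 0) * x * y - M 0 1 * y ^ 2) := by
  rw [Matrix.det_fin_two] at hM
  rw [Matrix.trace_fin_two] at hs
  have hsquares : (M 1 0 - M 0 1) * (M 1 0 * x ^ 2 + (M 1 1 - M 0 0) * x * y - M 0 1 * y ^ 2) -
      s ^ 2 * (x ^ 2 + y ^ 2) = (M 1 0 * x + (M 1 1 - M 0 0) / 2 * y) ^ 2 +
        ((M 1 1 - M 0 0) / 2 * x - M 0 1 * y) ^ 2 := by
    linear_combination (-(x ^ 2 + y ^ 2)) * (hs / 4 - hM)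
  linarith [sq_nonneg (M 1 0 * x + (M 1 1 - M 0 0) / 2 * y),
    sq_nonneg ((M 1 1 - M 0 0) / 2 * x - M 0 1 * y)]

lemma offDiag_of_mul_eq_mul {R : Type*} [CommRing R] {A M M' : Matrix (Fin 2) (Fin 2) R}
    (hA : A.det = 1) (h : M' * A = A * M) :
    M 1 0 = M' 1 0 * A 0 0 ^ 2 + (M' 1 1 - M' 0 0) * A 0 0 * A 1 0 - M' 0 1 * A 1 0 ^ 2 ∧
    -M 0 1 = M' 1 0 * A 0 1 ^ 2 + (M' 1 1 - M' 0 0) * A 0 1 * A 1 1 - M' 0 1 * A 1 1 ^ 2 := by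
  rw [Matrix.det_fin_two] at hA
  have hentry (i j : Fin 2) := congrFun₂ h i j
  simp only [Matrix.mul_apply, Fin.sum_univ_two] at hentry
  constructor
  · linear_combination (-M 1 0) * hA + A 1 0 * hentry 0 0 - A 0 0 * hentry 1 0
  · linear_combination M 0 1 * hA + A 1 1 * hentry 0 1 - A 0 1 * hentry 1 1

/-- The size of the off-diagonal part of a matrix. For elliptic unimodular matrices it measures
the distance to the rotations, up to conjugation. -/
def offDiagSize (M : Matrix (Fin 2) (Fin 2) ℝ) : ℝ := |M 0 1| + |M 1 0|

lemma offDiagSize_nonneg (M : Matrix (Fin 2) (Fin 2) ℝ) : 0 ≤ offDiagSize M :=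
  add_nonneg (abs_nonneg _) (abs_nonneg _)

lemma abs_lower_left_sub_upper_right_le (M : Matrix (Fin 2) (Fin 2) ℝ) :
    |M 1 0 - M 0 1| ≤ offDiagSize M :=
  (abs_sub _ _).trans_eq (add_comm _ _)

lemma mul_trace_le_offDiagSize {A M M' : Matrix (Fin 2) (Fin 2) ℝ} (hA : A.det = 1)
    (hconj : M' * A = A * M) (hM' : M'.det = 1) {s : ℝ} (hs : 4 * s ^ 2 = 4 - M'.trace ^ 2) :
    s * |A.trace| ≤ offDiagSize M + offDiagSize M' := by
  obtain ⟨h10, h01⟩ := offDiag_of_mul_eq_mul hA hconj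
  have hentries : s ^ 2 * (A 0 0 ^ 2 + A 1 0 ^ 2 + (A 0 1 ^ 2 + A 1 1 ^ 2)) ≤
      offDiagSize M' * offDiagSize M := by
    calc s ^ 2 * (A 0 0 ^ 2 + A 1 0 ^ 2 + (A 0 1 ^ 2 + A 1 1 ^ 2))
        ≤ (M' 1 0 - M' 0 1) * M 1 0 + (M' 1 0 - M' 0 1) * -M 0 1 := by
          rw [mul_add, h10, h01]
          exact add_le_add (sq_mul_add_sq_le hM' hs _ _) (sq_mul_add_sq_le hM' hs _ _)
      _ = (M' 1 0 - M' 0 1) * (M 1 0 - M 0 1) := by ring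
      _ ≤ |M' 1 0 - M' 0 1| * |M 1 0 - M 0 1| := (le_abs_self _).trans_eq (abs_mul _ _)
      _ ≤ offDiagSize M' * offDiagSize M :=
        mul_le_mul (abs_lower_left_sub_upper_right_le _) (abs_lower_left_sub_upper_right_le _)
          (abs_nonneg _) (offDiagSize_nonneg _)
  have htrace : A.trace ^ 2 ≤ 2 * (A 0 0 ^ 2 + A 1 0 ^ 2 + (A 0 1 ^ 2 + A 1 1 ^ 2)) := by
    rw [Matrix.trace_fin_two]
    nlinarith [sq_nonneg (A 0 0 - A 1 1), sq_nonneg (A 0 1), sq_nonneg (A 1 0)]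
  refine (abs_le_of_sq_le_sq' ?_
    (add_nonneg (offDiagSize_nonneg M) (offDiagSize_nonneg M'))).2
  rw [mul_pow, sq_abs]
  nlinarith [mul_le_mul_of_nonneg_left htrace (sq_nonneg s),
    sq_nonneg (offDiagSize M - offDiagSize M'), sq_nonneg (offDiagSize M),
    sq_nonneg (offDiagSize M')]

end ConjugateMatrices

variable {w : ℤ → ℝ} {N : ℕ} (hw : ∀ k, w (k + N) = w k)
include hw

lemma transfer_add_one_lower_left (m : ℤ) : transfer w (m + 1) N 1 0 = -transfer w m N 0 1 := by
  have h := transfer_mul_transfer m hw 1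
  have hone : transfer w m 1 = stepMatrix (w m) := by simp [transfer_succ]
  rw [hone, Nat.cast_one] at h
  have h11 := congrFun₂ h 1 1
  simpa [stepMatrix, Matrix.mul_apply, neg_eq_iff_eq_neg] using h11

lemma sum_abs_upper_right (htr : (transfer w 0 N).trace ^ 2 < 4) :
    ∑ k ∈ Finset.range N, |transfer w k N 0 1| = |∑ k ∈ Finset.range N, transfer w k N 0 1| := by
  refine sum_abs_eq_abs_sum_of_mul_pos (fun k => ?_) N
  have h := offDiag_mul_neg (det_transfer w (k + 1) N) (by rwa [trace_transfer _ hw])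
  rw [transfer_add_one_lower_left hw] at h
  push_cast
  linarith

lemma sum_offDiagSize_transfer :
    ∑ k ∈ Finset.range N, offDiagSize (transfer w k N) =
      2 * ∑ k ∈ Finset.range N, |transfer w k N 0 1| := by
  simp only [offDiagSize, Finset.sum_add_distrib, two_mul]
  congr 1
  have hperiod : transfer w (N : ℤ) N = transfer w 0 N := by
    simpa using transfer_add_period 0 hw N
  have hsum := Finset.sum_range_succ (fun k : ℕ => |transfer w k N 1 0|) N
  rw [Finset.sum_range_succ', Nat.cast_zero, hperiod, add_left_inj] at hsum
  rw [← hsum]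
  refine Finset.sum_congr rfl fun k _ => ?_
  rw [Nat.cast_succ, transfer_add_one_lower_left hw, abs_neg]

lemma mul_growth_le_abs_sum_upper_right {s : ℝ} (hs : 0 ≤ s) (htr : (transfer w 0 N).trace ^ 2 < 4)
    (hs2 : 4 * s ^ 2 = 4 - (transfer w 0 N).trace ^ 2) {a r L : ℕ} (haL : a + L + r ≤ N) {K : ℝ}
    (hK : ∀ k ∈ Finset.Ico a (a + L), K ≤ |(transfer w k r).trace|) :
    s * K * L ≤ 4 * |∑ k ∈ Finset.range N, transfer w k N 0 1| := by
  let τ : ℕ → ℝ := fun k => offDiagSize (transfer w k N)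
  have hpair (k : ℕ) (hk : k ∈ Finset.Ico a (a + L)) : s * K ≤ τ k + τ (k + r) := by
    refine (mul_le_mul_of_nonneg_left (hK k hk) hs).trans
      (mul_trace_le_offDiagSize (det_transfer w k r) ?_ (det_transfer _ _ _) ?_)
    · rw [Nat.cast_add]
      exact transfer_mul_transfer k hw r
    · rw [trace_transfer _ hw, hs2]
  have hle {b c : ℕ} (hc : c ≤ N) :
      ∑ k ∈ Finset.Ico b c, τ k ≤ 2 * |∑ k ∈ Finset.range N, transfer w k N 0 1| := by
    rw [← sum_abs_upper_right hw htr, ← sum_offDiagSize_transfer hw, Finset.range_eq_Ico]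
    exact Finset.sum_le_sum_of_subset_of_nonneg (Finset.Ico_subset_Ico b.zero_le hc)
      fun _ _ _ => offDiagSize_nonneg _
  calc s * K * L = ∑ _k ∈ Finset.Ico a (a + L), s * K := by
        rw [Finset.sum_const, Nat.card_Ico, add_tsub_cancel_left, nsmul_eq_mul, mul_comm]
    _ ≤ ∑ k ∈ Finset.Ico a (a + L), (τ k + τ (k + r)) := Finset.sum_le_sum hpair
    _ = ∑ k ∈ Finset.Ico a (a + L), τ k + ∑ k ∈ Finset.Ico (a + r) (a + L + r), τ k := by
      rw [Finset.sum_add_distrib, Finset.sum_Ico_add' τ]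
    _ ≤ 4 * |∑ k ∈ Finset.range N, transfer w k N 0 1| := by
      linarith [hle (b := a) (c := a + L) (by omega), hle (b := a + r) haL]

end RealMatrix

end BandEstimate

section BandMeasure

open Polynomial Matrix

lemma degree_transfer (v : ℤ → ℝ) (m : ℤ) (n : ℕ) :
    (transfer (fun k => (X : ℝ[X]) - C (v k)) m n 0 0).degree = n ∧
    (transfer (fun k => (X : ℝ[X]) - C (v k)) m n 1 0).degree < n := by
  induction n with
  | zero => simp
  | succ n ih =>
    obtain ⟨h0, h1⟩ := ih
    rw [transfer_succ]
    simp only [stepMatrix, Matrix.mul_apply, Fin.sum_univ_two, Matrix.of_apply, Matrix.cons_val',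
      Matrix.cons_val_zero, Matrix.cons_val_one, Matrix.cons_val_fin_one, neg_one_mul, one_mul,
      zero_mul, add_zero, ← sub_eq_add_neg]
    have hmul : ((X - C (v (m + n))) * transfer (fun k => (X : ℝ[X]) - C (v k)) m n 0 0).degree =
        ((n + 1 : ℕ) : WithBot ℕ) := by
      rw [degree_mul, degree_X_sub_C, h0, add_comm]
      rfl
    have hlt : (n : WithBot ℕ) < ((n + 1 : ℕ) : WithBot ℕ) := by
      exact_mod_cast n.lt_succ_self
    refine ⟨?_, h0.trans_lt hlt⟩
    rw [degree_sub_eq_left_of_degree_lt (hmul ▸ h1.trans hlt), hmul]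

lemma natDegree_discriminant (v : ℤ → ℝ) {N : ℕ} (hN : 0 < N) :
    (discriminant v N).natDegree = N := by
  obtain ⟨n, rfl⟩ := Nat.exists_eq_succ_of_ne_zero hN.ne'
  have h00 := (degree_transfer v 0 (n + 1)).1
  have h11 : transfer (fun k => (X : ℝ[X]) - C (v k)) 0 (n + 1) 1 1 =
      transfer (fun k => (X : ℝ[X]) - C (v k)) 0 n 0 1 := by
    rw [transfer_succ]
    simp [stepMatrix, Matrix.mul_apply]
  have hlt : (transfer (fun k => (X : ℝ[X]) - C (v k)) 0 n 0 1).degree < (n + 1 : ℕ) := by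
    obtain _ | n := n
    · simp
    · rw [transfer_succ_upper_right, degree_neg, (degree_transfer v (0 + 1) n).1]
      exact_mod_cast by omega
  refine natDegree_eq_of_degree_eq_some ?_
  rw [discriminant, Matrix.trace_fin_two, h11,
    degree_add_eq_left_of_degree_lt (h00.symm ▸ hlt), h00]

open Classical in
lemma eval_injOn_setOf_card_roots_derivative_eq {P : ℝ[X]} (hP : derivative P ≠ 0) (i : ℕ) :
    Set.InjOn (fun E => P.eval E) {E | {z ∈ (derivative P).roots.toFinset | z < E}.card = i} := by
  have hcount {x y : ℝ} (hxy : x < y) (heq : P.eval x = P.eval y) :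
      {z ∈ (derivative P).roots.toFinset | z < x}.card <
        {z ∈ (derivative P).roots.toFinset | z < y}.card := by
    obtain ⟨z, hz, hz0⟩ := exists_hasDerivAt_eq_zero hxy P.continuous.continuousOn heq
      fun z _ => P.hasDerivAt z
    have hzroot : z ∈ (derivative P).roots.toFinset := by
      rw [Multiset.mem_toFinset, mem_roots hP]
      exact hz0
    refine Finset.card_lt_card (Finset.ssubset_iff_of_subset ?_ |>.2
      ⟨z, Finset.mem_filter.2 ⟨hzroot, hz.2⟩, fun h => (Finset.mem_filter.1 h).2.not_gt hz.1⟩)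
    exact Finset.monotone_filter_right _ fun u _ hu => lt_trans hu hxy
  intro x hx y hy heq
  by_contra hne
  obtain hlt | hlt := lt_or_gt_of_ne hne
  · exact (hcount hlt heq).ne (hx.trans hy.symm)
  · exact (hcount hlt heq.symm).ne (hy.trans hx.symm)

lemma mul_volume_le_pi_of_injOn {f f' : ℝ → ℝ} {s : Set ℝ} (hs : MeasurableSet s)
    (hf : ∀ x ∈ s, HasDerivAt f (f' x) x) (hinj : Set.InjOn f s) (h2 : ∀ x ∈ s, |f x| < 2) {c : ℝ}
    (hder : ∀ x ∈ s, c * √(4 - f x ^ 2) ≤ |f' x|) :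
    ENNReal.ofReal c * volume s ≤ ENNReal.ofReal Real.pi := by
  have hmem (x : ℝ) (hx : x ∈ s) : -1 < f x / 2 ∧ f x / 2 < 1 := by
    obtain ⟨hlo, hhi⟩ := abs_lt.1 (h2 x hx)
    constructor <;> linarith
  let φ' : ℝ → ℝ := fun x => -(1 / √(1 - (f x / 2) ^ 2)) * (f' x / 2)
  have hφ (x : ℝ) (hx : x ∈ s) : HasDerivWithinAt (fun x => Real.arccos (f x / 2)) (φ' x) s x :=
    (HasDerivAt.comp (h₂ := Real.arccos) x (Real.hasDerivAt_arccos (hmem x hx).1.ne'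
      (hmem x hx).2.ne) ((hf x hx).div_const 2)).hasDerivWithinAt
  have hφinj : Set.InjOn (fun x => Real.arccos (f x / 2)) s := fun x hx y hy hxy => by
    have h := Real.arccos_injOn ⟨(hmem x hx).1.le, (hmem x hx).2.le⟩
      ⟨(hmem y hy).1.le, (hmem y hy).2.le⟩ hxy
    exact hinj hx hy (by linarith)
  have hc (x : ℝ) (hx : x ∈ s) : c ≤ |φ' x| := by
    have hpos : 0 < 4 - f x ^ 2 := by nlinarith [abs_lt.1 (h2 x hx)]
    have hsqrt : √(1 - (f x / 2) ^ 2) = √(4 - f x ^ 2) / 2 := by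
      rw [show 1 - (f x / 2) ^ 2 = (4 - f x ^ 2) / 2 ^ 2 by ring, Real.sqrt_div hpos.le,
        Real.sqrt_sq zero_le_two]
    have habs : |φ' x| = |f' x| / √(4 - f x ^ 2) := by
      simp only [φ', hsqrt, abs_mul, abs_neg, abs_div, abs_one, abs_two,
        abs_of_nonneg (Real.sqrt_nonneg _)]
      field_simp
    rw [habs, le_div_iff₀ (Real.sqrt_pos.2 hpos)]
    exact hder x hx
  calc ENNReal.ofReal c * volume s = ∫⁻ _ in s, ENNReal.ofReal c := (setLIntegral_const _ _).symm
    _ ≤ ∫⁻ x in s, ENNReal.ofReal |φ' x| * 1 := setLIntegral_mono' hs fun x hx => by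
      rw [mul_one]
      exact ENNReal.ofReal_le_ofReal (hc x hx)
    _ = volume ((fun x => Real.arccos (f x / 2)) '' s) := by
      rw [← lintegral_image_eq_lintegral_abs_deriv_mul hs hφ hφinj (fun _ => 1), setLIntegral_one]
    _ ≤ volume (Set.Icc 0 Real.pi) := measure_mono <|
      Set.image_subset_iff.2 fun x _ => ⟨Real.arccos_nonneg _, Real.arccos_le_pi _⟩
    _ = ENNReal.ofReal Real.pi := by rw [Real.volume_Icc, sub_zero]

open Classical in
lemma volume_le_of_mul_sqrt_le_abs_derivative {P : ℝ[X]} {S : Set ℝ} (hS : MeasurableSet S)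
    (h2 : ∀ E ∈ S, |P.eval E| < 2) {c : ℝ} (hc : 0 < c)
    (hder : ∀ E ∈ S, c * √(4 - P.eval E ^ 2) ≤ |(derivative P).eval E|) :
    volume S ≤ ENNReal.ofReal (P.natDegree * (Real.pi / c)) := by
  obtain rfl | ⟨E, hE⟩ := S.eq_empty_or_nonempty
  · simp
  have hP : derivative P ≠ 0 := fun h => by
    have hpos : 0 < 4 - P.eval E ^ 2 := by nlinarith [abs_lt.1 (h2 E hE)]
    have := hder E hE
    rw [h, eval_zero, abs_zero] at this
    exact this.not_gt (mul_pos hc (Real.sqrt_pos.2 hpos))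
  -- The critical points cut the line into at most `P.natDegree` pieces on which `P` is injective.
  let R := (derivative P).roots.toFinset
  let count : ℝ → ℕ := fun E => {z ∈ R | z < E}.card
  have hcount (E : ℝ) : count E < P.natDegree := by
    calc count E ≤ (derivative P).natDegree :=
          (Finset.card_filter_le _ _).trans ((Multiset.toFinset_card_le _).trans (card_roots' _))
      _ < P.natDegree := natDegree_derivative_lt fun h => hP (derivative_eq_zero.2 h)
  have hmeas : Measurable count := Monotone.measurable fun x y hxy =>
    Finset.card_le_card (Finset.monotone_filter_right _ fun z _ hz => lt_of_lt_of_le hz hxy)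
  have hpiece (i : ℕ) : volume (S ∩ count ⁻¹' {i}) ≤ ENNReal.ofReal (Real.pi / c) := by
    rw [ENNReal.ofReal_div_of_pos hc, ENNReal.le_div_iff_mul_le
      (Or.inl (by simpa using hc)) (Or.inl ENNReal.ofReal_ne_top), mul_comm]
    exact mul_volume_le_pi_of_injOn (hS.inter (hmeas (measurableSet_singleton i)))
      (fun x _ => P.hasDerivAt x)
      ((eval_injOn_setOf_card_roots_derivative_eq hP i).mono fun x hx => hx.2)
      (fun x hx => h2 x hx.1) fun x hx => hder x hx.1
  have hcover : S ⊆ ⋃ i ∈ Finset.range P.natDegree, S ∩ count ⁻¹' {i} := fun E hE =>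
    Set.mem_biUnion (Finset.mem_coe.2 (Finset.mem_range.2 (hcount E))) ⟨hE, rfl⟩
  calc volume S ≤ ∑ i ∈ Finset.range P.natDegree, volume (S ∩ count ⁻¹' {i}) :=
        (measure_mono hcover).trans (measure_biUnion_finset_le _ _)
    _ ≤ P.natDegree • ENNReal.ofReal (Real.pi / c) :=
      (Finset.sum_le_card_nsmul _ _ _ fun i _ => hpiece i).trans_eq (by rw [Finset.card_range])
    _ = ENNReal.ofReal (P.natDegree * (Real.pi / c)) := by
      rw [nsmul_eq_mul, ENNReal.ofReal_mul (Nat.cast_nonneg _), ENNReal.ofReal_natCast]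

lemma finite_setOf_abs_eval_eq {P : ℝ[X]} (hP : 0 < P.natDegree) (a : ℝ) :
    {E : ℝ | |P.eval E| = a}.Finite := by
  have hne (b : ℝ) : P - C b ≠ 0 := fun h => hP.ne' (by rw [sub_eq_zero.1 h, natDegree_C])
  refine (((P - C a).rootSet_finite ℝ).union ((P - C (-a)).rootSet_finite ℝ)).subset fun E hE => ?_
  refine (eq_or_eq_neg_of_abs_eq hE).imp (fun h => ?_) fun h => ?_ <;>
  exact (mem_rootSet_of_ne (hne _)).2 (by simp [h])

lemma volume_bands_le {v : ℤ → ℝ} {N : ℕ} (hN : 0 < N) (hv : ∀ k, v (k + N) = v k) {B : Set ℝ}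
    (hB : MeasurableSet B) {K L : ℝ} (hK : 0 < K) (hL : 0 < L)
    (hgrow : ∀ E ∈ B, ∃ a r l : ℕ, L ≤ l ∧ a + l + r ≤ N ∧
      ∀ k ∈ Finset.Ico a (a + l), K ≤ |(transfer (fun j => E - v j) k r).trace|) :
    volume {E ∈ B | |(discriminant v N).eval E| ≤ 2} ≤
      ENNReal.ofReal (8 * Real.pi * N / (K * L)) := by
  have hdeg := natDegree_discriminant v hN
  have hS : MeasurableSet {E ∈ B | |(discriminant v N).eval E| < 2} :=
    hB.inter (isOpen_lt (discriminant v N).continuous.abs continuous_const).measurableSet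
  have hcover : {E ∈ B | |(discriminant v N).eval E| ≤ 2} ⊆
      {E ∈ B | |(discriminant v N).eval E| < 2} ∪ {E | |(discriminant v N).eval E| = 2} :=
    fun E hE => hE.2.lt_or_eq.imp_left fun h => ⟨hE.1, h⟩
  have hopen := volume_le_of_mul_sqrt_le_abs_derivative hS (fun E hE => hE.2)
    (c := K * L / 8) (by positivity) fun E hE => ?_
  · calc volume {E ∈ B | |(discriminant v N).eval E| ≤ 2}
        ≤ volume {E ∈ B | |(discriminant v N).eval E| < 2} +
          volume {E | |(discriminant v N).eval E| = 2} :=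
            (measure_mono hcover).trans (measure_union_le _ _)
      _ ≤ ENNReal.ofReal (8 * Real.pi * N / (K * L)) := by
        rw [(finite_setOf_abs_eval_eq (hdeg.symm ▸ hN) 2).measure_zero, add_zero]
        refine hopen.trans_eq ?_
        rw [hdeg]
        congr 1
        field_simp
  · obtain ⟨a, r, l, hLl, harl, htrace⟩ := hgrow E hE.1
    have hpos : 0 < 4 - (discriminant v N).eval E ^ 2 := by nlinarith [abs_lt.1 hE.2]
    have hgrowth := mul_growth_le_abs_sum_upper_right (w := fun j => E - v j)
      (fun k => by rw [hv]) (s := √(4 - (discriminant v N).eval E ^ 2) / 2) (by positivity)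
      (by rw [← eval_discriminant]; linarith)
      (by rw [← eval_discriminant, div_pow, Real.sq_sqrt hpos.le]; ring) harl htrace
    rw [eval_derivative_discriminant hv, abs_neg]
    have hLl' : √(4 - (discriminant v N).eval E ^ 2) / 2 * K * L ≤
        √(4 - (discriminant v N).eval E ^ 2) / 2 * K * l := by gcongr
    linarith

end BandMeasure

section Gaps

open Polynomial Matrix

section TraceTwoCos

variable {M : Matrix (Fin 2) (Fin 2) ℝ} {θ : ℝ}

lemma sin_smul_pow_succ (hM : M.det = 1) (hθ : M.trace = 2 * Real.cos θ) (n : ℕ) :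
    Real.sin θ • M ^ (n + 1) = Real.sin ((n + 1) * θ) • M - Real.sin (n * θ) • 1 := by
  induction n with
  | zero => simp
  | succ n ih =>
    have hsin : Real.sin ((n + 1 + 1) * θ) =
        2 * Real.cos θ * Real.sin ((n + 1) * θ) - Real.sin (n * θ) := by
      rw [show ((n : ℝ) + 1 + 1) * θ = (n + 1) * θ + θ by ring,
        show (n : ℝ) * θ = (n + 1) * θ - θ by ring, Real.sin_add, Real.sin_sub]
      ring
    rw [pow_succ, ← smul_mul_assoc, ih, sub_mul, smul_mul_assoc, smul_mul_assoc,
      mul_self_eq_trace_smul_sub_one hM, one_mul, hθ]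
    push_cast
    rw [hsin]
    module

lemma exists_pow_eq_smul_one (hM : M.det = 1) (hθ : M.trace = 2 * Real.cos θ)
    (hsin : Real.sin θ ≠ 0) {q k : ℕ} (hk : (q + 1) * θ = k * Real.pi) :
    ∃ η : ℝ, |η| = 1 ∧ M ^ (q + 1) = η • 1 := by
  refine ⟨Real.cos (k * Real.pi), by simp [Real.cos_nat_mul_pi], ?_⟩
  have hq : Real.sin (q * θ) = -Real.cos (k * Real.pi) * Real.sin θ := by
    rw [show (q : ℝ) * θ = k * Real.pi - θ by linarith, Real.sin_sub, Real.sin_nat_mul_pi]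
    ring
  have hpow := sin_smul_pow_succ hM hθ q
  rw [hk, Real.sin_nat_mul_pi, hq, zero_smul, zero_sub] at hpow
  refine smul_right_injective _ hsin (?_ : Real.sin θ • _ = Real.sin θ • _)
  rw [hpow]
  module

end TraceTwoCos

lemma transfer_two_add {R : Type*} [CommRing R] (w : ℤ → R) (n : ℕ) :
    transfer w 0 (2 + n) = transfer w 2 n * (stepMatrix (w 1) * stepMatrix (w 0)) := by
  rw [transfer_add]
  simp [transfer_succ w 0 1, transfer_succ w 0 0]

lemma trace_mul_stepMatrix_mul_stepMatrix {R : Type*} [CommRing R] {x y η : R}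
    {A : Matrix (Fin 2) (Fin 2) R} (hA : A * (stepMatrix y * stepMatrix x) = η • 1) (t : R) :
    (A * (stepMatrix (y + t) * stepMatrix (x - t))).trace = η * (2 + t ^ 2) := by
  have hinv : A = η • ((stepMatrix x).adjugate * (stepMatrix y).adjugate) := by
    calc A = A * (stepMatrix y * stepMatrix x) * (stepMatrix y * stepMatrix x).adjugate := by
          rw [mul_assoc, Matrix.mul_adjugate, Matrix.det_mul, det_stepMatrix, det_stepMatrix,
            mul_one, one_smul, mul_one]
      _ = η • ((stepMatrix x).adjugate * (stepMatrix y).adjugate) := by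
          rw [hA, Matrix.adjugate_mul_distrib, smul_mul_assoc, one_mul]
  rw [hinv]
  simp [Matrix.trace_fin_two, stepMatrix, Matrix.adjugate_fin_two]
  ring

lemma exists_perturbation_of_transfer_eq {v : ℤ → ℝ} {N : ℕ} (hN : 2 ≤ N)
    (hv : ∀ k, v (k + N) = v k) {E η : ℝ} (hη : |η| = 1)
    (hM : transfer (fun j => E - v j) 0 N = η • 1) {t : ℝ} (ht : 0 < t) :
    ∃ v' : ℤ → ℝ, (∀ k, v' (k + N) = v' k) ∧ (∀ k, |v' k - v k| ≤ t) ∧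
      2 < |(discriminant v' N).eval E| := by
  let v' : ℤ → ℝ := fun k => v k +
    (if (N : ℤ) ∣ k then t else if (N : ℤ) ∣ k - 1 then -t else 0)
  refine ⟨v', fun k => ?_, fun k => ?_, ?_⟩
  · simp only [v', hv, add_sub_right_comm, dvd_add_self_right]
  · simp only [v', add_sub_cancel_left]
    split_ifs <;> simp [abs_of_pos ht, ht.le]
  · obtain ⟨n, rfl⟩ := Nat.exists_eq_add_of_le hN
    have hndvd (j : ℤ) (h0 : 0 < j) (h1 : j < 2 + n) : ¬ ((2 + n : ℕ) : ℤ) ∣ j := fun h =>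
      absurd (Int.le_of_dvd h0 h) (by push_cast; omega)
    have hrest : transfer (fun j => E - v' j) 2 n = transfer (fun j => E - v j) 2 n :=
      transfer_congr fun k hk => by
        simp only [v']
        rw [if_neg (hndvd _ (by omega) (by omega)), if_neg (hndvd _ (by omega) (by omega)),
          add_zero]
    have h0 : E - v' 0 = E - v 0 - t := by simp [v', sub_sub]
    have h1 : E - v' 1 = E - v 1 + t := by
      simp only [v']
      rw [if_neg (hndvd 1 (by omega) (by omega)), if_pos (by simp)]
      ring
    rw [transfer_two_add] at hM
    rw [eval_discriminant, transfer_two_add, hrest, h0, h1,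
      trace_mul_stepMatrix_mul_stepMatrix hM, abs_mul, hη, one_mul, abs_of_pos (by positivity)]
    linarith [pow_pos ht 2]

lemma exists_nat_mul_pi_mem_Ioo {a b : ℝ} (ha : 0 ≤ a) (hab : a < b) :
    ∃ Q : ℕ, ∀ q ≥ Q, ∃ k : ℕ, k * Real.pi / (q + 1) ∈ Set.Ioo a b := by
  obtain ⟨Q, hQ⟩ := exists_nat_gt (Real.pi / (b - a))
  refine ⟨Q, fun q hq => ⟨⌊a * (q + 1) / Real.pi⌋₊ + 1, ?_, ?_⟩⟩
  · have hfloor := Nat.lt_floor_add_one (a * (q + 1) / Real.pi)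
    rw [div_lt_iff₀ Real.pi_pos] at hfloor
    rw [lt_div_iff₀ (by positivity)]
    exact_mod_cast hfloor
  · have hfloor := Nat.floor_le (a := a * (q + 1) / Real.pi) (by positivity)
    rw [le_div_iff₀ Real.pi_pos] at hfloor
    rw [div_lt_iff₀ (sub_pos.2 hab)] at hQ
    rw [div_lt_iff₀ (by positivity)]
    have hqQ : (Q : ℝ) ≤ q := by exact_mod_cast hq
    push_cast
    nlinarith

lemma exists_angle_of_eval_ne {D : ℝ → ℝ} (hD : Continuous D) {a b : ℝ} (hab : a ≤ b)
    (h2 : ∀ E ∈ Set.Icc a b, |D E| < 2) (hne : D a ≠ D b) :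
    ∃ Q : ℕ, ∀ q ≥ Q, ∃ E ∈ Set.Icc a b, ∃ θ : ℝ, D E = 2 * Real.cos θ ∧ Real.sin θ ≠ 0 ∧
      ∃ k : ℕ, (q + 1) * θ = k * Real.pi := by
  let θ : ℝ → ℝ := fun E => Real.arccos (D E / 2)
  have hθ : Continuous θ := Real.continuous_arccos.comp (hD.div_const 2)
  have hmem (E : ℝ) (hE : E ∈ Set.Icc a b) : -1 ≤ D E / 2 ∧ D E / 2 ≤ 1 := by
    obtain ⟨hlo, hhi⟩ := abs_lt.1 (h2 E hE)
    constructor <;> linarith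
  have hθne : θ a ≠ θ b := fun h => hne <| by
    have := Real.arccos_injOn (hmem a ⟨le_rfl, hab⟩) (hmem b ⟨hab, le_rfl⟩) h
    linarith
  have hmin : 0 ≤ min (θ a) (θ b) := le_min (Real.arccos_nonneg _) (Real.arccos_nonneg _)
  have hmax : max (θ a) (θ b) ≤ Real.pi := max_le (Real.arccos_le_pi _) (Real.arccos_le_pi _)
  obtain ⟨Q, hQ⟩ := exists_nat_mul_pi_mem_Ioo hmin (min_lt_max.2 hθne)
  refine ⟨Q, fun q hq => ?_⟩
  obtain ⟨k, hk⟩ := hQ q hq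
  obtain ⟨E, hE, hEθ⟩ := intermediate_value_uIcc hθ.continuousOn (Set.Ioo_subset_Icc_self hk)
  rw [Set.uIcc_of_le hab] at hE
  refine ⟨E, hE, k * Real.pi / (q + 1), ?_, ?_, k, by field_simp⟩
  · rw [← hEθ, Real.cos_arccos (hmem E hE).1 (hmem E hE).2]
    ring
  · exact (Real.sin_pos_of_pos_of_lt_pi (hmin.trans_lt hk.1) (hk.2.trans_le hmax)).ne'

lemma exists_Icc_abs_eval_lt {P : ℝ[X]} (hP : 0 < P.natDegree) {c : ℝ} {U : Set ℝ}
    (hU : IsOpen U) (hne : U.Nonempty) (hle : ∀ E ∈ U, |P.eval E| ≤ c) :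
    ∃ a b, a ≤ b ∧ Set.Icc a b ⊆ U ∧ (∀ E ∈ Set.Icc a b, |P.eval E| < c) ∧
      P.eval a ≠ P.eval b := by
  have hinf {s : Set ℝ} (hs : s.Infinite) (x : ℝ) : ∃ E ∈ s, |P.eval E| ≠ x := by
    by_contra! h
    exact hs ((finite_setOf_abs_eval_eq hP x).subset h)
  obtain ⟨x, hx⟩ := hne
  obtain ⟨a, haU, ha⟩ := hinf (infinite_of_mem_nhds x (hU.mem_nhds hx)) c
  have hV : IsOpen (U ∩ {E | |P.eval E| < c}) :=
    hU.inter (isOpen_lt P.continuous.abs continuous_const)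
  obtain ⟨r, hr, hball⟩ := Metric.isOpen_iff.1 hV a ⟨haU, (hle a haU).lt_of_ne ha⟩
  obtain ⟨b, hb, hab⟩ := hinf (Set.Ioo_infinite (lt_add_of_pos_right a hr)) |P.eval a|
  have hIcc : Set.Icc a b ⊆ U ∩ {E | |P.eval E| < c} := fun E hE => hball <| by
    rw [Metric.mem_ball, Real.dist_eq, abs_of_nonneg (sub_nonneg.2 hE.1)]
    linarith [hE.2, hb.2]
  exact ⟨a, b, hb.1.le, fun E hE => (hIcc hE).1, fun E hE => (hIcc hE).2,
    fun h => hab (by rw [h])⟩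

lemma exists_gap_perturbation {v : ℤ → ℝ} {p : ℕ} (hp : 0 < p) (hv : ∀ k, v (k + p) = v k)
    {U : Set ℝ} (hU : IsOpen U) (hne : U.Nonempty) :
    ∃ Q : ℕ, ∀ q ≥ Q, ∃ E ∈ U, ∀ δ > 0, ∃ v' : ℤ → ℝ,
      (∀ k, v' (k + (p * q : ℕ)) = v' k) ∧ (∀ k, |v' k - v k| ≤ δ) ∧
      ∃ r : ℕ, 0 < r ∧ (∀ k, v' (k + r) = v' k) ∧ 2 < |(discriminant v' r).eval E| := by
  have hvq (q : ℕ) (k : ℤ) : v (k + (p * q : ℕ)) = v k := by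
    simpa [mul_comm] using Function.Periodic.nat_mul (f := v) hv q k
  by_cases hgap : ∃ E ∈ U, 2 < |(discriminant v p).eval E|
  · obtain ⟨E, hE, hE2⟩ := hgap
    exact ⟨0, fun q _ => ⟨E, hE, fun δ hδ => ⟨v, hvq q, fun k => by simpa using hδ.le,
      p, hp, hv, hE2⟩⟩⟩
  push Not at hgap
  obtain ⟨a, b, hab, hIcc, h2, hab'⟩ := exists_Icc_abs_eval_lt
    (by rwa [natDegree_discriminant v hp]) hU hne hgap
  obtain ⟨Q, hQ⟩ := exists_angle_of_eval_ne (discriminant v p).continuous hab h2 hab'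
  refine ⟨Q + 2, fun q hq => ?_⟩
  obtain ⟨q, rfl⟩ : ∃ q', q = q' + 1 := ⟨q - 1, by omega⟩
  obtain ⟨E, hE, θ, htrace, hsin, k, hk⟩ := hQ q (by omega)
  refine ⟨E, hIcc hE, fun δ hδ => ?_⟩
  rw [eval_discriminant] at htrace
  obtain ⟨η, hη, hpow⟩ := exists_pow_eq_smul_one (det_transfer _ 0 p) htrace hsin hk
  rw [← transfer_mul_period 0 fun k => by rw [hv]] at hpow
  have hN : 2 ≤ p * (q + 1) := by nlinarith
  obtain ⟨v', hper, hclose, hgap'⟩ :=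
    exists_perturbation_of_transfer_eq hN (hvq (q + 1)) hη hpow hδ
  exact ⟨v', hper, hclose, p * (q + 1), by omega, hper, hgap'⟩

lemma two_add_le_abs_trace_pow {M : Matrix (Fin 2) (Fin 2) ℝ} (hM : M.det = 1) {η : ℝ}
    (hη : 0 ≤ η) (h : 2 + η ≤ |M.trace|) (s : ℕ) : 2 + 4 ^ s * η ≤ |(M ^ 2 ^ s).trace| := by
  induction s with
  | zero => simpa using h
  | succ s ih =>
    have hdet : (M ^ 2 ^ s).det = 1 := by rw [Matrix.det_pow, hM, one_pow]
    rw [pow_succ 2, pow_mul, sq, mul_self_eq_trace_smul_sub_one hdet, Matrix.trace_sub,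
      Matrix.trace_smul, Matrix.trace_one, smul_eq_mul, Fintype.card_fin]
    have hpos : 0 ≤ 4 ^ s * η := by positivity
    have hsq : (2 + 4 ^ s * η) ^ 2 ≤ (M ^ 2 ^ s).trace ^ 2 := by
      rw [← sq_abs (Matrix.trace _)]
      exact pow_le_pow_left₀ (by positivity) ih 2
    refine le_trans ?_ (le_abs_self _)
    rw [pow_succ (4 : ℝ)]
    push_cast
    nlinarith

end Gaps

section SmallSpectrum

open Polynomial Matrix

/-- The `N`-periodic potential equal to `w i` on the `i`-th block of length `l` in `[0, N)`; it
lets different approximants of a potential act at different places of one period. -/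
def concatPotential (N l : ℕ) (w : ℕ → ℤ → ℝ) (k : ℤ) : ℝ :=
  w ((k % N).toNat / l) (k % N)

lemma concatPotential_add_period (N l : ℕ) (w : ℕ → ℤ → ℝ) (k : ℤ) :
    concatPotential N l w (k + N) = concatPotential N l w k := by
  simp only [concatPotential, Int.add_emod_right]

lemma concatPotential_natCast {N l i k : ℕ} (w : ℕ → ℤ → ℝ) (hi : i * l ≤ k)
    (hil : k < i * l + l) (hk : k < N) : concatPotential N l w k = w i k := by
  have hmod : (k : ℤ) % N = k := Int.emod_eq_of_lt (by omega) (by omega)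
  have hdiv : k / l = i := by
    rw [Nat.div_eq_iff (by omega)]
    omega
  rw [concatPotential, hmod, Int.toNat_natCast, hdiv]

lemma transfer_concatPotential {N l i k r : ℕ} (w : ℕ → ℤ → ℝ) (E : ℝ) (hi : i * l ≤ k)
    (hil : k + r ≤ i * l + l) (hN : i * l + l ≤ N) :
    transfer (fun j => E - concatPotential N l w j) k r = transfer (fun j => E - w i j) k r :=
  transfer_congr fun j hj => by
    have hkj := concatPotential_natCast (k := k + j) w (hi.trans (Nat.le_add_right k j))
      (by omega) (by omega : k + j < N)
    push_cast at hkj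
    rw [hkj]

lemma abs_concatPotential_sub_le {v : ℤ → ℝ} {N : ℕ} (hv : ∀ k, v (k + N) = v k) {δ : ℝ}
    {w : ℕ → ℤ → ℝ} (hw : ∀ i k, |w i k - v k| ≤ δ) (l : ℕ) (k : ℤ) :
    |concatPotential N l w k - v k| ≤ δ := by
  have hmod : v (k % N) = v k := by
    have hper := Function.Periodic.int_mul (f := v) hv (k / N) (k % N)
    rwa [Int.cast_id, mul_comm (k / N : ℤ), Int.emod_add_mul_ediv, eq_comm] at hper
  rw [← hmod]
  exact hw _ _

lemma exists_perturbation_two_lt_abs_eval_discriminant {v : ℤ → ℝ} {p : ℕ} (hp : 0 < p)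
    (hv : ∀ k, v (k + p) = v k) {δ : ℝ} (hδ : 0 < δ) (E₀ : ℝ) :
    ∃ (w : ℤ → ℝ) (r : ℕ), (∀ k, |w k - v k| ≤ δ) ∧ (∀ k, w (k + r) = w k) ∧
      2 < |(discriminant w r).eval E₀| := by
  obtain ⟨Q, hQ⟩ := exists_gap_perturbation hp hv Metric.isOpen_ball
    ⟨E₀, Metric.mem_ball_self (half_pos hδ)⟩
  obtain ⟨E, hE, hpert⟩ := hQ Q le_rfl
  obtain ⟨v', -, hclose, r, -, hper, hgap⟩ := hpert (δ / 2) (half_pos hδ)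
  refine ⟨fun k => v' k + (E₀ - E), r, fun k => ?_, fun k => by simp only [hper], ?_⟩
  · rw [add_sub_right_comm]
    refine (abs_add_le _ _).trans ?_
    rw [abs_sub_comm E₀]
    linarith [hclose k, (Real.dist_eq E E₀).symm.trans_lt hE]
  · have hshift : (fun k => E₀ - (v' k + (E₀ - E))) = fun k => E - v' k := by
      ext k
      ring
    rwa [eval_discriminant, hshift, ← eval_discriminant]

lemma exists_pow_le_abs_trace_transfer {w : ℤ → ℝ} {r : ℕ} (hw : ∀ k, w (k + r) = w k) {η : ℝ}
    (hη : 0 < η) (K : ℝ) : ∃ s : ℕ, ∀ E, 2 + η < |(discriminant w r).eval E| →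
      ∀ k : ℤ, K ≤ |(transfer (fun j => E - w j) k (r * 2 ^ s)).trace| := by
  obtain ⟨s, hs⟩ := pow_unbounded_of_one_lt (K / η) (show (1 : ℝ) < 4 by norm_num)
  rw [div_lt_iff₀ hη] at hs
  refine ⟨s, fun E hE k => ?_⟩
  have hwE (k : ℤ) : (fun j => E - w j) (k + r) = (fun j => E - w j) k := by simp only [hw]
  rw [transfer_mul_period _ hwE]
  refine le_trans (by linarith)
    (two_add_le_abs_trace_pow (det_transfer _ _ _) hη.le (hE.le.trans_eq ?_) s)
  rw [trace_transfer _ hwE, eval_discriminant]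

lemma exists_finite_family_le_abs_trace_transfer {v : ℤ → ℝ} {p : ℕ} (hp : 0 < p)
    (hv : ∀ k, v (k + p) = v k) {δ : ℝ} (hδ : 0 < δ) {B : Set ℝ} (hB : IsCompact B) :
    ∃ (m : ℕ) (w : ℕ → ℤ → ℝ), (∀ i k, |w i k - v k| ≤ δ) ∧ ∀ K, ∃ R : ℕ, ∀ E ∈ B,
      ∃ i < m, ∃ r ≤ R, ∀ k : ℤ, K ≤ |(transfer (fun j => E - w i j) k r).trace| := by
  choose w r hclose hper hgap using exists_perturbation_two_lt_abs_eval_discriminant hp hv hδ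
  choose η hη2 hη using fun E => exists_between (hgap E)
  obtain ⟨t, ht⟩ := hB.elim_finite_subcover
    (fun E₀ : ℝ => {E | η E₀ < |(discriminant (w E₀) (r E₀)).eval E|})
    (fun E₀ => isOpen_lt continuous_const (Polynomial.continuous _).abs)
    (fun E _ => Set.mem_iUnion.2 ⟨E, hη E⟩)
  refine ⟨t.toList.length, fun i => w (t.toList.getD i 0), fun i => hclose _, fun K => ?_⟩
  choose s hs using fun E₀ =>
    exists_pow_le_abs_trace_transfer (hper E₀) (sub_pos.2 (hη2 E₀)) K
  refine ⟨∑ E₀ ∈ t, r E₀ * 2 ^ s E₀, fun E hE => ?_⟩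
  obtain ⟨E₀, hE₀, hEE₀⟩ := Set.mem_iUnion₂.1 (ht hE)
  obtain ⟨i, hi, hiE₀⟩ := List.mem_iff_getElem.1 (Finset.mem_toList.2 hE₀)
  refine ⟨i, hi, r E₀ * 2 ^ s E₀,
    Finset.single_le_sum (f := fun E₀ => r E₀ * 2 ^ s E₀) (fun _ _ => Nat.zero_le _) hE₀, ?_⟩
  simp only [List.getD_eq_getElem _ _ hi, hiE₀]
  exact hs E₀ E (by rwa [add_sub_cancel])

lemma div_four_mul_le_cast_div_sub {m R N : ℕ} (hm : 0 < m) (hN : 4 * m * (R + 1) ≤ N) :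
    (N : ℝ) / (4 * m) ≤ (N / m - R : ℕ) := by
  have hm' : (0 : ℝ) < m := by exact_mod_cast hm
  have hfloor : (N : ℝ) / m < (N / m : ℕ) + 1 := by
    rw [div_lt_iff₀ hm']
    exact_mod_cast Nat.lt_mul_of_div_lt (Nat.lt_succ_self _) hm
  have hR : (R : ℝ) + 1 ≤ N / (4 * m) := by
    rw [le_div_iff₀ (by positivity), mul_comm]
    exact_mod_cast hN
  have hsub : ((N / m : ℕ) : ℝ) ≤ (N / m - R : ℕ) + R := by
    exact_mod_cast (by omega : N / m ≤ N / m - R + R)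
  have hfour : (N : ℝ) / m = 4 * (N / (4 * m)) := by field_simp
  linarith [show (0 : ℝ) ≤ R from R.cast_nonneg]

lemma exists_small_bands {v : ℤ → ℝ} {p : ℕ} (hp : 0 < p) (hv : ∀ k, v (k + p) = v k)
    {δ ε : ℝ} (hδ : 0 < δ) (hε : 0 < ε) {B : Set ℝ} (hB : IsCompact B) :
    ∃ Q : ℕ, ∀ q ≥ Q, ∃ v' : ℤ → ℝ, (∀ k, v' (k + (p * q : ℕ)) = v' k) ∧
      (∀ k, |v' k - v k| ≤ δ) ∧
      volume {E ∈ B | |(discriminant v' (p * q)).eval E| ≤ 2} ≤ ENNReal.ofReal ε := by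
  obtain ⟨m, w, hclose, hgrow⟩ := exists_finite_family_le_abs_trace_transfer hp hv hδ hB
  let K : ℝ := 32 * Real.pi * (m + 1 : ℕ) / ε
  have hK : 0 < K := by positivity
  obtain ⟨R, hR⟩ := hgrow K
  refine ⟨4 * (m + 1) * (R + 1), fun q hq => ?_⟩
  have hqN : 4 * (m + 1) * (R + 1) ≤ p * q := hq.trans (Nat.le_mul_of_pos_left q hp)
  have hN : 0 < p * q := lt_of_lt_of_le (by positivity) hqN
  have hlen := div_four_mul_le_cast_div_sub m.succ_pos hqN
  generalize hNdef : p * q = N at *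
  have hvN (k : ℤ) : v (k + N) = v k := by
    simpa [← hNdef, mul_comm] using Function.Periodic.nat_mul (f := v) hv q k
  let l := N / (m + 1)
  have : (0 : ℝ) < N := by exact_mod_cast hN
  have hL : (0 : ℝ) < N / (4 * (m + 1 : ℕ)) := by positivity
  have hper := concatPotential_add_period N l w
  refine ⟨_, hper, abs_concatPotential_sub_le hvN hclose l, ?_⟩
  refine (volume_bands_le hN hper hB.measurableSet hK hL fun E hE => ?_).trans_eq ?_
  · obtain ⟨i, him, r, hrR, htrace⟩ := hR E hE
    have hil : i * l + l ≤ N := by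
      calc i * l + l = (i + 1) * l := by ring
        _ ≤ (m + 1) * l := Nat.mul_le_mul_right _ (by omega)
        _ ≤ N := Nat.mul_div_le N (m + 1)
    have hrl : r ≤ l := by
      have : 0 < l - R := by exact_mod_cast hL.trans_le hlen
      omega
    refine ⟨i * l, r, l - r, hlen.trans (by exact_mod_cast Nat.sub_le_sub_left hrR l), by omega,
      fun k hk => ?_⟩
    rw [Finset.mem_Ico] at hk
    rw [transfer_concatPotential w E hk.1 (by omega) hil]
    exact htrace k
  · simp only [K]
    congr 1
    field_simp
    norm_num

end SmallSpectrum

section GreenFunction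

open Polynomial Filter Topology

lemma sq_add_sq_sub_eq_zero_of_tendsto {𝕜 : Type*} [NormedField 𝕜] {b : ℕ → 𝕜} {ζ : 𝕜}
    (hb : Tendsto b atTop (𝓝 0)) (hrec : ∀ k, b (k + 2) = ζ * b (k + 1) - b k) :
    b 1 ^ 2 + b 0 ^ 2 - ζ * b 0 * b 1 = 0 := by
  have hconst (k : ℕ) : b (k + 1) ^ 2 + b k ^ 2 - ζ * b k * b (k + 1) =
      b 1 ^ 2 + b 0 ^ 2 - ζ * b 0 * b 1 := by
    induction k with
    | zero => rfl
    | succ k ih =>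
      rw [← ih, hrec]
      ring
  have hb1 : Tendsto (fun k => b (k + 1)) atTop (𝓝 0) := (tendsto_add_atTop_iff_nat 1).2 hb
  have hlim : Tendsto (fun k => b (k + 1) ^ 2 + b k ^ 2 - ζ * b k * b (k + 1)) atTop
      (𝓝 (0 ^ 2 + 0 ^ 2 - ζ * 0 * 0)) :=
    ((hb1.pow 2).add (hb.pow 2)).sub ((hb.const_mul ζ).mul hb1)
  simp only [hconst] at hlim
  simpa using tendsto_nhds_unique tendsto_const_nhds hlim

lemma sq_mul_sq_sub_four_eq_of_source {𝕜 : Type*} [NormedField 𝕜] {a : ℤ → 𝕜} {ζ D : 𝕜}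
    (ha : Tendsto a cofinite (𝓝 0)) (h0 : ζ * a 0 - a 1 - a (-1) = D)
    (hk : ∀ k ≠ 0, ζ * a k - a (k + 1) - a (k - 1) = 0) :
    a 0 ^ 2 * (ζ ^ 2 - 4) = D ^ 2 := by
  have hpos : Tendsto (fun k : ℕ => a k) atTop (𝓝 0) :=
    (ha.comp Nat.cast_injective.tendsto_cofinite).mono_left Nat.cofinite_eq_atTop.ge
  have hneg : Tendsto (fun k : ℕ => a (-k)) atTop (𝓝 0) :=
    (ha.comp (neg_injective.comp Nat.cast_injective).tendsto_cofinite).mono_left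
      Nat.cofinite_eq_atTop.ge
  have hrecpos (k : ℕ) : a ((k + 2 : ℕ) : ℤ) = ζ * a ((k + 1 : ℕ) : ℤ) - a k := by
    have := hk (k + 1) (by omega)
    rw [add_sub_cancel_right, add_assoc, one_add_one_eq_two] at this
    push_cast
    linear_combination -this
  have hrecneg (k : ℕ) : a (-((k + 2 : ℕ) : ℤ)) = ζ * a (-((k + 1 : ℕ) : ℤ)) - a (-k) := by
    have := hk (-(k + 1)) (by omega)
    rw [show -((k : ℤ) + 1) + 1 = -k by ring, show -((k : ℤ) + 1) - 1 = -(k + 2) by ring] at this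
    push_cast
    linear_combination -this
  have hright := sq_add_sq_sub_eq_zero_of_tendsto hpos hrecpos
  have hdiff := sq_add_sq_sub_eq_zero_of_tendsto (b := fun k : ℕ => a k - a (-k)) (ζ := ζ)
    (by simpa using hpos.sub hneg) fun k => by
      simp only [hrecpos, hrecneg]
      ring
  simp only [Nat.cast_zero, Nat.cast_one, neg_zero, sub_self, mul_zero, zero_mul, sub_zero]
    at hright hdiff
  have hsymm : a 1 = a (-1) := by
    have : (a 1 - a (-1)) ^ 2 = 0 := by linear_combination hdiff
    exact sub_eq_zero.1 (pow_eq_zero_iff two_ne_zero |>.1 this)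
  rw [← h0, ← hsymm]
  linear_combination (-4) * hright

/-- The unit vector at the origin of `ℓ²(ℤ)`. -/
noncomputable def siteVector : ℓ^2(ℤ, ℂ) := lp.single 2 (0 : ℤ) (1 : ℂ)

lemma siteVector_apply_ne {n : ℤ} (hn : n ≠ 0) : siteVector n = 0 := by
  rw [siteVector, lp.single_apply_ne _ _ _ hn]

lemma inner_siteVector (u : ℓ^2(ℤ, ℂ)) : ⟪siteVector, u⟫_ℂ = u 0 := by
  rw [siteVector, lp.inner_single_left]
  simp

lemma schrodinger_pow_apply_eq_zero (V : ℓ^∞(ℤ, ℝ)) (j : ℕ) {n : ℤ} (hn : j < n.natAbs) :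
    ((schrodinger V ^ j) siteVector) n = 0 := by
  induction j generalizing n with
  | zero => exact siteVector_apply_ne (by omega)
  | succ j ih =>
    rw [pow_succ', mul_apply_eq_comp, schrodinger_apply, ih (by omega), ih (by omega),
      ih (by omega)]
    simp

section DividedDifference

variable {S K R : Type*} [CommRing S] [CommRing K] [Algebra S K] [Ring R] [Algebra S R]
  [Algebra K R]

/-- The divided difference `(P(z) - P(a)) / (z - a)` of a polynomial at a scalar `z` and an
element `a` of an algebra, as a polynomial expression, so that no invertibility is needed. -/
def dividedDifference (P : S[X]) (z : K) (a : R) : R :=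
  ∑ k ∈ Finset.range (P.natDegree + 1), P.coeff k • ∑ i ∈ Finset.range k, z ^ i • a ^ (k - 1 - i)

lemma dividedDifference_mul_sub [IsScalarTower S K R] (P : S[X]) (z : K) (a : R) :
    dividedDifference P z a * (z • 1 - a) = aeval z P • 1 - aeval a P := by
  have hcomm : Commute (z • (1 : R)) a := (Commute.one_left a).smul_left z
  rw [dividedDifference, aeval_eq_sum_range, aeval_eq_sum_range, Finset.sum_smul, Finset.sum_mul,
    ← Finset.sum_sub_distrib]
  refine Finset.sum_congr rfl fun k _ => ?_
  have hgeom := hcomm.geom_sum₂_mul k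
  simp only [_root_.smul_pow, one_pow, smul_mul_assoc, one_mul] at hgeom
  rw [smul_mul_assoc, hgeom, smul_sub, smul_assoc]

end DividedDifference

lemma dividedDifference_schrodinger_apply_eq_zero (V : ℓ^∞(ℤ, ℝ)) {P : ℝ[X]} {n : ℤ}
    (hn : P.natDegree ≤ n.natAbs) (z : ℂ) :
    dividedDifference P z (schrodinger V) siteVector n = 0 := by
  simp only [dividedDifference, _root_.sum_apply, lp.coeFn_sum, Finset.sum_apply,
    _root_.smul_apply, lp.coeFn_smul, Pi.smul_apply]
  refine Finset.sum_eq_zero fun k hk => ?_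
  rw [Finset.sum_eq_zero fun i hi => ?_, smul_zero]
  rw [Finset.mem_range] at hi hk
  rw [schrodinger_pow_apply_eq_zero _ _ (by omega), smul_zero]

/-- The numerator of the diagonal Green function at the origin of an `N`-periodic Schrödinger
operator `H`: the diagonal entry of `(Δ(z) - Δ(H)) / (z - H)`, with `Δ` the discriminant. -/
noncomputable def greenNumerator (V : ℓ^∞(ℤ, ℝ)) (N : ℕ) (z : ℂ) : ℂ :=
  dividedDifference (discriminant V N) z (schrodinger V) siteVector 0

/- By periodicity `Δ(H)` is the sum of the shifts by `±N`, so along `Nℤ` the equation becomes that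
of the free Laplacian at energy `Δ(z)` with a source at the origin. -/
lemma sq_green_mul {V : ℓ^∞(ℤ, ℝ)} {N : ℕ} (hN : 0 < N) (hV : ∀ k, V (k + N) = V k) {z : ℂ}
    {u : ℓ^2(ℤ, ℂ)} (hu : z • u - schrodinger V u = siteVector) :
    u 0 ^ 2 * (aeval z (discriminant V N) ^ 2 - 4) = greenNumerator V N z ^ 2 := by
  let W : ℓ^2(ℤ, ℂ) →L[ℂ] ℓ^2(ℤ, ℂ) := dividedDifference (discriminant V N) z (schrodinger V)
  have hWu : aeval z (discriminant V N) • u - (lpShift N u + lpShift (-N) u) = W siteVector := by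
    have hfac := dividedDifference_mul_sub (discriminant V N) z (schrodinger V)
    rw [aeval_discriminant V hV] at hfac
    rw [← hu]
    exact (congrArg (fun B : ℓ^2(ℤ, ℂ) →L[ℂ] ℓ^2(ℤ, ℂ) => B u) hfac).symm
  have hsource (k : ℤ) : aeval z (discriminant V N) * u (k * N) - u ((k + 1) * N) -
      u ((k - 1) * N) = W siteVector (k * N) := by
    rw [← hWu, add_mul, sub_mul, one_mul]
    change _ = aeval z (discriminant V N) * u (k * N) - (u (k * N + N) + u (k * N + -N))
    rw [← sub_eq_add_neg, sub_sub]
  have hdeg := natDegree_discriminant V hN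
  have hNz : (N : ℤ) ≠ 0 := by exact_mod_cast hN.ne'
  have hdecay : Tendsto (fun k : ℤ => u (k * N)) cofinite (𝓝 0) :=
    (tendsto_zero_iff_norm_tendsto_zero.2 (tendsto_lp_cofinite u)).comp
      (mul_left_injective₀ hNz).tendsto_cofinite
  have h := sq_mul_sq_sub_four_eq_of_source (a := fun k : ℤ => u (k * N))
    (ζ := aeval z (discriminant V N)) (D := W siteVector 0) hdecay
    (by simpa using hsource 0) fun k hk => by
    rw [hsource, dividedDifference_schrodinger_apply_eq_zero V _ z]
    rw [hdeg, Int.natAbs_mul, Int.natAbs_natCast]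
    exact Nat.le_mul_of_pos_left N (by omega)
  simpa [W, greenNumerator] using h

section Resolvent

variable {H : Type*} [NormedAddCommGroup H] [InnerProductSpace ℂ H] [CompleteSpace H]
  {A : H →L[ℂ] H}

lemma im_inner_apply_self_eq_zero (hA : IsSelfAdjoint A) (ψ : H) : (⟪ψ, A ψ⟫_ℂ).im = 0 := by
  rw [ContinuousLinearMap.isSelfAdjoint_iff_isSymmetric] at hA
  exact Complex.conj_eq_iff_im.1 ((inner_conj_symm (A ψ) ψ).trans (hA ψ ψ))

lemma cfc_const_sub (hA : IsSelfAdjoint A) (E : ℝ) :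
    cfc (fun x : ℝ => E - x) A = (E : ℂ) • 1 - A := by
  rw [cfc_sub (fun _ => E) (fun x : ℝ => x) A, cfc_id' ℝ A, cfc_const E A]
  rfl

lemma sub_mul_sub_mul_cfc_inv (hA : IsSelfAdjoint A) (E : ℝ) {ε : ℝ} (hε : ε ≠ 0) :
    ((E + ε * Complex.I : ℂ) • 1 - A) * (((E - ε * Complex.I : ℂ) • 1 - A) *
      cfc (fun x : ℝ => ((x - E) ^ 2 + ε ^ 2)⁻¹) A) = 1 := by
  have hpos (x : ℝ) : (x - E) ^ 2 + ε ^ 2 ≠ 0 := by positivity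
  have hg : Continuous fun x : ℝ => ((x - E) ^ 2 + ε ^ 2)⁻¹ := Continuous.inv₀ (by fun_prop) hpos
  have hprod : ((E + ε * Complex.I : ℂ) • 1 - A) * ((E - ε * Complex.I : ℂ) • 1 - A) =
      cfc (fun x : ℝ => (x - E) ^ 2 + ε ^ 2) A := by
    have hsq : ((ε : ℂ) * Complex.I) * (ε * Complex.I) = -(ε ^ 2 : ℝ) := by
      rw [mul_mul_mul_comm, Complex.I_mul_I]
      push_cast
      ring
    have hconst : cfc (fun _ : ℝ => ε ^ 2) A = ((ε ^ 2 : ℝ) : ℂ) • (1 : H →L[ℂ] H) := by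
      rw [cfc_const (ε ^ 2) A]
      rfl
    calc ((E + ε * Complex.I : ℂ) • 1 - A) * ((E - ε * Complex.I : ℂ) • 1 - A)
        = ((E : ℂ) • 1 - A) * ((E : ℂ) • 1 - A) -
            (((ε : ℂ) * Complex.I) * (ε * Complex.I)) • (1 : H →L[ℂ] H) := by
          simp only [add_smul, sub_smul, mul_sub, sub_mul, add_mul, smul_mul_assoc,
            mul_smul_comm, one_mul, mul_one]
          module
      _ = cfc (fun x : ℝ => (E - x) * (E - x)) A + cfc (fun _ : ℝ => ε ^ 2) A := by
          rw [cfc_mul (fun x : ℝ => E - x) (fun x : ℝ => E - x) A, cfc_const_sub hA, hconst, hsq,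
            neg_smul, sub_neg_eq_add]
      _ = cfc (fun x : ℝ => (x - E) ^ 2 + ε ^ 2) A := by
          rw [← cfc_add (a := A) (fun x : ℝ => (E - x) * (E - x)) (fun _ => ε ^ 2)]
          exact cfc_congr fun x _ => by ring
  rw [← mul_assoc, hprod, ← cfc_mul _ _ A (by fun_prop) hg.continuousOn, ← cfc_const_one ℝ A]
  exact cfc_congr fun x _ => mul_inv_cancel₀ (hpos x)

lemma exists_green_vector (hA : IsSelfAdjoint A) (ψ : H) (E : ℝ) {ε : ℝ} (hε : ε ≠ 0) :
    ∃ u : H, ((E : ℂ) + ε * Complex.I) • u - A u = ψ ∧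
      (⟪ψ, u⟫_ℂ).im = -∫ x, ε / ((x - E) ^ 2 + ε ^ 2) ∂(spectralMeasure A hA ψ) := by
  let g : ℝ → ℝ := fun x => ((x - E) ^ 2 + ε ^ 2)⁻¹
  have hg : Continuous g := Continuous.inv₀ (by fun_prop) fun x => by positivity
  let G := cfc g A
  refine ⟨(((E - ε * Complex.I : ℂ) • 1 - A) * G) ψ,
    congrArg (fun C : H →L[ℂ] H => C ψ) (sub_mul_sub_mul_cfc_inv hA E hε), ?_⟩
  have hsplit : ((E - ε * Complex.I : ℂ) • 1 - A) * G =
      cfc (fun x => (E - x) * g x) A - (ε * Complex.I : ℂ) • G := by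
    rw [cfc_mul (fun x : ℝ => E - x) g A (by fun_prop) hg.continuousOn, cfc_const_sub hA,
      sub_smul, sub_right_comm, sub_mul _ _ G, smul_mul_assoc, one_mul]
  have him : (⟪ψ, cfc (fun x => (E - x) * g x) A ψ⟫_ℂ).im = 0 :=
    im_inner_apply_self_eq_zero (cfc_predicate _ A) ψ
  have hGim : (⟪ψ, G ψ⟫_ℂ).im = 0 := im_inner_apply_self_eq_zero (cfc_predicate g A) ψ
  have hint : ∫ x, ε / ((x - E) ^ 2 + ε ^ 2) ∂(spectralMeasure A hA ψ) = ε * (⟪ψ, G ψ⟫_ℂ).re := by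
    simp only [div_eq_mul_inv, integral_const_mul]
    rw [integral_spectralMeasure_of_continuous A hA ψ hg]
  rw [hint, hsplit, _root_.sub_apply, _root_.smul_apply, inner_sub_right, inner_smul_right,
    Complex.sub_im, him, Complex.mul_im, hGim]
  simp

end Resolvent

end GreenFunction

section PoissonKernel

open Filter Topology

lemma integral_mul_poisson (g : ℝ → ℝ) (x : ℝ) {ε : ℝ} (hε : 0 < ε) :
    ∫ E, g E * (ε / ((x - E) ^ 2 + ε ^ 2)) = ∫ t, g (x + ε * t) * (1 + t ^ 2)⁻¹ := by
  have hscale := Measure.integral_comp_mul_left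
    (fun y => g (x + y) * (ε / ((x - (x + y)) ^ 2 + ε ^ 2))) ε
  rw [abs_of_pos (inv_pos.2 hε), smul_eq_mul, eq_comm, inv_mul_eq_iff_eq_mul₀ hε.ne'] at hscale
  rw [← integral_add_left_eq_self (fun E => g E * (ε / ((x - E) ^ 2 + ε ^ 2))) x, hscale,
    ← integral_const_mul]
  refine integral_congr_ae (Eventually.of_forall fun t => ?_)
  have hden : (x - (x + ε * t)) ^ 2 + ε ^ 2 = ε ^ 2 * (1 + t ^ 2) := by ring
  have : (1 + t ^ 2) ≠ 0 := by positivity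
  simp only [hden]
  field_simp

lemma norm_mul_inv_one_add_sq_le {a c : ℝ} (ha : |a| ≤ c) (t : ℝ) :
    ‖a * (1 + t ^ 2)⁻¹‖ ≤ c * (1 + t ^ 2)⁻¹ := by
  have hpos : 0 ≤ (1 + t ^ 2)⁻¹ := by positivity
  rw [norm_mul, Real.norm_eq_abs, Real.norm_of_nonneg hpos]
  exact mul_le_mul_of_nonneg_right ha hpos

lemma tendsto_poisson_apply {g : ℝ → ℝ} (hg : Continuous g) {c : ℝ} (hc : ∀ y, |g y| ≤ c)
    (x : ℝ) :
    Tendsto (fun ε : ℝ => ∫ t, g (x + ε * t) * (1 + t ^ 2)⁻¹) (𝓝[>] 0) (𝓝 (g x * Real.pi)) := by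
  rw [← integral_univ_inv_one_add_sq, ← integral_const_mul]
  have hpos (t : ℝ) : 1 + t ^ 2 ≠ 0 := by positivity
  refine tendsto_integral_filter_of_dominated_convergence (fun t => c * (1 + t ^ 2)⁻¹)
    (Eventually.of_forall fun ε => ?_)
    (Eventually.of_forall fun ε => Eventually.of_forall fun t =>
      norm_mul_inv_one_add_sq_le (hc _) t)
    (integrable_inv_one_add_sq.const_mul c)
    (Eventually.of_forall fun t => Tendsto.mul_const _ ?_)
  · exact ((hg.comp (by fun_prop)).mul
      (Continuous.inv₀ (by fun_prop) hpos)).aestronglyMeasurable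
  · have hcont : Continuous fun ε : ℝ => g (x + ε * t) := hg.comp (by fun_prop)
    simpa using (hcont.tendsto 0).mono_left (nhdsWithin_le_nhds (s := Set.Ioi 0))

variable (μ : Measure ℝ) [IsFiniteMeasure μ]

lemma integral_mul_integral_poisson {g : ℝ → ℝ} (hg : Continuous g) (hgi : Integrable g) {ε : ℝ}
    (hε : 0 < ε) :
    ∫ E, g E * ∫ x, ε / ((x - E) ^ 2 + ε ^ 2) ∂μ =
      ∫ x, (∫ t, g (x + ε * t) * (1 + t ^ 2)⁻¹) ∂μ := by
  have hpos (q : ℝ × ℝ) : 0 < (q.2 - q.1) ^ 2 + ε ^ 2 := by positivity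
  have hcont : Continuous fun q : ℝ × ℝ => g q.1 * (ε / ((q.2 - q.1) ^ 2 + ε ^ 2)) :=
    (hg.comp continuous_fst).mul
      (Continuous.div (by fun_prop) (by fun_prop) fun q => (hpos q).ne')
  have hbound : Integrable (fun q : ℝ × ℝ => |g q.1| * ε⁻¹) (volume.prod μ) :=
    (hgi.abs.comp_fst μ).mul_const _
  have hint : Integrable (fun q : ℝ × ℝ => g q.1 * (ε / ((q.2 - q.1) ^ 2 + ε ^ 2)))
      (volume.prod μ) := by
    refine hbound.mono' hcont.aestronglyMeasurable (Eventually.of_forall fun q => ?_)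
    have hle : ε / ((q.2 - q.1) ^ 2 + ε ^ 2) ≤ ε⁻¹ := by
      rw [div_le_iff₀ (hpos q), inv_mul_eq_div, le_div_iff₀ hε]
      linarith [sq_nonneg (q.2 - q.1)]
    rw [norm_mul, Real.norm_eq_abs, Real.norm_of_nonneg (div_nonneg hε.le (hpos q).le)]
    exact mul_le_mul_of_nonneg_left hle (abs_nonneg _)
  simp only [← integral_const_mul]
  rw [integral_integral_swap hint]
  exact integral_congr_ae (Eventually.of_forall fun x => integral_mul_poisson g x hε)

lemma tendsto_integral_poisson (g : C_c(ℝ, ℝ)) :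
    Tendsto (fun ε : ℝ => ∫ E, g E * ∫ x, ε / ((x - E) ^ 2 + ε ^ 2) ∂μ) (𝓝[>] 0)
      (𝓝 (Real.pi * ∫ x, g x ∂μ)) := by
  obtain ⟨c, hc⟩ := g.hasCompactSupport.exists_bound_of_continuous g.continuous
  have hlim : Tendsto (fun ε : ℝ => ∫ x, (∫ t, g (x + ε * t) * (1 + t ^ 2)⁻¹) ∂μ) (𝓝[>] 0)
      (𝓝 (∫ x, g x * Real.pi ∂μ)) := by
    refine tendsto_integral_filter_of_dominated_convergence (fun _ => c * Real.pi)
      (Eventually.of_forall fun ε => ?_)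
      (Eventually.of_forall fun ε => Eventually.of_forall fun x => ?_)
      (integrable_const _)
      (Eventually.of_forall fun x => tendsto_poisson_apply g.continuous hc x)
    · have hcont : Continuous (Function.uncurry fun x t : ℝ => g (x + ε * t) * (1 + t ^ 2)⁻¹) :=
        (g.continuous.comp (by fun_prop)).mul
          (Continuous.inv₀ (by fun_prop) fun q => by positivity)
      exact hcont.stronglyMeasurable.integral_prod_right.aestronglyMeasurable
    · rw [← integral_univ_inv_one_add_sq, ← integral_const_mul]
      exact norm_integral_le_of_norm_le (integrable_inv_one_add_sq.const_mul c)
        (Eventually.of_forall fun t => norm_mul_inv_one_add_sq_le (hc _) t)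
  rw [integral_mul_const, mul_comm] at hlim
  refine hlim.congr' ?_
  filter_upwards [self_mem_nhdsWithin] with ε hε
  exact (integral_mul_integral_poisson μ g.continuous
    (g.continuous.integrable_of_hasCompactSupport g.hasCompactSupport) hε).symm

end PoissonKernel

section DensityOfStates

open Polynomial Filter Topology

section BoundaryValues

lemma exists_forall_add_mul_I_mem {K : Set ℝ} (hK : IsCompact K) {U : Set ℂ} (hU : IsOpen U)
    (hKU : K ⊆ Complex.ofReal ⁻¹' U) :
    ∃ r > 0, ∀ E ∈ K, ∀ ε : ℝ, |ε| ≤ r → (E + ε * Complex.I : ℂ) ∈ U := by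
  obtain ⟨r, hr, hrU⟩ := (hK.image Complex.continuous_ofReal).exists_cthickening_subset_open hU
    (Set.image_subset_iff.2 hKU)
  refine ⟨r, hr, fun E hE ε hε => hrU (Metric.mem_cthickening_of_dist_le _ (E : ℂ) _ _
    (Set.mem_image_of_mem _ hE) ?_)⟩
  simpa [dist_eq_norm] using hε

lemma tendsto_integral_mul_add_mul_I {F : ℂ → ℝ} (hF : Measurable F) {U : Set ℂ} (hU : IsOpen U)
    (hFU : ContinuousOn F U) (g : C_c(ℝ, ℝ)) (hg : tsupport g ⊆ Complex.ofReal ⁻¹' U) :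
    Tendsto (fun ε : ℝ => ∫ E : ℝ, g E * F (E + ε * Complex.I)) (𝓝[>] 0)
      (𝓝 (∫ E : ℝ, g E * F E)) := by
  obtain ⟨r, hr, hrU⟩ := exists_forall_add_mul_I_mem g.hasCompactSupport hU hg
  have hcont : ContinuousOn (fun q : ℝ × ℝ => F (q.1 + q.2 * Complex.I))
      (tsupport g ×ˢ Set.Icc (-r) r) :=
    hFU.comp (by fun_prop) fun q hq => hrU q.1 hq.1 q.2 (abs_le.2 hq.2)
  obtain ⟨C, hC⟩ := (g.hasCompactSupport.prod isCompact_Icc).exists_bound_of_continuousOn hcont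
  refine tendsto_integral_filter_of_dominated_convergence (fun E => |g E| * C)
    (Eventually.of_forall fun ε => ?_) ?_
    ((g.continuous.integrable_of_hasCompactSupport g.hasCompactSupport).abs.mul_const C)
    (Eventually.of_forall fun E => ?_)
  · exact (g.continuous.measurable.mul (hF.comp (by fun_prop))).aestronglyMeasurable
  · filter_upwards [Ioc_mem_nhdsGT hr] with ε hε
    refine Eventually.of_forall fun E => ?_
    by_cases hE : E ∈ tsupport g
    · rw [norm_mul, Real.norm_eq_abs]
      exact mul_le_mul_of_nonneg_left (hC (E, ε) ⟨hE, by linarith [hε.1], hε.2⟩) (abs_nonneg _)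
    · simp [image_eq_zero_of_notMem_tsupport hE]
  · by_cases hE : E ∈ tsupport g
    · have hline : Tendsto (fun ε : ℝ => (E + ε * Complex.I : ℂ)) (𝓝[>] 0) (𝓝 E) := by
        have : Continuous fun ε : ℝ => (E + ε * Complex.I : ℂ) := by fun_prop
        simpa using (this.tendsto 0).mono_left nhdsWithin_le_nhds
      exact ((hFU.continuousAt (hU.mem_nhds (hg hE))).tendsto.comp hline).const_mul _
    · simp [image_eq_zero_of_notMem_tsupport hE]

end BoundaryValues

/-- The square of the diagonal Green function at the origin of an `N`-periodic Schrödinger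
operator; unlike the Green function itself it is rational in the energy. -/
noncomputable def greenSq (V : ℓ^∞(ℤ, ℝ)) (N : ℕ) (z : ℂ) : ℂ :=
  greenNumerator V N z ^ 2 / (aeval z (discriminant V N) ^ 2 - 4)

/-- The absolute value of the imaginary part of the diagonal Green function at the origin,
expressed through its square: `|Im w|² = (|w²| - Re w²) / 2`. -/
noncomputable def absImGreen (V : ℓ^∞(ℤ, ℝ)) (N : ℕ) (z : ℂ) : ℝ :=
  √((‖greenSq V N z‖ - (greenSq V N z).re) / 2)

/-- The complex energies at which the discriminant differs from `±2`. -/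
def regularPoints (V : ℤ → ℝ) (N : ℕ) : Set ℂ := {z | aeval z (discriminant V N) ^ 2 - 4 ≠ 0}

/-- The real energies at which the discriminant differs from `±2`. -/
def regularEnergies (V : ℤ → ℝ) (N : ℕ) : Set ℝ := Complex.ofReal ⁻¹' regularPoints V N

/-- The spectral measure of a Schrödinger operator at the unit vector of the origin. -/
noncomputable abbrev siteMeasure (V : ℓ^∞(ℤ, ℝ)) : Measure ℝ :=
  spectralMeasure (schrodinger V) (isSelfAdjoint_schrodinger V) siteVector

/-- The density of the spectral measure at the origin of an `N`-periodic Schrödinger operator. -/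
noncomputable def siteDensity (V : ℓ^∞(ℤ, ℝ)) (N : ℕ) (E : ℝ) : ℝ := absImGreen V N E / Real.pi

lemma sqrt_norm_sq_sub_re_sq (w : ℂ) : √((‖w ^ 2‖ - (w ^ 2).re) / 2) = |w.im| := by
  rw [norm_pow, ← Complex.normSq_eq_norm_sq, Complex.normSq_apply, sq, Complex.mul_re,
    ← Real.sqrt_sq_eq_abs]
  congr 1
  ring

lemma isOpen_regularPoints (V : ℤ → ℝ) (N : ℕ) : IsOpen (regularPoints V N) :=
  isOpen_ne_fun (((discriminant V N).continuous_aeval.pow 2).sub continuous_const)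
    continuous_const

lemma isOpen_regularEnergies (V : ℤ → ℝ) (N : ℕ) : IsOpen (regularEnergies V N) :=
  (isOpen_regularPoints V N).preimage Complex.continuous_ofReal

lemma finite_compl_regularEnergies (V : ℤ → ℝ) {N : ℕ} (hN : 0 < N) :
    (regularEnergies V N)ᶜ.Finite := by
  have hdeg : 0 < (discriminant V N).natDegree := (natDegree_discriminant V hN).symm ▸ hN
  refine (finite_setOf_abs_eval_eq hdeg 2).subset fun E hE => ?_
  have hsq : ((((discriminant V N).eval E) ^ 2 - 4 : ℝ) : ℂ) = 0 := by
    have hE' : aeval (E : ℂ) (discriminant V N) ^ 2 - 4 = 0 := not_not.1 hE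
    rw [← Complex.coe_algebraMap, aeval_algebraMap_apply, Complex.coe_algebraMap] at hE'
    exact_mod_cast hE'
  have habs : |(discriminant V N).eval E| = |2| :=
    (sq_eq_sq_iff_abs_eq_abs _ _).1 (by linarith [Complex.ofReal_eq_zero.1 hsq])
  rwa [abs_two] at habs

variable (V : ℓ^∞(ℤ, ℝ)) (N : ℕ)

lemma continuous_greenNumerator : Continuous (greenNumerator V N) := by
  have hop : Continuous fun z : ℂ => dividedDifference (discriminant V N) z (schrodinger V) := by
    unfold dividedDifference
    fun_prop
  exact (continuous_const.inner (hop.clm_apply continuous_const)).congr fun _ =>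
    inner_siteVector _

lemma measurable_absImGreen : Measurable (absImGreen V N) := by
  have hsq : Measurable (greenSq V N) :=
    ((continuous_greenNumerator V N).measurable.pow_const 2).div
      (((discriminant V N).continuous_aeval.measurable.pow_const 2).sub_const 4)
  exact ((hsq.norm.sub (Complex.measurable_re.comp hsq)).div_const 2).sqrt

lemma continuousOn_absImGreen : ContinuousOn (absImGreen V N) (regularPoints V N) := by
  have hsq : ContinuousOn (greenSq V N) (regularPoints V N) :=
    ((continuous_greenNumerator V N).pow 2).continuousOn.div
      (((discriminant V N).continuous_aeval.pow 2).sub continuous_const).continuousOn fun _ h => h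
  exact ((hsq.norm.sub (Complex.continuous_re.comp_continuousOn hsq)).div_const 2).sqrt

lemma siteDensity_nonneg (E : ℝ) : 0 ≤ siteDensity V N E :=
  div_nonneg (Real.sqrt_nonneg _) Real.pi_pos.le

lemma measurable_siteDensity : Measurable (siteDensity V N) :=
  ((measurable_absImGreen V N).comp Complex.measurable_ofReal).div_const _

lemma continuousOn_siteDensity : ContinuousOn (siteDensity V N) (regularEnergies V N) :=
  ((continuousOn_absImGreen V N).comp Complex.continuous_ofReal.continuousOn
    fun _ h => h).div_const _

variable {V N}

lemma integral_poisson_siteMeasure (hN : 0 < N) (hV : ∀ k, V (k + N) = V k) (E : ℝ) {ε : ℝ}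
    (hε : 0 < ε) (hreg : (E + ε * Complex.I : ℂ) ∈ regularPoints V N) :
    ∫ x, ε / ((x - E) ^ 2 + ε ^ 2) ∂(siteMeasure V) = absImGreen V N (E + ε * Complex.I) := by
  obtain ⟨u, hu, him⟩ :=
    exists_green_vector (isSelfAdjoint_schrodinger V) siteVector E hε.ne'
  have hsq : greenSq V N (E + ε * Complex.I) = u 0 ^ 2 :=
    (eq_div_of_mul_eq hreg (sq_green_mul hN hV hu)).symm
  rw [inner_siteVector] at him
  rw [absImGreen, hsq, sqrt_norm_sq_sub_re_sq, him, abs_neg, abs_of_nonneg]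
  exact integral_nonneg fun x => by positivity

lemma integral_siteMeasure (hN : 0 < N) (hV : ∀ k, V (k + N) = V k) (g : C_c(ℝ, ℝ))
    (hg : tsupport g ⊆ regularEnergies V N) :
    ∫ E, g E ∂(siteMeasure V) = ∫ E, g E * siteDensity V N E := by
  suffices h : Real.pi * ∫ E, g E ∂(siteMeasure V) = ∫ E : ℝ, g E * absImGreen V N E by
    simp only [siteDensity, mul_div_assoc', integral_div]
    rw [← h, mul_div_cancel_left₀ _ Real.pi_ne_zero]
  have hopen := isOpen_regularPoints V N
  obtain ⟨r, hr, hreg⟩ := exists_forall_add_mul_I_mem g.hasCompactSupport hopen hg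
  refine tendsto_nhds_unique (tendsto_integral_poisson (siteMeasure V) g)
    ((tendsto_integral_mul_add_mul_I (measurable_absImGreen V N) hopen
      (continuousOn_absImGreen V N) g hg).congr' ?_)
  filter_upwards [Ioc_mem_nhdsGT hr] with ε hε
  refine integral_congr_ae (Eventually.of_forall fun E => ?_)
  by_cases hE : E ∈ tsupport g
  · simp only
    rw [integral_poisson_siteMeasure hN hV E hε.1
      (hreg E hE ε ((abs_of_pos hε.1).trans_le hε.2))]
  · simp [image_eq_zero_of_notMem_tsupport hE]

lemma lintegral_siteMeasure (hN : 0 < N) (hV : ∀ k, V (k + N) = V k) {g : C_c(ℝ, ℝ)}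
    (hg0 : ∀ x, 0 ≤ g x) (hg : tsupport g ⊆ regularEnergies V N) :
    ∫⁻ E, ENNReal.ofReal (g E) ∂(siteMeasure V) = ∫⁻ E, ENNReal.ofReal (g E)
      ∂(volume.withDensity fun E => ENNReal.ofReal (siteDensity V N E)) := by
  have hint : Integrable fun E => g E * siteDensity V N E := by
    have hc : ContinuousOn (fun E => g E * siteDensity V N E) (tsupport g) :=
      g.continuous.continuousOn.mul ((continuousOn_siteDensity V N).mono hg)
    refine (hc.integrableOn_compact g.hasCompactSupport).integrable_of_forall_notMem_eq_zero
      fun E hE => ?_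
    rw [image_eq_zero_of_notMem_tsupport hE, zero_mul]
  have hm := (measurable_siteDensity V N).ennreal_ofReal
  rw [lintegral_ofReal_compactlySupported _ hg0, integral_siteMeasure hN hV g hg,
    ofReal_integral_eq_lintegral_ofReal hint
      (Eventually.of_forall fun E => mul_nonneg (hg0 E) (siteDensity_nonneg V N E)),
    lintegral_withDensity_eq_lintegral_mul _ hm (g := fun E => ENNReal.ofReal (g E))
      g.continuous.measurable.ennreal_ofReal]
  refine lintegral_congr fun E => ?_
  rw [Pi.mul_apply, mul_comm, ENNReal.ofReal_mul (siteDensity_nonneg V N E)]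

lemma siteMeasure_eq_withDensity (hN : 0 < N) (hV : ∀ k, V (k + N) = V k) :
    siteMeasure V = volume.withDensity fun E => ENNReal.ofReal (siteDensity V N E) := by
  let R := regularEnergies V N
  let m := volume.withDensity fun E => ENNReal.ofReal (siteDensity V N E)
  have hfin : Rᶜ.Finite := finite_compl_regularEnergies V hN
  have hsite : siteMeasure V Rᶜ = 0 := by
    rw [← Set.biUnion_of_singleton Rᶜ]
    exact (measure_biUnion_null_iff hfin.countable).2 fun E _ =>
      (IsGordon.of_periodic hN hV).spectralMeasure_singleton _ E
  have hm : m Rᶜ = 0 := withDensity_absolutelyContinuous _ _ (hfin.measure_zero _)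
  have hopen (O : Set ℝ) (hO : IsOpen O) : siteMeasure V O = m O := by
    have hdiff (ν : Measure ℝ) (hν : ν Rᶜ = 0) : ν O = ν (O ∩ R) := by
      rw [← Set.sdiff_compl, measure_sdiff_null hν]
    have hOR := hO.inter (isOpen_regularEnergies V N)
    rw [hdiff _ hsite, hdiff _ hm]
    refine le_antisymm (measure_le_of_forall_lintegral_ofReal_le _ hOR fun g h0 h1 hs => ?_)
      (measure_le_of_forall_lintegral_ofReal_le _ hOR fun g h0 h1 hs => ?_)
    · rw [lintegral_siteMeasure hN hV h0 (hs.trans Set.inter_subset_right)]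
      exact lintegral_ofReal_le_measure_of_tsupport_subset m hOR h1 hs
    · rw [← lintegral_siteMeasure hN hV h0 (hs.trans Set.inter_subset_right)]
      exact lintegral_ofReal_le_measure_of_tsupport_subset _ hOR h1 hs
  exact ext_of_generate_finite _ BorelSpace.measurable_eq isPiSystem_isOpen hopen
    (hopen _ isOpen_univ)

lemma siteMeasure_absolutelyContinuous (hN : 0 < N) (hV : ∀ k, V (k + N) = V k) :
    siteMeasure V ≪ volume := by
  rw [siteMeasure_eq_withDensity hN hV]
  exact withDensity_absolutelyContinuous _ _

end DensityOfStates

section TotalVariation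

open Polynomial Filter Topology

lemma continuous_eval_lp (k : ℤ) : Continuous fun V : ℓ^∞(ℤ, ℝ) => V k :=
  (continuous_apply k).comp lp.uniformContinuous_coe.continuous

lemma continuous_coeff_transfer (m : ℤ) (n : ℕ) (i j : Fin 2) (k : ℕ) :
    Continuous fun V : ℓ^∞(ℤ, ℝ) =>
      (transfer (fun l => (X : ℝ[X]) - C (V l)) m n i j).coeff k := by
  induction n generalizing i j k with
  | zero => exact continuous_const
  | succ n ih =>
    have hX : Continuous fun V : ℓ^∞(ℤ, ℝ) =>
        (X * transfer (fun l => (X : ℝ[X]) - C (V l)) m n 0 j).coeff k := by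
      cases k with
      | zero => simp only [coeff_X_mul_zero, continuous_const]
      | succ k => simpa only [coeff_X_mul] using ih 0 j k
    simp only [transfer_succ, stepMatrix, Matrix.mul_apply, Fin.sum_univ_two]
    fin_cases i
    · simp only [Fin.zero_eta, Matrix.of_apply, Matrix.cons_val', Matrix.cons_val_zero,
        Matrix.cons_val_one, sub_mul, neg_mul, one_mul, coeff_add, coeff_sub, coeff_neg,
        coeff_C_mul]
      exact (hX.sub ((continuous_eval_lp (m + n)).mul (ih 0 j k))).add (ih 1 j k).neg
    · simpa using ih 0 j k

lemma continuous_coeff_discriminant (N k : ℕ) :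
    Continuous fun V : ℓ^∞(ℤ, ℝ) => (discriminant V N).coeff k := by
  simp only [discriminant, Matrix.trace_fin_two, coeff_add]
  exact (continuous_coeff_transfer 0 N 0 0 k).add (continuous_coeff_transfer 0 N 1 1 k)

lemma continuous_aeval_discriminant {N : ℕ} (hN : 0 < N) (z : ℂ) :
    Continuous fun V : ℓ^∞(ℤ, ℝ) => aeval z (discriminant V N) := by
  simp only [aeval_eq_sum_range, natDegree_discriminant _ hN]
  exact continuous_finsetSum _ fun k _ => (continuous_coeff_discriminant N k).smul continuous_const

lemma norm_schrodinger_sub_le (V W : ℓ^∞(ℤ, ℝ)) : ‖schrodinger V - schrodinger W‖ ≤ ‖V - W‖ := by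
  have hdiff : schrodinger V - schrodinger W = lpMultiplication (V - W) := by
    ext ψ n
    change (ψ (n + 1) + ψ (n - 1) + (V n : ℂ) * ψ n) - (ψ (n + 1) + ψ (n - 1) + (W n : ℂ) * ψ n) =
      ((V n - W n : ℝ) : ℂ) * ψ n
    push_cast
    ring
  rw [hdiff]
  exact LinearMap.mkContinuous_norm_le _ (norm_nonneg _) _

lemma continuous_schrodinger : Continuous schrodinger :=
  (LipschitzWith.of_dist_le_mul (K := 1) fun V W => by
    simpa [dist_eq_norm] using norm_schrodinger_sub_le V W).continuous

lemma continuous_greenNumerator_potential {N : ℕ} (hN : 0 < N) (z : ℂ) :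
    Continuous fun V : ℓ^∞(ℤ, ℝ) => greenNumerator V N z := by
  have hop : Continuous fun V : ℓ^∞(ℤ, ℝ) =>
      dividedDifference (discriminant V N) z (schrodinger V) := by
    have hpow (n : ℕ) : Continuous fun V : ℓ^∞(ℤ, ℝ) => schrodinger V ^ n :=
      continuous_schrodinger.pow n
    simp only [dividedDifference, natDegree_discriminant _ hN]
    exact continuous_finsetSum _ fun k _ => (continuous_coeff_discriminant N k).smul
      (continuous_finsetSum _ fun i _ => (hpow (k - 1 - i)).const_smul (z ^ i))
  exact (continuous_const.inner (hop.clm_apply continuous_const)).congr fun _ =>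
    inner_siteVector _

variable {V : ℓ^∞(ℤ, ℝ)} {N : ℕ}

lemma continuousAt_siteDensity (hN : 0 < N) {E : ℝ} (hE : E ∈ regularEnergies V N) :
    ContinuousAt (fun W : ℓ^∞(ℤ, ℝ) => siteDensity W N E) V := by
  have hsq : ContinuousAt (fun W : ℓ^∞(ℤ, ℝ) => greenSq W N E) V :=
    ((continuous_greenNumerator_potential hN E).pow 2).continuousAt.div
      (((continuous_aeval_discriminant hN E).pow 2).sub continuous_const).continuousAt hE
  exact ((hsq.norm.sub (Complex.continuous_re.continuousAt.comp hsq)).div_const 2).sqrt.div_const _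

lemma norm_siteVector : ‖siteVector‖ = 1 := by
  rw [siteVector, lp.norm_single (by norm_num), norm_one]

lemma siteMeasure_univ (V : ℓ^∞(ℤ, ℝ)) : siteMeasure V Set.univ = 1 := by
  rw [← ofReal_measureReal (measure_ne_top _ _), spectralMeasure_real_univ, norm_siteVector,
    one_pow, ENNReal.ofReal_one]

lemma lintegral_siteDensity (hN : 0 < N) (hV : ∀ k, V (k + N) = V k) :
    ∫⁻ E, ENNReal.ofReal (siteDensity V N E) = 1 := by
  rw [← siteMeasure_univ V, siteMeasure_eq_withDensity hN hV,
    withDensity_apply _ MeasurableSet.univ, Measure.restrict_univ]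

/- Scheffé's argument: the densities converge almost everywhere, and the positive part of
`siteDensity V - siteDensity W` is dominated by `siteDensity V`. -/
lemma tendsto_lintegral_siteDensity_sub (hN : 0 < N) (hV : ∀ k, V (k + N) = V k) :
    Tendsto (fun W : ℓ^∞(ℤ, ℝ) => ∫⁻ E, ENNReal.ofReal (siteDensity V N E - siteDensity W N E))
      (𝓝 V) (𝓝 0) := by
  have hreg : ∀ᵐ E : ℝ, E ∈ regularEnergies V N :=
    mem_ae_iff.2 ((finite_compl_regularEnergies V hN).measure_zero _)
  rw [← lintegral_zero (μ := (volume : Measure ℝ))]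
  refine tendsto_lintegral_filter_of_dominated_convergence
    (fun E => ENNReal.ofReal (siteDensity V N E))
    (Eventually.of_forall fun W =>
      ((measurable_siteDensity V N).sub (measurable_siteDensity W N)).ennreal_ofReal)
    (Eventually.of_forall fun W => Eventually.of_forall fun E =>
      ENNReal.ofReal_le_ofReal (sub_le_self _ (siteDensity_nonneg W N E)))
    ((lintegral_siteDensity hN hV).trans_ne ENNReal.one_ne_top) ?_
  filter_upwards [hreg] with E hE
  have hcont : ContinuousAt (fun W : ℓ^∞(ℤ, ℝ) =>
      ENNReal.ofReal (siteDensity V N E - siteDensity W N E)) V :=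
    ENNReal.continuous_ofReal.continuousAt.comp
      (continuousAt_const.sub (continuousAt_siteDensity hN hE))
  simpa using hcont.tendsto

lemma siteMeasure_le_add_lintegral_siteDensity_sub {W : ℓ^∞(ℤ, ℝ)} (hN : 0 < N)
    (hV : ∀ k, V (k + N) = V k) (hW : ∀ k, W (k + N) = W k) {S : Set ℝ} (hS : MeasurableSet S) :
    siteMeasure V S ≤
      siteMeasure W S + ∫⁻ E, ENNReal.ofReal (siteDensity V N E - siteDensity W N E) := by
  rw [siteMeasure_eq_withDensity hN hV, siteMeasure_eq_withDensity hN hW,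
    withDensity_apply _ hS, withDensity_apply _ hS]
  calc ∫⁻ E in S, ENNReal.ofReal (siteDensity V N E)
      ≤ ∫⁻ E in S, (ENNReal.ofReal (siteDensity W N E) +
          ENNReal.ofReal (siteDensity V N E - siteDensity W N E)) := by
        refine lintegral_mono fun E => ?_
        refine (ENNReal.ofReal_le_ofReal ?_).trans ENNReal.ofReal_add_le
        rw [add_sub_cancel]
    _ = (∫⁻ E in S, ENNReal.ofReal (siteDensity W N E)) +
          ∫⁻ E in S, ENNReal.ofReal (siteDensity V N E - siteDensity W N E) :=
        lintegral_add_left (measurable_siteDensity W N).ennreal_ofReal _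
    _ ≤ _ := by
        gcongr
        exact Measure.restrict_le_self

lemma measure_le_add_of_measure_compl_le_add {α : Type*} [MeasurableSpace α] {μ ν : Measure α}
    [IsFiniteMeasure μ] (huniv : μ Set.univ = ν Set.univ) {S : Set α} (hS : MeasurableSet S)
    {η : ℝ≥0∞} (h : ν Sᶜ ≤ μ Sᶜ + η) : μ S ≤ ν S + η := by
  refine (ENNReal.add_le_add_iff_right (measure_ne_top μ Sᶜ)).1 ?_
  rw [measure_add_measure_compl hS, huniv, ← measure_add_measure_compl hS, add_right_comm,
    add_assoc]
  gcongr

lemma exists_siteMeasure_le_add (hN : 0 < N) (hV : ∀ k, V (k + N) = V k) {η : ℝ≥0∞} (hη : 0 < η) :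
    ∃ δ > 0, ∀ W : ℓ^∞(ℤ, ℝ), (∀ k, W (k + N) = W k) → ‖W - V‖ < δ → ∀ S : Set ℝ,
      MeasurableSet S → siteMeasure W S ≤ siteMeasure V S + η := by
  obtain ⟨δ, hδ, hball⟩ := Metric.eventually_nhds_iff.1
    ((tendsto_lintegral_siteDensity_sub hN hV).eventually (gt_mem_nhds hη))
  refine ⟨δ, hδ, fun W hW hWV S hS => measure_le_add_of_measure_compl_le_add
    ((siteMeasure_univ W).trans (siteMeasure_univ V).symm) hS ?_⟩
  refine (siteMeasure_le_add_lintegral_siteDensity_sub hN hV hW hS.compl).trans ?_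
  gcongr
  exact (hball (by rwa [dist_eq_norm])).le

end TotalVariation

section ShiftCovariance

lemma spectralMeasure_unitary_conj {H : Type*} [NormedAddCommGroup H] [InnerProductSpace ℂ H]
    [CompleteSpace H] {A B : H →L[ℂ] H} (hA : IsSelfAdjoint A) (hB : IsSelfAdjoint B)
    (u : unitary (H →L[ℂ] H)) (h : (u : H →L[ℂ] H) * A * (star u : H →L[ℂ] H) = B) (ψ : H) :
    spectralMeasure B hB ((u : H →L[ℂ] H) ψ) = spectralMeasure A hA ψ := by
  refine Measure.ext_of_integral_eq_on_compactlySupported fun g => ?_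
  rw [integral_spectralMeasure, integral_spectralMeasure]
  let Φ := Unitary.conjStarAlgAut ℂ (H →L[ℂ] H) u
  have hΦ : Continuous Φ := by
    change Continuous fun x : H →L[ℂ] H => (u : H →L[ℂ] H) * x * (star u : H →L[ℂ] H)
    fun_prop
  have hΦA : Φ A = B := by rw [Unitary.conjStarAlgAut_apply, h]
  have hcfc : Φ (cfc (g : ℝ → ℝ) A) = cfc (g : ℝ → ℝ) B := by
    rw [StarAlgHomClass.map_cfc (S := ℂ) Φ (g : ℝ → ℝ) A g.continuous.continuousOn hΦ hA
      (hΦA ▸ hB), hΦA]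
  have hu (φ : H) : (star u : H →L[ℂ] H) ((u : H →L[ℂ] H) φ) = φ :=
    congrArg (fun C : H →L[ℂ] H => C φ) (Unitary.coe_star_mul_self u)
  rw [← hcfc]
  change (⟪(u : H →L[ℂ] H) ψ, (u : H →L[ℂ] H) (cfc (g : ℝ → ℝ) A
    ((star u : H →L[ℂ] H) ((u : H →L[ℂ] H) ψ)))⟫_ℂ).re = _
  rw [hu, ← ContinuousLinearMap.adjoint_inner_right, ← ContinuousLinearMap.star_eq_adjoint, hu]

lemma lpShift_mul (a b : ℤ) : lpShift a * lpShift b = lpShift (a + b) := by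
  ext ψ n
  change ψ (n + a + b) = ψ (n + (a + b))
  rw [add_assoc]

lemma lpShift_zero : lpShift 0 = 1 := by
  ext ψ n
  change ψ (n + 0) = ψ n
  rw [add_zero]

lemma star_lpShift (m : ℤ) : star (lpShift m) = lpShift (-m) := by
  rw [ContinuousLinearMap.star_eq_adjoint, eq_comm, ContinuousLinearMap.eq_adjoint_iff]
  intro φ ψ
  rw [inner_lpShift_left, neg_neg]

/-- The shift by `m` on `ℓ²(ℤ)` as a unitary operator. -/
noncomputable def unitaryShift (m : ℤ) : unitary (ℓ^2(ℤ, ℂ) →L[ℂ] ℓ^2(ℤ, ℂ)) :=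
  ⟨lpShift m, by
    rw [Unitary.mem_iff, star_lpShift, lpShift_mul, lpShift_mul, neg_add_cancel, add_neg_cancel,
      lpShift_zero]
    exact ⟨rfl, rfl⟩⟩

lemma unitaryShift_conj_schrodinger {V W : ℓ^∞(ℤ, ℝ)} {m : ℤ} (hVW : ∀ n, W n = V (n + m)) :
    (unitaryShift m : ℓ^2(ℤ, ℂ) →L[ℂ] ℓ^2(ℤ, ℂ)) * schrodinger V *
      (star (unitaryShift m) : ℓ^2(ℤ, ℂ) →L[ℂ] ℓ^2(ℤ, ℂ)) = schrodinger W := by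
  change lpShift m * schrodinger V * star (lpShift m) = _
  rw [star_lpShift]
  ext ψ n
  change ψ (n + m + 1 + -m) + ψ (n + m - 1 + -m) + (V (n + m) : ℂ) * ψ (n + m + -m) =
    ψ (n + 1) + ψ (n - 1) + (W n : ℂ) * ψ n
  rw [hVW, add_neg_cancel_right, show n + m + 1 + -m = n + 1 by ring,
    show n + m - 1 + -m = n - 1 by ring]

lemma spectralMeasure_single {V W : ℓ^∞(ℤ, ℝ)} {m : ℤ} (hVW : ∀ n, W n = V (n + m)) :
    spectralMeasure (schrodinger V) (isSelfAdjoint_schrodinger V) (lp.single 2 m (1 : ℂ)) =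
      siteMeasure W := by
  have hsite : lpShift m (lp.single 2 m (1 : ℂ)) = siteVector := by
    rw [lpShift_single, sub_self, siteVector]
  rw [siteMeasure, ← hsite]
  exact (spectralMeasure_unitary_conj _ _ (unitaryShift m)
    (unitaryShift_conj_schrodinger hVW) _).symm

lemma hasPurelyACSpectrum_of_single {A : ℓ^2(ℤ, ℂ) →L[ℂ] ℓ^2(ℤ, ℂ)} (hA : IsSelfAdjoint A)
    (h : ∀ m : ℤ, spectralMeasure A hA (lp.single 2 m (1 : ℂ)) ≪ volume) :
    HasPurelyACSpectrum A hA := by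
  intro ψ
  have hmem (m : ℤ) : lp.single 2 m (ψ m) ∈ acSubmodule A hA := by
    have hsmul : (lp.single 2 m (ψ m) : ℓ^2(ℤ, ℂ)) = ψ m • lp.single 2 m (1 : ℂ) := by
      rw [← lp.single_smul, smul_eq_mul, mul_one]
    rw [hsmul]
    exact (acSubmodule A hA).smul_mem _ (h m)
  exact (isClosed_acSubmodule A hA).mem_of_tendsto (lp.hasSum_single (by norm_num) ψ)
    (Filter.Eventually.of_forall fun s => (acSubmodule A hA).sum_mem fun m _ => hmem m)

end ShiftCovariance

section PeriodicSampling

open Filter Topology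

variable {Ω : Type*} [TopologicalSpace Ω] {T : Ω ≃ₜ Ω}

/-- The function `f` is invariant under the `N`-th iterate of `T`, so that all its potentials along
the orbits of `T` are `N`-periodic. -/
def HasPeriod {X : Type*} (T : Ω ≃ₜ Ω) (N : ℕ) (f : Ω → X) : Prop :=
  ∀ ω, f ((T ^ (N : ℤ)) ω) = f ω

lemma homeomorph_zpow_add (T : Ω ≃ₜ Ω) (m n : ℤ) (ω : Ω) :
    (T ^ (m + n)) ω = (T ^ m) ((T ^ n) ω) := by
  rw [zpow_add]
  rfl

lemma HasPeriod.zpow_mul {X : Type*} {N : ℕ} {f : Ω → X} (hf : HasPeriod T N f) (j : ℤ) (ω : Ω) :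
    f ((T ^ (N * j : ℤ)) ω) = f ω := by
  induction j using Int.induction_on with
  | zero => simp
  | succ j ih => rw [mul_add, mul_one, add_comm, homeomorph_zpow_add, hf, ih]
  | pred j ih =>
    rw [← ih, ← hf ((T ^ (N * (-j - 1 : ℤ) : ℤ)) ω), ← homeomorph_zpow_add]
    congr 3
    ring

lemma HasPeriod.mul {X : Type*} {N : ℕ} {f : Ω → X} (hf : HasPeriod T N f) (q : ℕ) :
    HasPeriod T (N * q) f := fun ω => by
  rw [Nat.cast_mul]
  exact hf.zpow_mul q ω

lemma IsMinimalHomeo.eq_univ_of_isClosed (hmin : IsMinimalHomeo T) {C : Set Ω} (hC : IsClosed C)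
    {ω₀ : Ω} (h : ∀ n : ℤ, (T ^ n) ω₀ ∈ C) : C = Set.univ :=
  Set.univ_subset_iff.1 <| (hmin ω₀).closure_eq ▸
    hC.closure_subset_iff.2 (Set.range_subset_iff.2 h)

lemma HasPeriod.of_orbit (hmin : IsMinimalHomeo T) {X : Type*} [TopologicalSpace X] [T2Space X]
    {N : ℕ} {f : Ω → X} (hf : Continuous f) (ω₀ : Ω)
    (h : ∀ n : ℤ, f ((T ^ (n + N)) ω₀) = f ((T ^ n) ω₀)) : HasPeriod T N f := by
  have hclosed : IsClosed {x | f ((T ^ (N : ℤ)) x) = f x} :=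
    isClosed_eq (hf.comp (T ^ (N : ℤ)).continuous) hf
  have hmem (n : ℤ) : f ((T ^ (N : ℤ)) ((T ^ n) ω₀)) = f ((T ^ n) ω₀) := by
    rw [← homeomorph_zpow_add, add_comm, h]
  exact fun ω => (Set.ext_iff.1 (hmin.eq_univ_of_isClosed hclosed hmem) ω).2 trivial

variable [CompactSpace Ω]

lemma dynPotential_apply (f : C(Ω, ℝ)) (ω : Ω) (n : ℤ) :
    dynPotential T f ω n = f ((T ^ n) ω) := rfl

lemma norm_dynPotential_sub_le (f g : C(Ω, ℝ)) (ω : Ω) :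
    ‖dynPotential T f ω - dynPotential T g ω‖ ≤ ‖f - g‖ :=
  lp.norm_le_of_forall_le (norm_nonneg _) fun n => (f - g).norm_coe_le_norm ((T ^ n) ω)

lemma HasPeriod.dynPotential_add {N : ℕ} {f : C(Ω, ℝ)} (hf : HasPeriod T N f) (ω : Ω) (k : ℤ) :
    dynPotential T f ω (k + N) = dynPotential T f ω k := by
  rw [dynPotential_apply, dynPotential_apply, add_comm, homeomorph_zpow_add, hf]

lemma dynPotential_zpow (f : C(Ω, ℝ)) (ω : Ω) (m n : ℤ) :
    dynPotential T f ((T ^ m) ω) n = dynPotential T f ω (n + m) := by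
  rw [dynPotential_apply, dynPotential_apply, homeomorph_zpow_add]

lemma isClosed_setOf_dynPotential_eq (f : C(Ω, ℝ)) (V : ℓ^∞(ℤ, ℝ)) :
    IsClosed {ω | dynPotential T f ω = V} := by
  have hset : {ω | dynPotential T f ω = V} = ⋂ n : ℤ, {ω | f ((T ^ n) ω) = V n} := by
    ext ω
    rw [Set.mem_iInter]
    exact ⟨fun h n => congrArg (fun W : ℓ^∞(ℤ, ℝ) => W n) h, fun h => lp.ext (funext h)⟩
  rw [hset]
  exact isClosed_iInter fun n => isClosed_eq (f.continuous.comp (T ^ n).continuous)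
    continuous_const

lemma HasPeriod.dynPotential_zpow_emod {N : ℕ} {f : C(Ω, ℝ)} (hf : HasPeriod T N f) (ω : Ω)
    (n : ℤ) : dynPotential T f ((T ^ n) ω) = dynPotential T f ((T ^ (n % N)) ω) := by
  ext m
  rw [dynPotential_apply, dynPotential_apply, ← homeomorph_zpow_add, ← homeomorph_zpow_add,
    ← hf.zpow_mul (n / N) ((T ^ (m + n % N)) ω), ← homeomorph_zpow_add, add_left_comm,
    Int.mul_ediv_add_emod]

lemma HasPeriod.exists_dynPotential_eq (hmin : IsMinimalHomeo T) {N : ℕ} (hN : 0 < N)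
    {f : C(Ω, ℝ)} (hf : HasPeriod T N f) (ω₀ ω : Ω) :
    ∃ k < N, dynPotential T f ω = dynPotential T f ((T ^ (k : ℤ)) ω₀) := by
  let C (k : ℕ) : Set Ω := {x | dynPotential T f x = dynPotential T f ((T ^ (k : ℤ)) ω₀)}
  have hclosed : IsClosed (⋃ k ∈ Finset.range N, C k) :=
    isClosed_biUnion_finset fun k _ => isClosed_setOf_dynPotential_eq f _
  have horbit (n : ℤ) : (T ^ n) ω₀ ∈ ⋃ k ∈ Finset.range N, C k := by
    have hN' : (0 : ℤ) < N := by exact_mod_cast hN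
    have hnonneg := Int.emod_nonneg n hN'.ne'
    have hlt := Int.emod_lt_of_pos n hN'
    simp only [Set.mem_iUnion, Finset.mem_range]
    refine ⟨(n % N).toNat, by omega, ?_⟩
    change dynPotential T f _ = _
    rw [Int.toNat_of_nonneg hnonneg, hf.dynPotential_zpow_emod]
  have hω : ω ∈ ⋃ k ∈ Finset.range N, C k :=
    hmin.eq_univ_of_isClosed hclosed horbit ▸ Set.mem_univ ω
  obtain ⟨k, hk, hωk⟩ := Set.mem_iUnion₂.1 hω
  exact ⟨k, Finset.mem_range.1 hk, hωk⟩

lemma HasPeriod.eventually_abs_sub_le {N : ℕ} {f : C(Ω, ℝ)} (hf : HasPeriod T N f) {δ : ℝ}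
    (hδ : 0 < δ) : ∀ᶠ g : C(Ω, ℝ) in 𝓝 f, ∀ ω, |g ((T ^ (N : ℤ)) ω) - g ω| ≤ δ := by
  filter_upwards [Metric.ball_mem_nhds f (half_pos hδ)] with g hg ω
  have happly (x : Ω) : |g x - f x| ≤ δ / 2 :=
    (ContinuousMap.dist_apply_le_dist x).trans (Metric.mem_ball.1 hg).le
  calc |g ((T ^ (N : ℤ)) ω) - g ω|
      = |(g ((T ^ (N : ℤ)) ω) - f ((T ^ (N : ℤ)) ω)) - (g ω - f ω)| := by
        rw [hf ω, sub_sub_sub_cancel_right]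
    _ ≤ |g ((T ^ (N : ℤ)) ω) - f ((T ^ (N : ℤ)) ω)| + |g ω - f ω| := abs_sub _ _
    _ ≤ δ := by linarith [happly ω, happly ((T ^ (N : ℤ)) ω)]

lemma norm_sub_le_of_orbit (hmin : IsMinimalHomeo T) (ω₀ : Ω) {f g : C(Ω, ℝ)} {c : ℝ}
    (h : ∀ n : ℤ, |f ((T ^ n) ω₀) - g ((T ^ n) ω₀)| ≤ c) : ‖f - g‖ ≤ c := by
  have hclosed : IsClosed {x | ‖(f - g) x‖ ≤ c} :=
    isClosed_le (f - g).continuous.norm continuous_const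
  refine (ContinuousMap.norm_le _ ((abs_nonneg _).trans (h 0))).2 fun ω => ?_
  exact (Set.ext_iff.1 (hmin.eq_univ_of_isClosed hclosed h) ω).2 trivial

end PeriodicSampling

section CantorGroup

open Filter Topology

variable {Ω : Type*} [AddCommGroup Ω] [TopologicalSpace Ω] {α : Ω} {U : AddSubgroup Ω}

/-- The natural numbers `N` such that some open subgroup contains exactly the multiples of `N • α`
among the multiples of `α`; these are the periods of the functions of the translation by `α` that
factor through a finite quotient. -/
def subgroupPeriods (α : Ω) : Set ℕ :=
  {N | 0 < N ∧ ∃ U : AddSubgroup Ω, IsOpen (U : Set Ω) ∧ ∀ n : ℤ, n • α ∈ U ↔ (N : ℤ) ∣ n}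

lemma zpow_apply_of_translation {T : Ω ≃ₜ Ω} (hα : ∀ ω, T ω = ω + α) (n : ℤ) (ω : Ω) :
    (T ^ n) ω = ω + n • α := by
  induction n using Int.induction_on generalizing ω with
  | zero => simp
  | succ n ih =>
    rw [homeomorph_zpow_add, ih, zpow_one, hα]
    module
  | pred n ih =>
    have hinv : (T ^ (-1 : ℤ)) ω = ω - α := by
      rw [zpow_neg_one]
      change T.symm ω = ω - α
      rw [Homeomorph.symm_apply_eq, hα, sub_add_cancel]
    rw [sub_eq_add_neg, homeomorph_zpow_add, hinv, ih]
    module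

lemma IsMinimalHomeo.dense_zmultiples {T : Ω ≃ₜ Ω} (hmin : IsMinimalHomeo T)
    (hα : ∀ ω, T ω = ω + α) : Dense (AddSubgroup.zmultiples α : Set Ω) := by
  refine (hmin 0).mono ?_
  rintro _ ⟨n, rfl⟩
  exact ⟨n, by simp only [zpow_apply_of_translation hα, zero_add]⟩

lemma zsmul_ne_zero_of_dense_zmultiples [T1Space Ω] [PerfectSpace Ω]
    (hd : Dense (AddSubgroup.zmultiples α : Set Ω)) {n : ℤ} (hn : n ≠ 0) : n • α ≠ 0 := by
  intro h
  have hfin : (AddSubgroup.zmultiples α : Set Ω).Finite :=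
    finite_zmultiples.2 (isOfFinAddOrder_iff_zsmul_eq_zero.2 ⟨n, hn, h⟩)
  refine infinite_of_mem_nhds (0 : Ω) univ_mem ?_
  rwa [← hd.closure_eq, hfin.isClosed.closure_eq]

variable [IsTopologicalAddGroup Ω]

lemma exists_zsmul_sub_mem (hd : Dense (AddSubgroup.zmultiples α : Set Ω))
    (hU : IsOpen (U : Set Ω)) (ω : Ω) : ∃ n : ℤ, ω - n • α ∈ U := by
  have hO : IsOpen {x : Ω | ω - x ∈ U} := hU.preimage (continuous_const.sub continuous_id)
  obtain ⟨_, hx, n, rfl⟩ := hd.inter_open_nonempty _ hO ⟨ω, by simp⟩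
  exact ⟨n, hx⟩

lemma exists_continuousMap_zsmul_eq (hd : Dense (AddSubgroup.zmultiples α : Set Ω))
    (hU : IsOpen (U : Set Ω)) {N : ℕ} (hUN : ∀ n : ℤ, n • α ∈ U → (N : ℤ) ∣ n)
    {X : Type*} [TopologicalSpace X] {v : ℤ → X} (hv : ∀ k, v (k + N) = v k) :
    ∃ f : C(Ω, X), (∀ u ∈ U, ∀ ω, f (ω + u) = f ω) ∧ ∀ n : ℤ, f (n • α) = v n := by
  choose r hr using exists_zsmul_sub_mem hd hU
  have hvr {ω : Ω} {n : ℤ} (h : ω - n • α ∈ U) : v (r ω) = v n := by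
    have hdiff : (r ω - n) • α ∈ U := by
      have := U.sub_mem h (hr ω)
      rwa [sub_sub_sub_cancel_left, sub_eq_add_neg, ← _root_.sub_zsmul] at this
    obtain ⟨j, hj⟩ := hUN _ hdiff
    rw [show r ω = n + j * N by rw [← sub_eq_iff_eq_add', hj, mul_comm]]
    exact Function.Periodic.int_mul (f := v) hv j n
  have hinv (u : Ω) (hu : u ∈ U) (ω : Ω) : v (r (ω + u)) = v (r ω) := hvr <| by
    simpa only [add_sub_right_comm] using U.add_mem (hr ω) hu
  have hlc : IsLocallyConstant fun ω => v (r ω) := IsLocallyConstant.iff_exists_open _ |>.2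
    fun ω => ⟨{x | x - ω ∈ U}, hU.preimage (continuous_id.sub continuous_const), by simp,
      fun x hx => by simpa only [add_sub_cancel] using hinv (x - ω) hx ω⟩
  exact ⟨⟨_, hlc.continuous⟩, hinv, fun n => hvr (by simp)⟩

lemma exists_hasPeriod_orbit {T : Ω ≃ₜ Ω} (hα : ∀ ω, T ω = ω + α) (hmin : IsMinimalHomeo T)
    {N : ℕ} (hN : N ∈ subgroupPeriods α) {X : Type*} [TopologicalSpace X] {v : ℤ → X}
    (hv : ∀ k, v (k + N) = v k) :
    ∃ f : C(Ω, X), HasPeriod T N f ∧ ∀ n : ℤ, f ((T ^ n) 0) = v n := by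
  obtain ⟨-, U, hU, hUN⟩ := hN
  obtain ⟨f, hfU, hf⟩ :=
    exists_continuousMap_zsmul_eq (hmin.dense_zmultiples hα) hU (fun n => (hUN n).1) hv
  refine ⟨f, fun ω => ?_, fun n => ?_⟩
  · rw [zpow_apply_of_translation hα, hfU _ ((hUN N).2 dvd_rfl)]
  · rw [zpow_apply_of_translation hα, zero_add, hf]

variable [CompactSpace Ω]

lemma exists_subgroupPeriod (α : Ω) (hU : IsOpen (U : Set Ω)) :
    ∃ N : ℕ, 0 < N ∧ ∀ n : ℤ, n • α ∈ U ↔ (N : ℤ) ∣ n := by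
  obtain ⟨a, ha⟩ := Int.subgroup_cyclic (U.comap (zmultiplesHom Ω α))
  have hdvd (n : ℤ) : n • α ∈ U ↔ (a.natAbs : ℤ) ∣ n := by
    change n ∈ U.comap (zmultiplesHom Ω α) ↔ _
    rw [ha, ← AddSubgroup.zmultiples_eq_closure, Int.mem_zmultiples_iff, Int.natAbs_dvd]
  have hfin : Finite (Ω ⧸ U) := AddSubgroup.quotient_finite_of_isOpen U hU
  obtain ⟨m, n, hmn, h⟩ := Finite.exists_ne_map_eq_of_infinite
    fun n : ℤ => ((n • α : Ω) : Ω ⧸ U)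
  rw [QuotientAddGroup.eq, ← neg_zsmul, ← add_zsmul, hdvd] at h
  refine ⟨a.natAbs, Nat.pos_of_ne_zero fun h0 => hmn ?_, hdvd⟩
  rw [h0, Nat.cast_zero, zero_dvd_iff] at h
  omega

variable [TotallyDisconnectedSpace Ω]

lemma exists_openAddSubgroup_subset {O : Set Ω} (hO : IsOpen O) (h0 : (0 : Ω) ∈ O) :
    ∃ U : AddSubgroup Ω, IsOpen (U : Set Ω) ∧ (U : Set Ω) ⊆ O := by
  obtain ⟨H, hH⟩ := ProfiniteGrp.exist_openNormalAddSubgroup_sub_open_nhds_of_zero hO h0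
  exact ⟨H.toAddSubgroup, H.isOpen', hH⟩

lemma exists_mul_mem_subgroupPeriods [PerfectSpace Ω]
    (hd : Dense (AddSubgroup.zmultiples α : Set Ω)) {p : ℕ} (hp : p ∈ subgroupPeriods α) (L : ℕ) :
    ∃ q ≥ L, p * q ∈ subgroupPeriods α := by
  obtain ⟨hp0, U, hU, hUp⟩ := hp
  let F : Set Ω := (fun j : ℕ => ((p * j : ℕ) : ℤ) • α) '' Set.Ico 1 L
  have hF : IsClosed F := ((Set.finite_Ico 1 L).image _).isClosed
  have hF0 : (0 : Ω) ∉ F := by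
    rintro ⟨j, hj, h⟩
    refine zsmul_ne_zero_of_dense_zmultiples hd ?_ h
    exact_mod_cast (Nat.mul_pos hp0 hj.1).ne'
  obtain ⟨U', hU', hU'F⟩ := exists_openAddSubgroup_subset hF.isOpen_compl hF0
  have hUU' : IsOpen ((U ⊓ U' : AddSubgroup Ω) : Set Ω) := hU.inter hU'
  obtain ⟨N, hN0, hN⟩ := exists_subgroupPeriod α hUU'
  have hNα : (N : ℤ) • α ∈ U ⊓ U' := (hN N).2 dvd_rfl
  obtain ⟨q, rfl⟩ : p ∣ N := Int.natCast_dvd_natCast.1 ((hUp N).1 hNα.1)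
  refine ⟨q, ?_, hN0, _, hUU', hN⟩
  by_contra! hq
  exact hU'F hNα.2 ⟨q, ⟨Nat.pos_of_mul_pos_left hN0, hq⟩, rfl⟩

lemma exists_openAddSubgroup_norm_sub_le (g : C(Ω, ℝ)) {ε : ℝ} (hε : 0 < ε) :
    ∃ U : AddSubgroup Ω, IsOpen (U : Set Ω) ∧ ∀ u ∈ U, ∀ ω, ‖g (ω + u) - g ω‖ ≤ ε := by
  have hO : IsOpen {x : Ω | ‖g.comp (Homeomorph.addRight x : C(Ω, Ω)) - g‖ < ε} := by
    refine isOpen_lt (Continuous.norm (Continuous.sub ?_ continuous_const)) continuous_const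
    refine ContinuousMap.continuous_of_continuous_uncurry _ ?_
    exact g.continuous.comp (continuous_snd.add continuous_fst)
  obtain ⟨U, hU, hUO⟩ := exists_openAddSubgroup_subset hO (by
    have hzero : g.comp (Homeomorph.addRight (0 : Ω) : C(Ω, Ω)) = g := by ext x; simp
    simpa [hzero] using hε)
  exact ⟨U, hU, fun u hu ω =>
    ((g.comp (Homeomorph.addRight u : C(Ω, Ω)) - g).norm_coe_le_norm ω).trans (hUO hu).le⟩

lemma exists_hasPeriod_near {T : Ω ≃ₜ Ω} (hα : ∀ ω, T ω = ω + α) (hmin : IsMinimalHomeo T)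
    (g : C(Ω, ℝ)) {ε : ℝ} (hε : 0 < ε) :
    ∃ p ∈ subgroupPeriods α, ∃ f : C(Ω, ℝ), HasPeriod T p f ∧ ‖f - g‖ ≤ ε := by
  obtain ⟨U, hU, hUg⟩ := exists_openAddSubgroup_norm_sub_le g hε
  obtain ⟨N, hN0, hN⟩ := exists_subgroupPeriod α hU
  have hmem : N ∈ subgroupPeriods α := ⟨hN0, U, hU, hN⟩
  obtain ⟨f, hf, hfn⟩ := exists_hasPeriod_orbit hα hmin hmem
    (v := fun k => g ((k % N) • α)) fun k => by simp
  refine ⟨N, hmem, f, hf, norm_sub_le_of_orbit hmin 0 fun n => ?_⟩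
  have hu : (n % N - n) • α ∈ U := (hN _).2 (Int.dvd_of_emod_eq_zero (by simp [Int.sub_emod]))
  have hgu := hUg _ hu (n • α)
  rw [← add_zsmul, add_sub_cancel, Real.norm_eq_abs] at hgu
  rwa [hfn, zpow_apply_of_translation hα, zero_add]

end CantorGroup

section PeriodicSpectrum

open Filter Topology

lemma eval_discriminant_comp_add {v w : ℤ → ℝ} {N : ℕ} (hv : ∀ k, v (k + N) = v k) {m : ℤ}
    (hw : ∀ n, w n = v (n + m)) (E : ℝ) :
    (discriminant w N).eval E = (discriminant v N).eval E := by
  rw [eval_discriminant, eval_discriminant, ← trace_transfer (w := fun k => E - v k) (m := m)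
    (fun k => by rw [hv])]
  congr 1
  refine transfer_congr fun k _ => ?_
  rw [hw, zero_add, add_comm]

variable {Ω : Type*} [TopologicalSpace Ω] [CompactSpace Ω] {T : Ω ≃ₜ Ω}

lemma norm_dynPotential_le (f : C(Ω, ℝ)) (ω : Ω) : ‖dynPotential T f ω‖ ≤ ‖f‖ :=
  lp.norm_le_of_forall_le (norm_nonneg _) fun n => f.norm_coe_le_norm ((T ^ n) ω)

lemma exists_mem_spectrum_dynSchrodinger_dist_le (f g : C(Ω, ℝ)) {ω : Ω} {E : ℝ}
    (hE : E ∈ spectrum ℝ (dynSchrodinger T f ω)) :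
    ∃ E' ∈ spectrum ℝ (dynSchrodinger T g ω), dist E E' ≤ dist f g := by
  obtain ⟨E', hE', h⟩ :=
    exists_mem_spectrum_abs_sub_le (isSelfAdjoint_dynSchrodinger T g ω) hE
  rw [dist_eq_norm f]
  exact ⟨E', hE', h.trans ((norm_schrodinger_sub_le _ _).trans (norm_dynPotential_sub_le f g ω))⟩

lemma eventually_spectrum_subset {f : C(Ω, ℝ)} {K O : Set ℝ} (hK : IsCompact K) (hO : IsOpen O)
    (hKO : K ⊆ O) (hf : ∀ ω, spectrum ℝ (dynSchrodinger T f ω) ⊆ K) :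
    ∀ᶠ g in 𝓝 f, ∀ ω, spectrum ℝ (dynSchrodinger T g ω) ⊆ O := by
  obtain ⟨δ, hδ, hδO⟩ := hK.exists_thickening_subset_open hO hKO
  filter_upwards [Metric.ball_mem_nhds f hδ] with g hg ω E hE
  obtain ⟨E', hE', hEE'⟩ := exists_mem_spectrum_dynSchrodinger_dist_le g f hE
  exact hδO (Metric.mem_thickening_iff.2 ⟨E', hf ω hE', hEE'.trans_lt hg⟩)

lemma HasPeriod.abs_eval_discriminant_le (hmin : IsMinimalHomeo T) {N : ℕ} (hN : 0 < N)
    {f : C(Ω, ℝ)} (hf : HasPeriod T N f) (ω₀ : Ω) {ω : Ω} {E : ℝ}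
    (hE : E ∈ spectrum ℝ (dynSchrodinger T f ω)) :
    |(discriminant (dynPotential T f ω₀) N).eval E| ≤ 2 := by
  obtain ⟨k, -, hk⟩ := hf.exists_dynPotential_eq hmin hN ω₀ ω
  rw [← eval_discriminant_comp_add (hf.dynPotential_add ω₀) (w := dynPotential T f ω) (m := k)
    fun n => by rw [hk, dynPotential_zpow]]
  exact _root_.abs_eval_discriminant_le _ (hf.dynPotential_add ω) hE

lemma HasPeriod.spectrum_subset (hmin : IsMinimalHomeo T) {N : ℕ} (hN : 0 < N) {f : C(Ω, ℝ)}
    (hf : HasPeriod T N f) {c : ℝ} (hc : 2 + ‖f‖ ≤ c) (ω₀ ω : Ω) :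
    spectrum ℝ (dynSchrodinger T f ω) ⊆
      {E ∈ Metric.closedBall 0 c | |(discriminant (dynPotential T f ω₀) N).eval E| ≤ 2} := by
  refine fun E hE => ⟨?_, hf.abs_eval_discriminant_le hmin hN ω₀ hE⟩
  rw [mem_closedBall_zero_iff, Real.norm_eq_abs]
  have hnorm := norm_dynPotential_le (T := T) f ω
  linarith [abs_le_of_mem_spectrum_schrodinger _ hE]

lemma isCompact_setOf_abs_eval_discriminant_le (v : ℤ → ℝ) (N : ℕ) {B : Set ℝ} (hB : IsCompact B) :
    IsCompact {E ∈ B | |(discriminant v N).eval E| ≤ 2} :=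
  hB.inter_right (isClosed_le (discriminant v N).continuous.abs continuous_const)

lemma HasPeriod.eventually_notMem_spectrum (hmin : IsMinimalHomeo T) {N : ℕ} (hN : 0 < N)
    {f : C(Ω, ℝ)} (hf : HasPeriod T N f) {ω₀ : Ω} {E : ℝ}
    (hE : 2 < |(discriminant (dynPotential T f ω₀) N).eval E|) :
    ∀ᶠ g in 𝓝 f, ∀ ω, E ∉ spectrum ℝ (dynSchrodinger T g ω) := by
  have hK : {x ∈ Metric.closedBall 0 (2 + ‖f‖) |
      |(discriminant (dynPotential T f ω₀) N).eval x| ≤ 2} ⊆ {E}ᶜ := by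
    rintro _ ⟨-, h⟩ rfl
    exact h.not_gt hE
  filter_upwards [eventually_spectrum_subset
    (isCompact_setOf_abs_eval_discriminant_le _ N (isCompact_closedBall 0 _))
    isOpen_compl_singleton hK (hf.spectrum_subset hmin hN le_rfl ω₀)] with g hg ω hEω
  exact hg ω hEω rfl

lemma eventually_volume_spectrum_lt {f : C(Ω, ℝ)} {K : Set ℝ} (hK : IsCompact K)
    (hf : ∀ ω, spectrum ℝ (dynSchrodinger T f ω) ⊆ K) {ε : ℝ≥0∞} (hε : volume K < ε) :
    ∀ᶠ g in 𝓝 f, ∀ ω, volume (spectrum ℝ (dynSchrodinger T g ω)) < ε := by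
  obtain ⟨O, hKO, hO, hOε⟩ := K.exists_isOpen_lt_of_lt _ hε
  filter_upwards [eventually_spectrum_subset hK hO hKO hf] with g hg ω
  exact (measure_mono (hg ω)).trans_lt hOε

end PeriodicSpectrum

section SingularContinuous

open Filter Topology

lemma dense_interior_of_forall_exists_mem_nhds {X : Type*} [PseudoMetricSpace X] {S : Set X}
    (h : ∀ g : X, ∀ r > 0, ∃ f, dist f g < r ∧ S ∈ 𝓝 f) : Dense (interior S) :=
  Metric.dense_iff.2 fun g r hr =>
    let ⟨f, hfg, hf⟩ := h g r hr
    ⟨f, hfg, mem_interior_iff_mem_nhds.2 hf⟩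

lemma IsGordon.isCantorSet_and_hasPurelySCSpectrum {V : ℓ^∞(ℤ, ℝ)} (hV : IsGordon V)
    (hvol : volume (spectrum ℝ (schrodinger V)) = 0) :
    IsCantorSet (spectrum ℝ (schrodinger V)) ∧
      HasPurelySCSpectrum (schrodinger V) (isSelfAdjoint_schrodinger V) :=
  ⟨isCantorSet_spectrum (isSelfAdjoint_schrodinger V) (fun _ _ => hV.eq_zero_of_eigenvector)
      (volume.interior_eq_empty_of_null hvol),
    fun ψ => ⟨spectralMeasure_mutuallySingular _ _ ψ hvol, hV.spectralMeasure_singleton ψ⟩⟩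

variable {Ω : Type*} [TopologicalSpace Ω] {T : Ω ≃ₜ Ω}

lemma isGordon_dynPotential [CompactSpace Ω] {f : C(Ω, ℝ)}
    (h : ∀ k : ℕ, ∃ q ≥ k, ∀ ω, |f ((T ^ (q : ℤ)) ω) - f ω| ≤ ((k : ℝ) + 1)⁻¹ ^ q) (ω : Ω) :
    IsGordon (dynPotential T f ω) := fun k => by
  obtain ⟨q, hq, hqf⟩ := h k
  refine ⟨q, hq, fun n => ?_⟩
  rw [dynPotential_apply, dynPotential_apply, add_comm, homeomorph_zpow_add]
  exact hqf _

variable [AddCommGroup Ω] {α : Ω}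

lemma HasPeriod.exists_near_volume_cover_lt [IsCantorGroup Ω]
    (hα : ∀ ω, T ω = ω + α) (hmin : IsMinimalHomeo T) {p : ℕ}
    (hp : p ∈ subgroupPeriods α) {f : C(Ω, ℝ)} (hf : HasPeriod T p f) {δ ε : ℝ} (hδ : 0 < δ)
    (hε : 0 < ε) :
    ∃ f' : C(Ω, ℝ), ‖f' - f‖ ≤ δ ∧ ∃ K, IsCompact K ∧ volume K < ENNReal.ofReal ε ∧
      ∀ ω, spectrum ℝ (dynSchrodinger T f' ω) ⊆ K := by
  let B : Set ℝ := Metric.closedBall 0 (2 + (‖f‖ + δ))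
  have hB : IsCompact B := isCompact_closedBall 0 _
  obtain ⟨Q, hQ⟩ := exists_small_bands hp.1 (hf.dynPotential_add 0) hδ (half_pos hε) hB
  obtain ⟨q, hq, hpq⟩ := exists_mul_mem_subgroupPeriods (hmin.dense_zmultiples hα) hp Q
  obtain ⟨v, hv, hvf, hvol⟩ := hQ q hq
  obtain ⟨f', hf', hf'v⟩ := exists_hasPeriod_orbit hα hmin hpq hv
  have hff' : ‖f' - f‖ ≤ δ := norm_sub_le_of_orbit hmin 0 fun n => by
    rw [hf'v]
    exact hvf n
  have hbound : 2 + ‖f'‖ ≤ 2 + (‖f‖ + δ) := by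
    linarith [norm_sub_norm_le f' f]
  have hv0 : (dynPotential T f' 0 : ℤ → ℝ) = v := funext hf'v
  refine ⟨f', hff', _, isCompact_setOf_abs_eval_discriminant_le v (p * q) hB, ?_, fun ω => ?_⟩
  · exact hvol.trans_lt ((ENNReal.ofReal_lt_ofReal_iff hε).2 (half_lt_self hε))
  · exact hv0 ▸ hf'.spectrum_subset hmin hpq.1 hbound 0 ω

lemma dense_interior_volume_spectrum_lt [IsCantorGroup Ω]
    (hα : ∀ ω, T ω = ω + α) (hmin : IsMinimalHomeo T) {ε : ℝ} (hε : 0 < ε) :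
    Dense (interior {f : C(Ω, ℝ) |
      ∀ ω, volume (spectrum ℝ (dynSchrodinger T f ω)) < ENNReal.ofReal ε}) := by
  refine dense_interior_of_forall_exists_mem_nhds fun g r hr => ?_
  obtain ⟨p, hp, f, hf, hfg⟩ := exists_hasPeriod_near hα hmin g (by positivity : 0 < r / 3)
  obtain ⟨f', hf'f, K, hK, hvol, hspec⟩ :=
    hf.exists_near_volume_cover_lt hα hmin hp (by positivity : 0 < r / 3) hε
  refine ⟨f', ?_, eventually_volume_spectrum_lt hK hspec hvol⟩
  rw [← dist_eq_norm] at hfg hf'f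
  linarith [dist_triangle f' f g]

lemma dense_interior_almost_period [IsTopologicalAddGroup Ω] [CompactSpace Ω]
    [TotallyDisconnectedSpace Ω] (hα : ∀ ω, T ω = ω + α) (hmin : IsMinimalHomeo T) (k : ℕ)
    {δ : ℕ → ℝ} (hδ : ∀ q, 0 < δ q) :
    Dense (interior {f : C(Ω, ℝ) | ∃ q ≥ k, ∀ ω, |f ((T ^ (q : ℤ)) ω) - f ω| ≤ δ q}) := by
  refine dense_interior_of_forall_exists_mem_nhds fun g r hr => ?_
  obtain ⟨p, hp, f, hf, hfg⟩ := exists_hasPeriod_near hα hmin g (half_pos hr)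
  rw [← dist_eq_norm] at hfg
  refine ⟨f, hfg.trans_lt (half_lt_self hr), ?_⟩
  filter_upwards [(hf.mul k).eventually_abs_sub_le (hδ (p * k))] with f' hf'
  exact ⟨p * k, Nat.le_mul_of_pos_left k hp.1, hf'⟩

lemma exists_dense_isGδ_sc [IsCantorGroup Ω] (hα : ∀ ω, T ω = ω + α) (hmin : IsMinimalHomeo T) :
    ∃ G : Set C(Ω, ℝ), IsGδ G ∧ Dense G ∧ ∀ f ∈ G, ∀ ω : Ω,
      IsCantorSet (spectrum ℝ (dynSchrodinger T f ω)) ∧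
      volume (spectrum ℝ (dynSchrodinger T f ω)) = 0 ∧
      HasPurelySCSpectrum (dynSchrodinger T f ω) (isSelfAdjoint_dynSchrodinger T f ω) := by
  let S (k : ℕ) : Set C(Ω, ℝ) :=
    {f | ∀ ω, volume (spectrum ℝ (dynSchrodinger T f ω)) < ENNReal.ofReal (1 / ((k : ℝ) + 1))}
  let P (k : ℕ) : Set C(Ω, ℝ) :=
    {f | ∃ q ≥ k, ∀ ω, |f ((T ^ (q : ℤ)) ω) - f ω| ≤ ((k : ℝ) + 1)⁻¹ ^ q}
  have hS (k : ℕ) : Dense (interior (S k)) :=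
    dense_interior_volume_spectrum_lt hα hmin Nat.one_div_pos_of_nat
  have hP (k : ℕ) : Dense (interior (P k)) :=
    dense_interior_almost_period hα hmin k fun q => by positivity
  have hSδ : IsGδ (⋂ k, interior (S k)) := .iInter_of_isOpen fun _ => isOpen_interior
  have hPδ : IsGδ (⋂ k, interior (P k)) := .iInter_of_isOpen fun _ => isOpen_interior
  refine ⟨_, hSδ.inter hPδ, (dense_iInter_of_isOpen (fun _ => isOpen_interior) hS).inter_of_Gδ
    hSδ hPδ (dense_iInter_of_isOpen (fun _ => isOpen_interior) hP), fun f ⟨hfS, hfP⟩ ω => ?_⟩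
  have hvol : volume (spectrum ℝ (dynSchrodinger T f ω)) = 0 := by
    have hlim : Tendsto (fun k : ℕ => ENNReal.ofReal (1 / ((k : ℝ) + 1))) atTop (𝓝 0) := by
      simpa using ENNReal.tendsto_ofReal tendsto_one_div_add_atTop_nhds_zero_nat
    refine le_antisymm (ge_of_tendsto' hlim fun k => ?_) zero_le
    exact (interior_subset (Set.mem_iInter.1 hfS k) ω).le
  have hper (k : ℕ) : f ∈ P k := interior_subset (Set.mem_iInter.1 hfP k)
  obtain ⟨hcantor, hsc⟩ :=
    (isGordon_dynPotential hper ω).isCantorSet_and_hasPurelySCSpectrum hvol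
  exact ⟨hcantor, hvol, hsc⟩

end SingularContinuous

section AbsolutelyContinuous

open Filter Topology Metric

lemma absolutelyContinuous_of_forall_le_add {X : Type*} [TopologicalSpace X] [MeasurableSpace X]
    {μ : ℕ → Measure X} [∀ j, (μ j).OuterRegular] {m ν : Measure X} (hac : ∀ j, μ j ≪ ν)
    {η : ℕ → ℝ≥0∞} (hη : Tendsto η atTop (𝓝 0))
    (hle : ∀ j k, j ≤ k → ∀ O, IsOpen O → μ k O ≤ μ j O + η j)
    (hm : ∀ O, IsOpen O → ∀ c, (∀ᶠ j in atTop, μ j O ≤ c) → m O ≤ c) : m ≪ ν := by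
  intro A hA
  refine le_antisymm (ge_of_tendsto' hη fun j => ?_) zero_le
  refine ENNReal.le_of_forall_pos_le_add fun ε hε _ => ?_
  obtain ⟨O, hAO, hO, hOε⟩ := A.exists_isOpen_lt_of_lt (μ := μ j) ε (by
    rw [hac j hA]
    exact_mod_cast hε)
  calc m A ≤ m O := measure_mono hAO
    _ ≤ μ j O + η j := hm O hO _ (eventually_atTop.2 ⟨j, fun k hjk => hle j k hjk O hO⟩)
    _ ≤ η j + ε := by
      rw [add_comm]
      gcongr

lemma siteMeasure_absolutelyContinuous_of_tendsto {V : ℕ → ℓ^∞(ℤ, ℝ)} {W : ℓ^∞(ℤ, ℝ)}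
    (hlim : Tendsto V atTop (𝓝 W)) (hac : ∀ j, siteMeasure (V j) ≪ volume)
    (hstep : ∀ j, ∀ S, MeasurableSet S →
      siteMeasure (V (j + 1)) S ≤ siteMeasure (V j) S + 2⁻¹ ^ (j + 1)) :
    siteMeasure W ≪ volume := by
  have hanti {O : Set ℝ} (hO : IsOpen O) :
      Antitone fun j => siteMeasure (V j) O + (2⁻¹ : ℝ≥0∞) ^ j :=
    antitone_nat_of_succ_le fun j => by
      calc siteMeasure (V (j + 1)) O + (2⁻¹ : ℝ≥0∞) ^ (j + 1)
          ≤ siteMeasure (V j) O + 2⁻¹ ^ (j + 1) + 2⁻¹ ^ (j + 1) := by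
            gcongr
            exact hstep j O hO.measurableSet
        _ = siteMeasure (V j) O + 2⁻¹ ^ j := by
            rw [add_assoc, pow_succ, ← mul_add, ENNReal.inv_two_add_inv_two, mul_one]
  exact absolutelyContinuous_of_forall_le_add hac
    (ENNReal.tendsto_pow_atTop_nhds_zero_of_lt_one ENNReal.one_half_lt_one)
    (fun j k hjk O hO => le_self_add.trans (hanti hO hjk))
    fun O hO c hc => spectralMeasure_open_le_of_tendsto
      (fun j => isSelfAdjoint_schrodinger (V j)) (isSelfAdjoint_schrodinger W)
      ((continuous_schrodinger.tendsto W).comp hlim) siteVector hO hc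

lemma measure_spectrum_pos {H : Type*} [NormedAddCommGroup H] [InnerProductSpace ℂ H]
    [CompleteSpace H] {A : H →L[ℂ] H} {hA : IsSelfAdjoint A} {ψ : H} (hψ : ψ ≠ 0) {m : Measure ℝ}
    (h : spectralMeasure A hA ψ ≪ m) : 0 < m (spectrum ℝ A) := by
  refine pos_iff_ne_zero.2 fun hm => hψ ?_
  have hzero := Measure.eq_zero_of_absolutelyContinuous_of_mutuallySingular h
    (spectralMeasure_mutuallySingular A hA ψ hm)
  have huniv := spectralMeasure_real_univ A hA ψ
  rw [hzero, measureReal_zero_apply] at huniv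
  exact norm_eq_zero.1 (pow_eq_zero_iff two_ne_zero |>.1 huniv.symm)

lemma nonempty_iInter_closedBall_of_subset {X : Type*} [PseudoMetricSpace X] [CompleteSpace X]
    {c : ℕ → X} {r : ℕ → ℝ} (hr : ∀ n, 0 ≤ r n) (hlim : Tendsto r atTop (𝓝 0))
    (hsub : ∀ n, closedBall (c (n + 1)) (r (n + 1)) ⊆ closedBall (c n) (r n)) :
    (⋂ n, closedBall (c n) (r n)).Nonempty := by
  have hanti : Antitone fun n => closedBall (c n) (r n) := antitone_nat_of_succ_le hsub
  refine nonempty_iInter_of_nonempty_biInter (fun _ => isClosed_closedBall)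
    (fun _ => isBounded_closedBall) (fun N => ⟨c N, ?_⟩) ?_
  · exact Set.mem_iInter₂.2 fun n hn => hanti hn (mem_closedBall_self (hr N))
  · exact squeeze_zero (fun _ => diam_nonneg) (fun n => diam_closedBall (hr n))
      (by simpa using hlim.const_mul 2)

variable {Ω : Type*} [TopologicalSpace Ω] {T : Ω ≃ₜ Ω}

lemma continuous_dynPotential [CompactSpace Ω] (ω : Ω) :
    Continuous fun f : C(Ω, ℝ) => dynPotential T f ω :=
  (LipschitzWith.of_dist_le_mul (K := 1) fun f g => by
    simpa [dist_eq_norm] using norm_dynPotential_sub_le f g ω).continuous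

lemma HasPeriod.exists_siteMeasure_le_add [CompactSpace Ω] (hmin : IsMinimalHomeo T) {N : ℕ}
    (hN : 0 < N) {f : C(Ω, ℝ)} (hf : HasPeriod T N f) (ω₀ : Ω) {η : ℝ≥0∞} (hη : 0 < η) :
    ∃ δ > 0, ∀ g : C(Ω, ℝ), HasPeriod T N g → ‖g - f‖ < δ → ∀ ω, ∀ S, MeasurableSet S →
      siteMeasure (dynPotential T g ω) S ≤ siteMeasure (dynPotential T f ω) S + η := by
  choose δ hδ hδS using fun k : ℕ => _root_.exists_siteMeasure_le_add hN
    (hf.dynPotential_add ((T ^ (k : ℤ)) ω₀)) hη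
  have hsmall : ∀ᶠ s : ℝ in 𝓝[>] 0, ∀ k ∈ Finset.range N, s < δ k :=
    (eventually_all_finset _).2 fun k _ => mem_nhdsWithin_of_mem_nhds (gt_mem_nhds (hδ k))
  obtain ⟨s, hs, hs0⟩ := (hsmall.and self_mem_nhdsWithin).exists
  refine ⟨s, hs0, fun g hg hgf ω S hS => ?_⟩
  obtain ⟨k, hk, hkf⟩ := hf.exists_dynPotential_eq hmin hN ω₀ ω
  rw [hkf]
  refine hδS k _ (hg.dynPotential_add ω) ?_ S hS
  rw [← hkf]
  exact (norm_dynPotential_sub_le g f ω).trans_lt (hgf.trans (hs k (Finset.mem_range.2 hk)))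

variable [AddCommGroup Ω] {α : Ω}

lemma HasPeriod.exists_gap_near [IsCantorGroup Ω] (hα : ∀ ω, T ω = ω + α)
    (hmin : IsMinimalHomeo T) {p : ℕ} (hp : p ∈ subgroupPeriods α) {f : C(Ω, ℝ)}
    (hf : HasPeriod T p f) {U : Set ℝ} (hU : IsOpen U) (hne : U.Nonempty) :
    ∃ N ∈ subgroupPeriods α, HasPeriod T N f ∧ ∀ δ > 0, ∃ f' : C(Ω, ℝ), HasPeriod T N f' ∧
      ‖f' - f‖ ≤ δ ∧ ∃ E ∈ U, ∀ᶠ g in 𝓝 f', ∀ ω, E ∉ spectrum ℝ (dynSchrodinger T g ω) := by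
  obtain ⟨Q, hQ⟩ := exists_gap_perturbation hp.1 (hf.dynPotential_add 0) hU hne
  obtain ⟨q, hq, hpq⟩ := exists_mul_mem_subgroupPeriods (hmin.dense_zmultiples hα) hp Q
  obtain ⟨E, hEU, hE⟩ := hQ q hq
  refine ⟨p * q, hpq, hf.mul q, fun δ hδ => ?_⟩
  obtain ⟨v, hv, hvf, r, hr, hvr, hgap⟩ := hE δ hδ
  obtain ⟨f', hf', hf'v⟩ := exists_hasPeriod_orbit hα hmin hpq hv
  have hr' : HasPeriod T r f' := .of_orbit hmin f'.continuous 0 fun n => by rw [hf'v, hf'v, hvr]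
  have hv0 : (dynPotential T f' 0 : ℤ → ℝ) = v := funext hf'v
  refine ⟨f', hf', norm_sub_le_of_orbit hmin 0 fun n => ?_, E, hEU,
    hr'.eventually_notMem_spectrum hmin hr (hv0.symm ▸ hgap)⟩
  rw [hf'v]
  exact hvf n

/-- A closed ball in `C(Ω, ℝ)` of positive radius around a function with a period in
`subgroupPeriods α`. The functions of part (a) are limits of nested sequences of such balls. -/
structure PeriodicBall (T : Ω ≃ₜ Ω) (α : Ω) where
  period : ℕ
  center : C(Ω, ℝ)
  radius : ℝ
  period_mem : period ∈ subgroupPeriods α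
  hasPeriod : HasPeriod T period center
  radius_pos : 0 < radius

variable [IsCantorGroup Ω]

lemma PeriodicBall.exists_refinement (hα : ∀ ω, T ω = ω + α) (hmin : IsMinimalHomeo T)
    (b : PeriodicBall T α) {U : Set ℝ} (hU : IsOpen U) (hne : U.Nonempty) {ε : ℝ} (hε : 0 < ε)
    {η : ℝ≥0∞} (hη : 0 < η) :
    ∃ b' : PeriodicBall T α, closedBall b'.center b'.radius ⊆ closedBall b.center b.radius ∧
      b'.radius ≤ ε ∧
      (∀ ω, ∀ S, MeasurableSet S → siteMeasure (dynPotential T b'.center ω) S ≤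
        siteMeasure (dynPotential T b.center ω) S + η) ∧
      ∀ g ∈ closedBall b'.center b'.radius,
        ∃ E ∈ U, ∀ ω, E ∉ spectrum ℝ (dynSchrodinger T g ω) := by
  obtain ⟨N, hN, hper, hnear⟩ := b.hasPeriod.exists_gap_near hα hmin b.period_mem hU hne
  obtain ⟨δ, hδ, hsite⟩ := hper.exists_siteMeasure_le_add hmin hN.1 0 hη
  have hρ := half_pos b.radius_pos
  obtain ⟨f', hf', hf'b, E, hEU, hE⟩ :=
    hnear (min (δ / 2) (b.radius / 2)) (lt_min (half_pos hδ) hρ)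
  obtain ⟨t, ht, hgap⟩ := nhds_basis_closedBall.eventually_iff.1 hE
  refine ⟨⟨N, f', min (min ε t) (b.radius / 2), hN, hf', lt_min (lt_min hε ht) hρ⟩,
    closedBall_subset_closedBall' ?_, (min_le_left _ _).trans (min_le_left _ _), ?_, ?_⟩
  · rw [dist_eq_norm]
    linarith [min_le_right (min ε t) (b.radius / 2), hf'b.trans (min_le_right _ _)]
  · exact hsite f' hf' ((hf'b.trans (min_le_left _ _)).trans_lt (half_lt_self hδ))
  · refine fun g hg => ⟨E, hEU, hgap ?_⟩
    exact closedBall_subset_closedBall ((min_le_left _ _).trans (min_le_right _ _)) hg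

lemma PeriodicBall.exists_seq (hα : ∀ ω, T ω = ω + α) (hmin : IsMinimalHomeo T)
    (b₀ : PeriodicBall T α) :
    ∃ b : ℕ → PeriodicBall T α, b 0 = b₀ ∧
      (∀ j, closedBall (b (j + 1)).center (b (j + 1)).radius ⊆
        closedBall (b j).center (b j).radius) ∧
      Tendsto (fun j => (b j).radius) atTop (𝓝 0) ∧
      (∀ j ω, ∀ S, MeasurableSet S → siteMeasure (dynPotential T (b (j + 1)).center ω) S ≤
        siteMeasure (dynPotential T (b j).center ω) S + 2⁻¹ ^ (j + 1)) ∧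
      ∀ U : Set ℝ, IsOpen U → U.Nonempty → ∃ j, ∀ g ∈ closedBall (b j).center (b j).radius,
        ∃ E ∈ U, ∀ ω, E ∉ spectrum ℝ (dynSchrodinger T g ω) := by
  obtain ⟨B, hBc, hB0, hB⟩ := TopologicalSpace.exists_countable_basis ℝ
  obtain ⟨U₀, hU₀, -, -⟩ := hB.exists_subset_of_mem_open (Set.mem_univ (0 : ℝ)) isOpen_univ
  obtain ⟨U, rfl⟩ := hBc.exists_eq_range ⟨U₀, hU₀⟩
  have hne (j : ℕ) : (U j).Nonempty :=
    Set.nonempty_iff_ne_empty.2 fun h => hB0 (h ▸ Set.mem_range_self j)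
  choose next hsub hrad hsite hgap using fun (j : ℕ) (b : PeriodicBall T α) =>
    b.exists_refinement hα hmin (hB.isOpen (Set.mem_range_self j)) (hne j)
      (by positivity : (0 : ℝ) < (1 / 2) ^ j) (η := 2⁻¹ ^ (j + 1)) (ENNReal.pow_pos (by simp) _)
  let b (j : ℕ) : PeriodicBall T α := Nat.rec b₀ next j
  refine ⟨b, rfl, fun j => hsub j (b j), ?_, fun j => hsite j (b j), fun O hO ⟨x, hx⟩ => ?_⟩
  · refine (tendsto_add_atTop_iff_nat 1).1 (squeeze_zero (fun j => (b (j + 1)).radius_pos.le)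
      (fun j => hrad j (b j)) ?_)
    exact tendsto_pow_atTop_nhds_zero_of_lt_one (by norm_num) (by norm_num)
  · obtain ⟨_, ⟨j, rfl⟩, -, hjO⟩ := hB.exists_subset_of_mem_open hx hO
    refine ⟨j + 1, fun g hg => ?_⟩
    obtain ⟨E, hE, hEg⟩ := hgap j (b j) g hg
    exact ⟨E, hjO hE, hEg⟩

lemma PeriodicBall.exists_mem_absolutelyContinuous (hα : ∀ ω, T ω = ω + α)
    (hmin : IsMinimalHomeo T) (b₀ : PeriodicBall T α) :
    ∃ f ∈ closedBall b₀.center b₀.radius, ∀ ω, siteMeasure (dynPotential T f ω) ≪ volume ∧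
      interior (spectrum ℝ (dynSchrodinger T f ω)) = ∅ := by
  obtain ⟨b, hb0, hsub, hrad, hsite, hgap⟩ := b₀.exists_seq hα hmin
  subst hb0
  obtain ⟨f, hf⟩ := nonempty_iInter_closedBall_of_subset (c := fun j => (b j).center)
    (fun j => (b j).radius_pos.le) hrad hsub
  rw [Set.mem_iInter] at hf
  have hlim : Tendsto (fun j => (b j).center) atTop (𝓝 f) := tendsto_iff_dist_tendsto_zero.2
    (squeeze_zero (fun _ => dist_nonneg) (fun j => mem_closedBall'.1 (hf j)) hrad)
  have hac (j : ℕ) (ω : Ω) : siteMeasure (dynPotential T (b j).center ω) ≪ volume :=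
    siteMeasure_absolutelyContinuous (b j).period_mem.1 ((b j).hasPeriod.dynPotential_add ω)
  refine ⟨f, hf 0, fun ω => ⟨?_, ?_⟩⟩
  · exact siteMeasure_absolutelyContinuous_of_tendsto
      (((continuous_dynPotential ω).tendsto f).comp hlim) (fun j => hac j ω) fun j => hsite j ω
  · by_contra hne
    obtain ⟨j, hj⟩ := hgap _ isOpen_interior (Set.nonempty_iff_ne_empty.2 hne)
    obtain ⟨E, hE, hEω⟩ := hj f (hf j)
    exact hEω ω (interior_subset hE)

lemma exists_dense_ac (hα : ∀ ω, T ω = ω + α) (hmin : IsMinimalHomeo T) :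
    ∃ D : Set C(Ω, ℝ), Dense D ∧ ∀ f ∈ D, ∀ ω : Ω,
      IsCantorSet (spectrum ℝ (dynSchrodinger T f ω)) ∧
      0 < volume (spectrum ℝ (dynSchrodinger T f ω)) ∧
      HasPurelyACSpectrum (dynSchrodinger T f ω) (isSelfAdjoint_dynSchrodinger T f ω) := by
  refine ⟨{f | ∀ ω, siteMeasure (dynPotential T f ω) ≪ volume ∧
    interior (spectrum ℝ (dynSchrodinger T f ω)) = ∅}, dense_iff.2 fun g r hr => ?_,
    fun f hf ω => ?_⟩
  · obtain ⟨p, hp, f₀, hf₀, hf₀g⟩ := exists_hasPeriod_near hα hmin g (by positivity : 0 < r / 3)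
    obtain ⟨f, hff₀, hf⟩ := PeriodicBall.exists_mem_absolutelyContinuous hα hmin
      ⟨p, f₀, r / 3, hp, hf₀, by positivity⟩
    refine ⟨f, ?_, hf⟩
    rw [← dist_eq_norm] at hf₀g
    rw [mem_closedBall] at hff₀
    rw [mem_ball]
    linarith [dist_triangle f f₀ g]
  · have hac : HasPurelyACSpectrum (dynSchrodinger T f ω) (isSelfAdjoint_dynSchrodinger T f ω) :=
      hasPurelyACSpectrum_of_single _ fun m => by
        have hshift := spectralMeasure_single (dynPotential_zpow (T := T) f ω m)
        exact hshift ▸ (hf _).1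
    have hne : siteVector ≠ 0 := norm_ne_zero_iff.1 (norm_siteVector.trans_ne one_ne_zero)
    exact ⟨isCantorSet_spectrum (isSelfAdjoint_dynSchrodinger T f ω)
      (fun _ _ => hac.eq_zero_of_eigenvector) (hf ω).2,
      measure_spectrum_pos hne (hac siteVector), hac⟩

end AbsolutelyContinuous

theorem theorem1 {Ω : Type*} [AddCommGroup Ω] [TopologicalSpace Ω] [IsCantorGroup Ω]
    (T : Ω ≃ₜ Ω) (hT : IsTranslation T) (hmin : IsMinimalHomeo T) :
    (∃ D : Set C(Ω, ℝ), Dense D ∧ ∀ f ∈ D, ∀ ω : Ω,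
      IsCantorSet (spectrum ℝ (dynSchrodinger T f ω)) ∧
      0 < volume (spectrum ℝ (dynSchrodinger T f ω)) ∧
      HasPurelyACSpectrum (dynSchrodinger T f ω) (isSelfAdjoint_dynSchrodinger T f ω)) ∧
    (∃ G : Set C(Ω, ℝ), IsGδ G ∧ Dense G ∧ ∀ f ∈ G, ∀ ω : Ω,
      IsCantorSet (spectrum ℝ (dynSchrodinger T f ω)) ∧
      volume (spectrum ℝ (dynSchrodinger T f ω)) = 0 ∧
      HasPurelySCSpectrum (dynSchrodinger T f ω) (isSelfAdjoint_dynSchrodinger T f ω)) := by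
  obtain ⟨α, hα⟩ := hT
  exact ⟨exists_dense_ac hα hmin, exists_dense_isGδ_sc hα hmin⟩
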